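/- Let $d\ge 2$, $\frac{3}{2d}<H<\frac34$, and let $B=(B_t)_{t\ge 0}$ be a $d$-dimensional fractional Brownian motion with Hurst parameter $H$, i.e. a centered Gaussian process in $\mathbb R^d$ with $\mathbb E[B^{(i)}_tB^{(j)}_s]=\frac{\delta_{i,j}}2(t^{2H}+s^{2H}-|t-s|^{2H})$. Let $\mathfrak H$ be the completion of the step functions on $[0,\infty)$ for the inner product with $\langle 1_{[a,b]},1_{[a',b']}\rangle_{\mathfrak H}=\mathbb E[(B^{(1)}_b-B^{(1)}_a)(B^{(1)}_{b'}-B^{(1)}_{a'})]$. For $f\in\mathfrak H^d$ let $B(f)=\sum_j B^{(j)}(f_j)$, where $B^{(j)}$ is the linear isometry from $\mathfrak H$ into $L^2(\Omega)$ with $B^{(j)}(1_{[0,t]})=B^{(j)}_t$. Let $I_n$ be the $n$-th multiple integral, i.e. the continuous linear map from the symmetric Hilbert tensor power $(\mathfrak H^d)^{\odot n}$ to $L^2(\Omega)$ with $I_n(f^{\otimes n})=H_n(B(f))$ for $\|f\|_{\mathfrak H^d}=1$, where $H_n(x)=(-1)^ne^{x^2/2}\frac{d^n}{dx^n}e^{-x^2/2}$.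 For $q\ge 1$, $\varepsilon>0$ and $T\ge 0$ let $h^\varepsilon_{2q,T}=\int_{0\le s\le t\le T}f^\varepsilon_{2q,s,t}\,ds\,dt$, an integral in $(\mathfrak H^d)^{\odot 2q}$, where for $\mathbf i=(i_1,\dots,i_{2q})\in\{1,\dots,d\}^{2q}$ $$f^\varepsilon_{2q,s,t}(\mathbf i,x_1,\dots,x_{2q})=(-1)^q\frac{(2\pi)^{-d/2}\alpha(\mathbf i)}{(2q)!}\bigl(\varepsilon+(t-s)^{2H}\bigr)^{-\frac d2-q}\prod_{j=1}^{2q}1_{[s,t]}(x_j)$$ and $\alpha(\mathbf i)=\mathbb E[X_{i_1}\cdots X_{i_{2q}}]$ with $X_1,\dots,X_d$ independent standard Gaussian variables. For $x,u_1,u_2\ge 0$ and $\varepsilon>0$ put $\mu(x,u_1,u_2)=\mathbb E[B^{(1)}_{u_1}(B^{(1)}_{x+u_2}-B^{(1)}_x)]$, $$G^{(q)}_{\varepsilon,x}(u_1,u_2)=(\varepsilon+u_1^{2H})^{-\frac d2-q}(\varepsilon+u_2^{2H})^{-\frac d2-q}\mu(x,u_1,u_2)^{2q},$$ $$F_{\varepsilon,x}(u_1,u_2)=\mathrm{Cov}\bigl[p_\varepsilon(B_{u_1}),p_\varepsilon(B_{x+u_2}-B_x)\bigr],\qquad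 p_\varepsilon(y)=(2\pi\varepsilon)^{-d/2}e^{-\|y\|^2/(2\varepsilon)},$$ $$\beta_q=\frac{1}{(2\pi)^d2^{2q}}\sum_{q_1+\dots+q_d=q}\frac{(2q_1)!\cdots(2q_d)!}{(q_1!)^2\cdots(q_d!)^2}.$$ Then the functions $(x,u_1,u_2)\mapsto G^{(q)}_{1,x}(u_1,u_2)$, $q\ge 1$, and $(x,u_1,u_2)\mapsto F_{1,x}(u_1,u_2)$ are integrable on $\mathbb R_+^3$. With the finite constants $$\sigma_q^2=2\beta_q\int_{\mathbb R_+^3}G^{(q)}_{1,x}(u_1,u_2)\,dx\,du_1\,du_2,\qquad \sigma^2=2\int_{\mathbb R_+^3}F_{1,x}(u_1,u_2)\,dx\,du_1\,du_2,$$ one has, for all $T_1,T_2\ge 0$ and all $q\ge 1$, $$\lim_{\varepsilon\to 0^+}\varepsilon^{d-\frac{3}{2H}}\,\mathbb E\bigl[I_{2q}(h^\varepsilon_{2q,T_1})\,I_{2q}(h^\varepsilon_{2q,T_2})\bigr]=\sigma_q^2\,(T_1\wedge T_2),$$ and moreover $\sum_{q=1}^\infty\sigma_q^2=\sigma^2<\infty$.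 -/

import Mathlib

open MeasureTheory ProbabilityTheory Filter Topology
open scoped NNReal TensorProduct

noncomputable section

namespace SelfIntersection

/-! ### Hilbert tensor powers of a real inner product space -/

section TensorPower

variable {K : Type*} [NormedAddCommGroup K] [InnerProductSpace ℝ K]

/-- The bilinear form on the algebraic tensor power `K ⊗ ⋯ ⊗ K` determined by
`(x₁ ⊗ ⋯ ⊗ xₙ, y₁ ⊗ ⋯ ⊗ yₙ) ↦ ∏ ⟪xₖ, yₖ⟫`. -/
def tensorForm (n : ℕ) (K : Type*) [NormedAddCommGroup K] [InnerProductSpace ℝ K] :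
    (⨂[ℝ] _ : Fin n, K) →ₗ[ℝ] (⨂[ℝ] _ : Fin n, K) →ₗ[ℝ] ℝ :=
  (PiTensorProduct.dualDistrib (R := ℝ) (M := fun _ : Fin n => K)) ∘ₗ
    PiTensorProduct.map (fun _ : Fin n => (innerₗ K : K →ₗ[ℝ] Module.Dual ℝ K))

theorem tensorForm_tprod {n : ℕ} (x y : Fin n → K) :
    tensorForm n K (PiTensorProduct.tprod ℝ x) (PiTensorProduct.tprod ℝ y) =
      ∏ k, inner ℝ (x k) (y k) := by
  rw [tensorForm, LinearMap.comp_apply, PiTensorProduct.map_tprod]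
  exact PiTensorProduct.dualDistrib_apply _ _

theorem exists_sum_tprod {n : ℕ} (t : ⨂[ℝ] _ : Fin n, K) :
    ∃ (m : ℕ) (c : Fin m → ℝ) (x : Fin m → Fin n → K),
      t = ∑ a, c a • PiTensorProduct.tprod ℝ (x a) := by
  have h : t ∈ Submodule.span ℝ (Set.range (PiTensorProduct.tprod ℝ (s := fun _ : Fin n => K))) := by
    rw [PiTensorProduct.span_tprod_eq_top]
    exact Submodule.mem_top
  rw [Submodule.mem_span_set'] at h
  obtain ⟨m, c, g, rfl⟩ := h
  choose x hx using fun a => (g a).2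
  exact ⟨m, c, x, Finset.sum_congr rfl fun a _ => by rw [hx a]⟩

theorem posSemidef_prod_inner {n m : ℕ} (x : Fin m → Fin n → K) (s : Finset (Fin n)) :
    (Matrix.of fun a b : Fin m => ∏ k ∈ s, inner ℝ (x a k) (x b k)).PosSemidef := by
  classical
  induction s using Finset.induction_on with
  | empty =>
    have h := Matrix.posSemidef_gram ℝ (fun _ : Fin m => (1 : ℝ))
    have e : Matrix.gram ℝ (fun _ : Fin m => (1 : ℝ)) =
        Matrix.of fun a b : Fin m => ∏ k ∈ (∅ : Finset (Fin n)), inner ℝ (x a k) (x b k) := by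
      ext a b
      simp [Matrix.gram_apply]
    exact e ▸ h
  | insert k s hk ih =>
    have h := (Matrix.posSemidef_gram ℝ (fun a : Fin m => x a k)).hadamard ih
    have e : (Matrix.gram ℝ (fun a : Fin m => x a k)).hadamard
          (Matrix.of fun a b : Fin m => ∏ k ∈ s, inner ℝ (x a k) (x b k)) =
        Matrix.of fun a b : Fin m => ∏ k ∈ insert k s, inner ℝ (x a k) (x b k) := by
      ext a b
      simp [Matrix.gram_apply, Matrix.hadamard_apply, Finset.prod_insert hk]
    exact e ▸ h

theorem tensorForm_symm {n : ℕ} (s t : ⨂[ℝ] _ : Fin n, K) :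
    tensorForm n K s t = tensorForm n K t s := by
  obtain ⟨m, c, x, rfl⟩ := exists_sum_tprod s
  obtain ⟨m', c', x', rfl⟩ := exists_sum_tprod t
  simp only [map_sum, map_smul, LinearMap.sum_apply, LinearMap.smul_apply, tensorForm_tprod,
    smul_eq_mul, Finset.mul_sum]
  rw [Finset.sum_comm]
  refine Finset.sum_congr rfl fun a _ => Finset.sum_congr rfl fun b _ => ?_
  rw [Finset.prod_congr rfl fun k _ => real_inner_comm (x a k) (x' b k)]
  ring

theorem tensorForm_self_nonneg {n : ℕ} (t : ⨂[ℝ] _ : Fin n, K) : 0 ≤ tensorForm n K t t := by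
  obtain ⟨m, c, x, rfl⟩ := exists_sum_tprod t
  have h := (posSemidef_prod_inner x Finset.univ).dotProduct_mulVec_nonneg c
  simp only [dotProduct, Matrix.mulVec, Matrix.of_apply, Pi.star_apply, star_trivial,
    Finset.mul_sum] at h
  simp only [map_sum, map_smul, LinearMap.sum_apply, LinearMap.smul_apply, tensorForm_tprod,
    smul_eq_mul, Finset.mul_sum]
  rw [Finset.sum_comm]
  refine h.trans_eq (Finset.sum_congr rfl fun a _ => Finset.sum_congr rfl fun b _ => by ring)

/-- The algebraic tensor power `K ⊗ ⋯ ⊗ K` (`n` factors), as a type of its own that carries the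
semi-inner product `tensorForm`. -/
def AlgTensor (n : ℕ) (K : Type*) [NormedAddCommGroup K] [InnerProductSpace ℝ K] : Type _ :=
  ⨂[ℝ] _ : Fin n, K

instance (n : ℕ) : AddCommGroup (AlgTensor n K) :=
  inferInstanceAs (AddCommGroup (⨂[ℝ] _ : Fin n, K))

instance (n : ℕ) : Module ℝ (AlgTensor n K) :=
  inferInstanceAs (Module ℝ (⨂[ℝ] _ : Fin n, K))

/-- The inner product of the algebraic tensor power. -/
@[reducible]
def algTensorCore (n : ℕ) (K : Type*) [NormedAddCommGroup K] [InnerProductSpace ℝ K] :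
    PreInnerProductSpace.Core ℝ (AlgTensor n K) where
  inner s t := tensorForm n K s t
  conj_inner_symm s t := tensorForm_symm t s
  re_inner_nonneg t := tensorForm_self_nonneg t
  add_left r s t := LinearMap.map_add₂ (tensorForm n K) r s t
  smul_left s t r := LinearMap.map_smul₂ (tensorForm n K) r s t

instance (n : ℕ) : SeminormedAddCommGroup (AlgTensor n K) :=
  @InnerProductSpace.Core.toSeminormedAddCommGroup ℝ _ _ _ _ (algTensorCore n K)

instance (n : ℕ) : InnerProductSpace ℝ (AlgTensor n K) :=
  InnerProductSpace.ofCore (algTensorCore n K)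

/-- The Hilbert tensor power `K^{⊗ n}`: the completion of the algebraic tensor power. -/
abbrev HTensor (n : ℕ) (K : Type*) [NormedAddCommGroup K] [InnerProductSpace ℝ K] : Type _ :=
  UniformSpace.Completion (AlgTensor n K)

/-- The elementary tensor `x₁ ⊗ ⋯ ⊗ xₙ` in `K^{⊗ n}`. -/
def tens {n : ℕ} (x : Fin n → K) : HTensor n K :=
  UniformSpace.Completion.coe' (α := AlgTensor n K) (PiTensorProduct.tprod ℝ x)

theorem inner_tens {n : ℕ} (x y : Fin n → K) :
    inner ℝ (tens x) (tens y) = ∏ k, inner ℝ (x k) (y k) := by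
  exact (UniformSpace.Completion.inner_coe (𝕜 := ℝ) (E := AlgTensor n K) _ _).trans
    (tensorForm_tprod x y)

/-- The symmetric tensor power `K^{⊙ n}`: the closed subspace of `K^{⊗ n}` generated by the
powers `f^{⊗ n}` of the unit vectors `f` of `K`. -/
def symTensor (n : ℕ) (K : Type*) [NormedAddCommGroup K] [InnerProductSpace ℝ K] :
    Submodule ℝ (HTensor n K) :=
  (Submodule.span ℝ (Set.range fun f : Metric.sphere (0 : K) 1 =>
    tens (fun _ : Fin n => (f : K)))).topologicalClosure

instance (n : ℕ) : CompleteSpace (symTensor n K) :=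
  inferInstanceAs (CompleteSpace (Submodule.topologicalClosure _))

/-- The power `f^{⊗ n}` of a unit vector `f`, as an element of the symmetric tensor power. -/
def symPow (n : ℕ) (f : Metric.sphere (0 : K) 1) : symTensor n K :=
  ⟨tens (fun _ : Fin n => (f : K)),
    Submodule.le_topologicalClosure _ (Submodule.subset_span ⟨f, rfl⟩)⟩

end TensorPower

/-! ### Fractional Brownian motion, its Hilbert space and its multiple integrals -/

section FBM

variable {Ω : Type*} [MeasurableSpace Ω] {d : ℕ}

/-- `B` is a `d`-dimensional fractional Brownian motion with Hurst parameter `H` under `P`: a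
centered Gaussian process in `ℝ^d` with
`E[B_t^{(i)} B_s^{(j)}] = δ_{ij} (t^{2H} + s^{2H} - |t - s|^{2H}) / 2`. -/
structure IsFBM (H : ℝ) (B : ℝ≥0 → Ω → EuclideanSpace ℝ (Fin d)) (P : Measure Ω) : Prop where
  gaussian : IsGaussianProcess B P
  centered : ∀ (t : ℝ≥0) (i : Fin d), ∫ ω, B t ω i ∂P = 0
  covariance : ∀ (t s : ℝ≥0) (i j : Fin d), ∫ ω, B t ω i * B s ω j ∂P =
    if i = j then
      ((t : ℝ) ^ (2 * H) + (s : ℝ) ^ (2 * H) - |(t : ℝ) - (s : ℝ)| ^ (2 * H)) / 2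
    else 0

open Classical in
/-- The class in `L²(P)` of a square integrable random variable (and `0` for other functions). -/
def toL2 (P : Measure Ω) (F : Ω → ℝ) : Lp ℝ 2 P :=
  if h : MemLp F 2 P then h.toLp F else 0

/-- The step functions on `[0, ∞)`: a formal finite sum `∑ c_t · t` stands for the step function
`∑ c_t 1_{[0,t]}`. The process and the measure are parameters because they determine the inner
product. -/
def Step (_B : ℝ≥0 → Ω → EuclideanSpace ℝ (Fin d)) (_P : Measure Ω) : Type :=
  ℝ≥0 →₀ ℝ

variable (B : ℝ≥0 → Ω → EuclideanSpace ℝ (Fin d)) (P : Measure Ω)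

instance : AddCommGroup (Step B P) := inferInstanceAs (AddCommGroup (ℝ≥0 →₀ ℝ))

instance : Module ℝ (Step B P) := inferInstanceAs (Module ℝ (ℝ≥0 →₀ ℝ))

/-- The linear map `1_{[0,t]} ↦ B_t^{(j)}` from step functions to `L²(P)`. -/
def wienerStep (j : Fin d) : Step B P →ₗ[ℝ] Lp ℝ 2 P :=
  Finsupp.linearCombination ℝ (fun t : ℝ≥0 => toL2 P (fun ω => B t ω j))

/-- The step function `1_{[s,t]}`, for `s ≤ t`. -/
def stepInd (s t : ℝ≥0) : Step B P :=
  (Finsupp.single t 1 - Finsupp.single s 1 : ℝ≥0 →₀ ℝ)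

variable [NeZero d]

/-- The inner product of step functions, which is determined by
`⟪1_{[a,b]}, 1_{[a',b']}⟫ = E[(B_b^{(1)} - B_a^{(1)}) (B_{b'}^{(1)} - B_{a'}^{(1)})]`. The first
component of the process has the index `0`. -/
@[reducible]
def stepCore : PreInnerProductSpace.Core ℝ (Step B P) where
  inner f g := inner ℝ (wienerStep B P 0 f) (wienerStep B P 0 g)
  conj_inner_symm f g := inner_conj_symm _ _
  re_inner_nonneg f := inner_self_nonneg
  add_left f g h := by rw [map_add, inner_add_left]
  smul_left f g r := by rw [map_smul, inner_smul_left]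

instance : SeminormedAddCommGroup (Step B P) :=
  @InnerProductSpace.Core.toSeminormedAddCommGroup ℝ _ _ _ _ (stepCore B P)

instance : InnerProductSpace ℝ (Step B P) :=
  InnerProductSpace.ofCore (stepCore B P)

/-- The Hilbert space `ℌ`: the completion of the space of step functions. -/
abbrev HSpace : Type := UniformSpace.Completion (Step B P)

/-- The indicator `1_{[s,t]}` as an element of `ℌ`, for `s ≤ t`. -/
def ind (s t : ℝ≥0) : HSpace B P :=
  UniformSpace.Completion.coe' (stepInd B P s t)

/-- The Hilbert space `ℌ^d`. -/
abbrev HSpaceD : Type := PiLp 2 (fun _ : Fin d => HSpace B P)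

/-- `f ↦ B^{(j)}(f)`: the continuous extension to `ℌ` of `1_{[0,t]} ↦ B_t^{(j)}`. -/
def wiener (j : Fin d) : HSpace B P →L[ℝ] Lp ℝ 2 P :=
  (wienerStep B P j).extendOfNorm
    (UniformSpace.Completion.toComplL (𝕜 := ℝ) (E := Step B P)).toLinearMap

/-- `B(f) = ∑_j B^{(j)}(f_j)` for `f ∈ ℌ^d`. -/
def isonormal (f : HSpaceD B P) : Lp ℝ 2 P :=
  ∑ j, wiener B P j (f j)

/-- The multiple integral `I_n`. On the symmetric tensor power it is the continuous linear
extension of `f^{⊗ n} ↦ H_n(B(f))`, `‖f‖ = 1`, where `H_n` is the `n`-th (probabilists') Hermite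
polynomial; on a general `h ∈ (ℌ^d)^{⊗ n}` it is the value at the symmetrization of `h`, that is,
at the orthogonal projection of `h` onto the symmetric tensor power. -/
def multInt (n : ℕ) : HTensor n (HSpaceD B P) →L[ℝ] Lp ℝ 2 P :=
  ((Finsupp.linearCombination ℝ (fun f : Metric.sphere (0 : HSpaceD B P) 1 =>
      toL2 P (fun ω => Polynomial.aeval (isonormal B P (f : HSpaceD B P) ω)
        (Polynomial.hermite n)))).extendOfNorm
    (Finsupp.linearCombination ℝ (symPow (K := HSpaceD B P) n))) ∘L
  (symTensor n (HSpaceD B P)).orthogonalProjectionOnto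

end FBM

/-! ### The chaos kernels of the self-intersection local time -/

/-- `α(i₁, …, iₙ) = E[X_{i₁} ⋯ X_{iₙ}]` for independent standard Gaussian `X₁, …, X_d`. -/
def gaussMoment {d n : ℕ} (i : Fin n → Fin d) : ℝ :=
  ∫ x : Fin d → ℝ, ∏ k, x (i k) ∂(Measure.pi fun _ : Fin d => gaussianReal 0 1)

section Kernels

variable {Ω : Type*} [MeasurableSpace Ω] {d : ℕ} [NeZero d]

/-- The kernel `f_{2q,s,t}^ε ∈ (ℌ^d)^{⊗ 2q}`, for `0 ≤ s ≤ t`, whose component with multi-index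
`i` is
`(-1)^q (2π)^{-d/2} α(i) / (2q)! · (ε + (t-s)^{2H})^{-d/2-q} ∏_j 1_{[s,t]}(x_j)`. -/
def kernelInc (H : ℝ) (B : ℝ≥0 → Ω → EuclideanSpace ℝ (Fin d)) (P : Measure Ω)
    (q : ℕ) (ε s t : ℝ) : HTensor (2 * q) (HSpaceD B P) :=
  ∑ i : Fin (2 * q) → Fin d,
    ((-1) ^ q * ((2 * Real.pi) ^ (-(d : ℝ) / 2) * gaussMoment i / (Nat.factorial (2 * q) : ℝ)) *
      (ε + (t - s) ^ (2 * H)) ^ (-(d : ℝ) / 2 - q)) •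
    tens (fun k : Fin (2 * q) =>
      (WithLp.toLp 2 (Pi.single (i k) (ind B P s.toNNReal t.toNNReal)) : HSpaceD B P))

/-- The kernel `h_{2q,T}^ε = ∫_{0 ≤ s ≤ t ≤ T} f_{2q,s,t}^ε ds dt`. -/
def kernel (H : ℝ) (B : ℝ≥0 → Ω → EuclideanSpace ℝ (Fin d)) (P : Measure Ω)
    (q : ℕ) (ε T : ℝ) : HTensor (2 * q) (HSpaceD B P) :=
  ∫ p in {p : ℝ × ℝ | 0 ≤ p.1 ∧ p.1 ≤ p.2 ∧ p.2 ≤ T}, kernelInc H B P q ε p.1 p.2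

/-! ### The limiting constants -/

/-- `μ(x, u₁, u₂) = E[B_{u₁}^{(1)} (B_{x+u₂}^{(1)} - B_x^{(1)})]`, for `x, u₁, u₂ ≥ 0`. -/
def mu (B : ℝ≥0 → Ω → EuclideanSpace ℝ (Fin d)) (P : Measure Ω) (x u₁ u₂ : ℝ) : ℝ :=
  ∫ ω, B u₁.toNNReal ω 0 * (B (x + u₂).toNNReal ω 0 - B x.toNNReal ω 0) ∂P

/-- `G_{ε,x}^{(q)}(u₁, u₂)`, for `x, u₁, u₂ ≥ 0`. -/
def G (H : ℝ) (B : ℝ≥0 → Ω → EuclideanSpace ℝ (Fin d)) (P : Measure Ω)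
    (q : ℕ) (ε x u₁ u₂ : ℝ) : ℝ :=
  (ε + u₁ ^ (2 * H)) ^ (-(d : ℝ) / 2 - q) * (ε + u₂ ^ (2 * H)) ^ (-(d : ℝ) / 2 - q) *
    mu B P x u₁ u₂ ^ (2 * q)

/-- The heat kernel `p_ε(x) = (2πε)^{-d/2} exp(-‖x‖² / (2ε))` on `ℝ^d`. -/
def heatKernel (ε : ℝ) (x : EuclideanSpace ℝ (Fin d)) : ℝ :=
  (2 * Real.pi * ε) ^ (-(d : ℝ) / 2) * Real.exp (-‖x‖ ^ 2 / (2 * ε))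

/-- `F_{ε,x}(u₁, u₂) = Cov[p_ε(B_{u₁}), p_ε(B_{x+u₂} - B_x)]`, for `x, u₁, u₂ ≥ 0`. -/
def F (B : ℝ≥0 → Ω → EuclideanSpace ℝ (Fin d)) (P : Measure Ω) (ε x u₁ u₂ : ℝ) : ℝ :=
  covariance (fun ω => heatKernel ε (B u₁.toNNReal ω))
    (fun ω => heatKernel ε (B (x + u₂).toNNReal ω - B x.toNNReal ω)) P

/-- `α_q = ∑_{q₁ + ⋯ + q_d = q} ∏_j (2 q_j)! / (q_j!)²`. -/
def alphaConst (d q : ℕ) : ℝ :=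
  ∑ m ∈ (Finset.univ : Finset (Fin d)).piAntidiag q,
    ∏ j, (Nat.factorial (2 * m j) : ℝ) / (Nat.factorial (m j) : ℝ) ^ 2

/-- `β_q = α_q / ((2π)^d 2^{2q})`. -/
def betaConst (d q : ℕ) : ℝ :=
  alphaConst d q / ((2 * Real.pi) ^ d * 2 ^ (2 * q))

/-- The octant `ℝ₊³`. -/
def octant : Set (ℝ × ℝ × ℝ) := {v | 0 ≤ v.1 ∧ 0 ≤ v.2.1 ∧ 0 ≤ v.2.2}

/-- `σ_q² = 2 β_q ∫_{ℝ₊³} G_{1,x}^{(q)}(u₁, u₂) dx du₁ du₂`. -/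
def sigmaSqChaos (H : ℝ) (B : ℝ≥0 → Ω → EuclideanSpace ℝ (Fin d)) (P : Measure Ω) (q : ℕ) : ℝ :=
  2 * betaConst d q * ∫ v in octant, G H B P q 1 v.1 v.2.1 v.2.2

/-- `σ² = 2 ∫_{ℝ₊³} F_{1,x}(u₁, u₂) dx du₁ du₂`. -/
def sigmaSq (B : ℝ≥0 → Ω → EuclideanSpace ℝ (Fin d)) (P : Measure Ω) : ℝ :=
  2 * ∫ v in octant, F B P 1 v.1 v.2.1 v.2.2

end Kernels

end SelfIntersection

end

/-!
The second moments of the chaos components and their sum are both governed by the covariance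
`μ = covMu H x u₁ u₂` of `B_{u₁}` and `B_{x+u₂} - B_x`, so the probabilistic part consists of two
Gaussian computations, and the rest is analysis of `covMu`.

*Reduction to covariances.* The multiple integral satisfies
`E[I_n(h) I_n(h')] = n! ⟪h, h'⟫` on symmetric tensors (`IsFBM.integral_multInt_mul`): on powers of
unit vectors this is `E[H_n(X) H_n(Y)] = n! ρⁿ` for a Gaussian pair, which follows from integration
by parts, and the powers span a dense subspace. The kernels are symmetric because
`∑ α(i) e_{i₁} ⊗ ⋯ ⊗ e_{iₙ}` is the average of `X^{⊗ n}` for a standard Gaussian vector `X`, and the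
same description gives `∑ α(i)²`. Hence the second moment is `β_q` times the double integral of an
explicit power of increment covariances (`IsFBM.integral_multInt_kernel`). On the other side, writing
the Gaussian kernels as characteristic functions,
`F_{1,x} = (2π)^{-d} (D^{-d/2} - ((1 + u₁^{2H}) (1 + u₂^{2H}))^{-d/2})` with
`D = (1 + u₁^{2H}) (1 + u₂^{2H}) - μ²` (`IsFBM.F_one_eq`).

*The series.* With `z = μ² / ((1 + u₁^{2H}) (1 + u₂^{2H}))` the expansion of `(1 - z)^{-d/2}` has the
numbers `β_q` as coefficients (`hasSum_alphaConst`), so `F_{1,x} = ∑_{q ≥ 1} β_q G^{(q)}_{1,x}` with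
nonnegative terms (`hasSum_chaosG`). Integrability of `F`, of every `G^{(q)}`, and the summation of
the variances all follow once `F` is dominated. By Bernoulli's inequality, `F` is at most a constant
times `z D^{-d/2}` (`covF_le`).

*Integrability* (`integrableOn_domF`). The octant is split according to whether the intervals
`[0, u₁]` and `[x, x + u₂]` are disjoint, overlapping or nested; the lengths `a, b, c` of the
successive gaps between the four endpoints serve as coordinates. Strong local nondeterminism
(`exists_fbmVar_ge`) bounds `D` from below: `|t|^{2H}` is a mixture of functions
`k(0) - k(w t)` with `k` positive definite and compactly supported, so that for large `w` an endpoint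
at distance `R` from the others decouples. Combined with elementary bounds for `z`, this dominates
`z D^{-d/2}` by a product of powers of `1 + a`, `1 + b`, `1 + c`. For disjoint intervals `z` decays
like `(1 + b)^{-2γ}` for any `γ ≤ 2 - 2H`, at the price of `(1 + a)^γ (1 + c)^γ` against
`(1 + a)^{-Hd} (1 + c)^{-Hd}`, so `1/2 < γ < Hd - 1` is needed: such a `γ` exists exactly when
`H < 3/4` and `Hd > 3/2`. The same `γ` works for nested intervals.

*The limit* (`tendsto_integral_chaosCov`). In the coordinates `s, x, u₁, u₂` of the two intervals
`[s, s + u₁]` and `[s + x, s + x + u₂]` the integrand does not depend on `s`. Rescaling `x, u₁, u₂` by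
`r = ε^{1/(2H)}` produces the factor `r^{3 - 2Hd} = ε^{3/(2H) - d}` and reduces `ε` to `1`
(`integral_chaosCov_eq`). As `r → 0` the domain converges to `s ∈ (0, min T₁ T₂)`, `u₁, u₂ ≥ 0`,
`x ∈ ℝ`, and dominated convergence applies. The half `x < 0` is mapped to `x > 0` by exchanging the
two increments, which is the origin of the factor `2`.
-/

noncomputable section

namespace SelfIntersection

/-! ### The first chaos -/

section FirstChaos

variable {Ω : Type*} [MeasurableSpace Ω] {d : ℕ} {H : ℝ}
  {B : ℝ≥0 → Ω → EuclideanSpace ℝ (Fin d)} {P : Measure Ω}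

/-- The covariance of fractional Brownian motion. -/
def fbmCov (H : ℝ) (t s : ℝ≥0) : ℝ :=
  ((t : ℝ) ^ (2 * H) + (s : ℝ) ^ (2 * H) - |(t : ℝ) - (s : ℝ)| ^ (2 * H)) / 2

theorem IsFBM.memLp (hB : IsFBM H B P) (t : ℝ≥0) (j : Fin d) :
    MemLp (fun ω => B t ω j) 2 P :=
  ((hB.gaussian.hasGaussianLaw_eval t).map_fun (EuclideanSpace.proj j)).memLp_two

theorem toL2_coeFn {F : Ω → ℝ} (h : MemLp F 2 P) : toL2 P F =ᵐ[P] F := by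
  rw [toL2, dif_pos h]
  exact h.coeFn_toLp

theorem inner_toL2 {F G : Ω → ℝ} (hF : MemLp F 2 P) (hG : MemLp G 2 P) :
    inner ℝ (toL2 P F) (toL2 P G) = ∫ ω, F ω * G ω ∂P := by
  rw [L2.inner_def]
  refine integral_congr_ae ?_
  filter_upwards [toL2_coeFn hF, toL2_coeFn hG] with ω h₁ h₂
  rw [h₁, h₂]
  simp [mul_comm]

theorem IsFBM.inner_toL2_coord (hB : IsFBM H B P) (t s : ℝ≥0) (i j : Fin d) :
    inner ℝ (toL2 P (fun ω => B t ω i)) (toL2 P (fun ω => B s ω j)) =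
      if i = j then fbmCov H t s else 0 := by
  rw [inner_toL2 (hB.memLp t i) (hB.memLp s j), hB.covariance, fbmCov]

/-- The coefficients of a step function with respect to the indicators `1_{[0,t]}`: the inclusion
into finitely supported functions, forgetting the inner product. -/
def stepCoeff (f : Step B P) : ℝ≥0 →₀ ℝ := f

theorem wienerStep_eq_sum (j : Fin d) (f : Step B P) :
    wienerStep B P j f = (stepCoeff f).sum fun t a => a • toL2 P (fun ω => B t ω j) :=
  Finsupp.linearCombination_apply ..

theorem IsFBM.inner_wienerStep_sum (hB : IsFBM H B P) (i j : Fin d) (f g : Step B P) :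
    inner ℝ (wienerStep B P i f) (wienerStep B P j g) =
      if i = j then (stepCoeff f).sum fun t a => (stepCoeff g).sum fun s b =>
        a * (b * fbmCov H t s) else 0 := by
  rw [wienerStep_eq_sum, wienerStep_eq_sum]
  split_ifs with hij
  · simp only [Finsupp.sum, sum_inner, inner_sum, inner_smul_left, inner_smul_right,
      hB.inner_toL2_coord, hij, if_true, conj_trivial, Finset.mul_sum]
    rw [Finset.sum_comm]
    exact Finset.sum_congr rfl fun _ _ => Finset.sum_congr rfl fun _ _ => by ring
  · simp only [Finsupp.sum, sum_inner, inner_sum, inner_smul_left, inner_smul_right,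
      hB.inner_toL2_coord, hij, if_false, mul_zero, Finset.sum_const_zero]

variable [NeZero d]

theorem inner_step (f g : Step B P) :
    inner ℝ f g = inner ℝ (wienerStep B P 0 f) (wienerStep B P 0 g) := rfl

theorem IsFBM.inner_wienerStep (hB : IsFBM H B P) (i j : Fin d) (f g : Step B P) :
    inner ℝ (wienerStep B P i f) (wienerStep B P j g) = if i = j then inner ℝ f g else 0 := by
  rw [inner_step, hB.inner_wienerStep_sum i j, hB.inner_wienerStep_sum 0 0]
  simp

theorem IsFBM.norm_wienerStep (hB : IsFBM H B P) (j : Fin d) (f : Step B P) :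
    ‖wienerStep B P j f‖ = ‖f‖ := by
  rw [norm_eq_sqrt_real_inner, norm_eq_sqrt_real_inner, hB.inner_wienerStep, if_pos rfl]

theorem IsFBM.wiener_coe (hB : IsFBM H B P) (j : Fin d) (f : Step B P) :
    wiener B P j (f : HSpace B P) = wienerStep B P j f := by
  refine LinearMap.extendOfNorm_eq (f := wienerStep B P j)
    (e := (UniformSpace.Completion.toComplL (𝕜 := ℝ) (E := Step B P)).toLinearMap)
    UniformSpace.Completion.denseRange_coe ⟨1, fun x => ?_⟩ f
  rw [hB.norm_wienerStep, one_mul]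
  exact (UniformSpace.Completion.norm_coe x).ge

theorem IsFBM.inner_wiener (hB : IsFBM H B P) (i j : Fin d) (f g : HSpace B P) :
    inner ℝ (wiener B P i f) (wiener B P j g) = if i = j then inner ℝ f g else 0 := by
  induction f, g using UniformSpace.Completion.induction_on₂ with
  | hp =>
    refine isClosed_eq (by fun_prop) ?_
    split_ifs
    · fun_prop
    · fun_prop
  | ih f g =>
    rw [hB.wiener_coe, hB.wiener_coe, hB.inner_wienerStep, UniformSpace.Completion.inner_coe]

/-- The map `f ↦ B(f)` as a continuous linear map. -/
def isonormalL (B : ℝ≥0 → Ω → EuclideanSpace ℝ (Fin d)) (P : Measure Ω) :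
    HSpaceD B P →L[ℝ] Lp ℝ 2 P :=
  ∑ j, wiener B P j ∘L PiLp.proj 2 (fun _ : Fin d => HSpace B P) j

theorem isonormalL_apply (f : HSpaceD B P) : isonormalL B P f = isonormal B P f := by
  simp [isonormalL, isonormal]

theorem IsFBM.inner_isonormal (hB : IsFBM H B P) (f g : HSpaceD B P) :
    inner ℝ (isonormal B P f) (isonormal B P g) = inner ℝ f g := by
  simp only [isonormal, sum_inner, inner_sum, hB.inner_wiener, PiLp.inner_apply]
  simp

theorem IsFBM.norm_isonormal (hB : IsFBM H B P) (f : HSpaceD B P) :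
    ‖isonormal B P f‖ = ‖f‖ := by
  rw [norm_eq_sqrt_real_inner, norm_eq_sqrt_real_inner, hB.inner_isonormal]

omit [NeZero d] in
/-- A finite linear combination of coordinates of the process is Gaussian, because it is a linear
image of the process restricted to a finite set of times. -/
theorem IsFBM.hasGaussianLaw_sum (hB : IsFBM H B P) (S : Finset ℝ≥0) (c : Fin d → ℝ≥0 → ℝ) :
    HasGaussianLaw (fun ω => ∑ j, ∑ t ∈ S, c j t * B t ω j) P := by
  have h := (hB.gaussian.hasGaussianLaw S).map_fun
    (∑ j : Fin d, ∑ t : S, c j t • ((EuclideanSpace.proj j : EuclideanSpace ℝ (Fin d) →L[ℝ] ℝ) ∘L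
      ContinuousLinearMap.proj (R := ℝ) (φ := fun _ : S => EuclideanSpace ℝ (Fin d)) t))
  refine h.congr (ae_of_all _ fun ω => ?_)
  simp only [_root_.sum_apply, _root_.smul_apply,
    ContinuousLinearMap.comp_apply, ContinuousLinearMap.proj_apply, smul_eq_mul,
    PiLp.proj_apply, Finset.restrict]
  refine Finset.sum_congr rfl fun j _ => ?_
  exact Finset.sum_coe_sort S (fun t => c j t * B t ω j)

omit [NeZero d] in
theorem IsFBM.integral_sum (hB : IsFBM H B P) (S : Finset ℝ≥0) (c : Fin d → ℝ≥0 → ℝ)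
    [IsProbabilityMeasure P] :
    ∫ ω, ∑ j, ∑ t ∈ S, c j t * B t ω j ∂P = 0 := by
  have hi : ∀ t j, Integrable (fun ω => B t ω j) P := fun t j =>
    (hB.memLp t j).integrable one_le_two
  rw [integral_finsetSum _ fun j _ => integrable_finsetSum _ fun t _ => (hi t j).const_mul _]
  refine Finset.sum_eq_zero fun j _ => ?_
  rw [integral_finsetSum _ fun t _ => (hi t j).const_mul _]
  refine Finset.sum_eq_zero fun t _ => ?_
  rw [integral_const_mul, hB.centered, mul_zero]

/-- The Lipschitz bound `|e^{ia} - e^{ib}| ≤ |a - b|`, integrated; it carries the Gaussian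
characteristic function from step functions to their limits in `L²`. -/
theorem lipschitz_charFun [IsProbabilityMeasure P] :
    LipschitzWith 1 (fun Y : Lp ℝ 2 P => ∫ ω, Complex.exp (Complex.I * (Y ω : ℝ)) ∂P) := by
  have hint : ∀ Y : Lp ℝ 2 P, Integrable (fun ω => Complex.exp (Complex.I * (Y ω : ℝ))) P := by
    intro Y
    refine Integrable.of_bound (C := 1) ?_ (ae_of_all _ fun ω => ?_)
    · exact (by fun_prop : Continuous fun x : ℝ =>
        Complex.exp (Complex.I * x)).comp_aestronglyMeasurable (Lp.aestronglyMeasurable Y)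
    · rw [Complex.norm_exp_I_mul_ofReal]
  refine LipschitzWith.of_dist_le_mul fun Y Z => ?_
  rw [NNReal.coe_one, one_mul, dist_eq_norm, dist_eq_norm, ← integral_sub (hint Y) (hint Z)]
  have hD : MemLp (Y - Z : Lp ℝ 2 P) 2 P := Lp.memLp _
  have hD1 : MemLp (Y - Z : Lp ℝ 2 P) 1 P := hD.mono_exponent (by norm_num)
  calc ‖∫ ω, (Complex.exp (Complex.I * (Y ω : ℝ)) - Complex.exp (Complex.I * (Z ω : ℝ))) ∂P‖
      ≤ ∫ ω, ‖(Y - Z : Lp ℝ 2 P) ω‖ ∂P := by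
        refine norm_integral_le_of_norm_le (memLp_one_iff_integrable.1 hD1).norm ?_
        filter_upwards [Lp.coeFn_sub Y Z] with ω h
        rw [h, Pi.sub_apply]
        have e : Complex.exp (Complex.I * (Y ω : ℝ)) - Complex.exp (Complex.I * (Z ω : ℝ)) =
            Complex.exp (Complex.I * (Z ω : ℝ)) *
              (Complex.exp (Complex.I * ((Y ω - Z ω : ℝ) : ℂ)) - 1) := by
          rw [mul_sub, ← Complex.exp_add]
          push_cast
          ring_nf
        rw [e, norm_mul, Complex.norm_exp_I_mul_ofReal, one_mul]
        exact Real.norm_exp_I_mul_ofReal_sub_one_le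
    _ = (eLpNorm (Y - Z : Lp ℝ 2 P) 1 P).toReal := by
        rw [eLpNorm_one_eq_lintegral_enorm, integral_norm_eq_lintegral_enorm hD1.1]
    _ ≤ (eLpNorm (Y - Z : Lp ℝ 2 P) 2 P).toReal :=
        ENNReal.toReal_mono hD.2.ne (eLpNorm_le_eLpNorm_of_exponent_le (by norm_num) hD.1)
    _ = ‖Y - Z‖ := rfl

/-- On step functions `B(f)` is, pointwise almost everywhere, the explicit sum over the jump times. -/
theorem IsFBM.isonormal_coe_ae (hB : IsFBM H B P) (f : Fin d → Step B P) (S : Finset ℝ≥0)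
    (hS : ∀ j, (stepCoeff (f j)).support ⊆ S) :
    isonormal B P (WithLp.toLp 2 fun j => (f j : HSpace B P)) =ᵐ[P]
      fun ω => ∑ j, ∑ t ∈ S, stepCoeff (f j) t * B t ω j := by
  have e : isonormal B P (WithLp.toLp 2 fun j => (f j : HSpace B P)) =
      ∑ j, ∑ t ∈ S, stepCoeff (f j) t • toL2 P (fun ω => B t ω j) := by
    refine Finset.sum_congr rfl fun j _ => ?_
    rw [← Finsupp.sum_of_support_subset (stepCoeff (f j)) (hS j) (fun t a => a • toL2 P (fun ω => B t ω j))
      (by simp)]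
    exact (hB.wiener_coe j (f j)).trans (wienerStep_eq_sum j (f j))
  rw [e]
  refine (Lp.coeFn_finsetSum _ _).trans ?_
  have h1 : ∀ᵐ ω ∂P, ∀ j : Fin d, (∑ t ∈ S, stepCoeff (f j) t • toL2 P (fun ω => B t ω j) : Lp ℝ 2 P) ω =
      ∑ t ∈ S, stepCoeff (f j) t * B t ω j := by
    refine ae_all_iff.2 fun j => ?_
    refine (Lp.coeFn_finsetSum _ _).trans ?_
    have h2 : ∀ᵐ ω ∂P, ∀ t ∈ S, (stepCoeff (f j) t • toL2 P (fun ω => B t ω j) : Lp ℝ 2 P) ω =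
        stepCoeff (f j) t * B t ω j := by
      refine (ae_ball_iff S.countable_toSet).2 fun t _ => ?_
      filter_upwards [Lp.coeFn_smul (stepCoeff (f j) t) (toL2 P (fun ω => B t ω j)),
        toL2_coeFn (hB.memLp t j)] with ω h3 h4
      rw [h3, Pi.smul_apply, h4, smul_eq_mul]
    filter_upwards [h2] with ω hω
    rw [Finset.sum_apply]
    exact Finset.sum_congr rfl fun t ht => hω t ht
  filter_upwards [h1] with ω hω
  rw [Finset.sum_apply]
  exact Finset.sum_congr rfl fun j _ => hω j

/-- The random variable `B(f)` is centered Gaussian with variance `‖f‖²`. -/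
theorem IsFBM.charFun_isonormal [IsProbabilityMeasure P] (hB : IsFBM H B P) (f : HSpaceD B P) :
    ∫ ω, Complex.exp (Complex.I * (isonormal B P f ω : ℝ)) ∂P =
      Complex.exp (-(‖f‖ ^ 2 / 2 : ℝ)) := by
  classical
  have hd : DenseRange fun f : Fin d → Step B P =>
      (WithLp.toLp 2 fun j => (f j : HSpace B P) : HSpaceD B P) :=
    (PiLp.homeomorph 2 (fun _ : Fin d => HSpace B P)).symm.surjective.denseRange.comp
      (DenseRange.piMap fun _ => UniformSpace.Completion.denseRange_coe)
      (PiLp.homeomorph 2 (fun _ : Fin d => HSpace B P)).symm.continuous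
  refine hd.induction_on f (p := fun f => ∫ ω, Complex.exp (Complex.I * (isonormal B P f ω : ℝ)) ∂P =
      Complex.exp (-(‖f‖ ^ 2 / 2 : ℝ))) ?_ fun f => ?_
  · refine isClosed_eq ?_ (by fun_prop)
    simp only [← isonormalL_apply]
    exact lipschitz_charFun.continuous.comp (isonormalL B P).continuous
  · set S : Finset ℝ≥0 := Finset.univ.biUnion fun j => (stepCoeff (f j)).support
    have hS : ∀ j, (stepCoeff (f j)).support ⊆ S := fun j =>
      Finset.subset_biUnion_of_mem (fun j => (stepCoeff (f j)).support) (Finset.mem_univ j)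
    have hae := hB.isonormal_coe_ae f S hS
    set Z : Ω → ℝ := fun ω => ∑ j, ∑ t ∈ S, stepCoeff (f j) t * B t ω j with hZ
    set F : HSpaceD B P := WithLp.toLp 2 fun j => (f j : HSpace B P) with hF
    have hg : HasGaussianLaw Z P := hB.hasGaussianLaw_sum S fun j t => stepCoeff (f j) t
    have hm : ∫ ω, Z ω ∂P = 0 := hB.integral_sum S fun j t => stepCoeff (f j) t
    have hv : Var[Z; P] = ‖F‖ ^ 2 := by
      rw [variance_of_integral_eq_zero hg.aemeasurable hm, ← hB.norm_isonormal F,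
        ← real_inner_self_eq_norm_sq, L2.inner_def]
      refine integral_congr_ae ?_
      filter_upwards [hae] with ω h
      rw [h]
      simp [sq]
    have h1 : ∫ ω, Complex.exp (Complex.I * (isonormal B P F ω : ℝ)) ∂P =
        ∫ ω, Complex.exp ((1 : ℝ) * (Z ω : ℝ) * Complex.I) ∂P := by
      refine integral_congr_ae ?_
      filter_upwards [hae] with ω h
      rw [h]
      push_cast
      ring_nf
    have h2 : ∫ ω, Complex.exp ((1 : ℝ) * (Z ω : ℝ) * Complex.I) ∂P =
        charFun (P.map Z) (1 : ℝ) := by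
      rw [charFun_apply_real, integral_map hg.aemeasurable (by fun_prop)]
    change ∫ ω, Complex.exp (Complex.I * (isonormal B P F ω : ℝ)) ∂P = _
    rw [h1, h2, hg.map_eq_gaussianReal, hm, hv, charFun_gaussianReal]
    congr 1
    simp

/-- The indicator `1_{[0,t]}` as an element of `ℌ`. -/
def indZero (B : ℝ≥0 → Ω → EuclideanSpace ℝ (Fin d)) (P : Measure Ω) (t : ℝ≥0) : HSpace B P :=
  UniformSpace.Completion.coe' (show Step B P from (Finsupp.single t 1 : ℝ≥0 →₀ ℝ))

theorem ind_eq_sub (s t : ℝ≥0) : ind B P s t = indZero B P t - indZero B P s :=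
  UniformSpace.Completion.coe_sub (α := Step B P) _ _

theorem IsFBM.wiener_indZero (hB : IsFBM H B P) (j : Fin d) (t : ℝ≥0) :
    wiener B P j (indZero B P t) = toL2 P (fun ω => B t ω j) := by
  rw [indZero, hB.wiener_coe]
  exact (Finsupp.linearCombination_single ℝ (1 : ℝ) t).trans (one_smul _ _)

theorem IsFBM.inner_indZero (hB : IsFBM H B P) (s t : ℝ≥0) :
    inner ℝ (indZero B P s) (indZero B P t) = fbmCov H s t := by
  have h := hB.inner_wiener 0 0 (indZero B P s) (indZero B P t)
  rw [if_pos rfl, hB.wiener_indZero, hB.wiener_indZero, hB.inner_toL2_coord, if_pos rfl] at h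
  exact h.symm

theorem IsFBM.inner_ind (hB : IsFBM H B P) (s t s' t' : ℝ≥0) :
    inner ℝ (ind B P s t) (ind B P s' t') =
      (|(t : ℝ) - s'| ^ (2 * H) + |(s : ℝ) - t'| ^ (2 * H) - |(t : ℝ) - t'| ^ (2 * H) -
        |(s : ℝ) - s'| ^ (2 * H)) / 2 := by
  simp only [ind_eq_sub, inner_sub_left, inner_sub_right, hB.inner_indZero, fbmCov]
  ring

theorem IsFBM.norm_ind_sq (hB : IsFBM H B P) (hH : 0 < H) (s t : ℝ≥0) :
    ‖ind B P s t‖ ^ 2 = |(t : ℝ) - s| ^ (2 * H) := by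
  rw [← real_inner_self_eq_norm_sq, hB.inner_ind, abs_sub_comm (s : ℝ) t]
  simp [Real.zero_rpow (by positivity : 2 * H ≠ 0)]

theorem IsFBM.continuous_indZero (hB : IsFBM H B P) (hH : 0 < H) :
    Continuous (indZero B P) := by
  have hc : ∀ s t, dist (indZero B P s) (indZero B P t) = √(|(s : ℝ) - t| ^ (2 * H)) := fun s t => by
    rw [dist_eq_norm, ← ind_eq_sub, ← hB.norm_ind_sq hH, Real.sqrt_sq (norm_nonneg _)]
  refine continuous_iff_continuousAt.2 fun t => ?_
  refine tendsto_iff_dist_tendsto_zero.2 ?_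
  simp only [hc]
  have h : Continuous fun s : ℝ≥0 => √(|(s : ℝ) - t| ^ (2 * H)) :=
    ((continuous_abs.comp (NNReal.continuous_coe.sub continuous_const)).rpow_const
      fun _ => Or.inr (by positivity)).sqrt
  have h0 := h.tendsto t
  simpa [Real.zero_rpow (by positivity : 2 * H ≠ 0)] using h0

end FirstChaos


/-! ### Hermite polynomials of correlated Gaussian variables -/

section Hermite

open Polynomial in
theorem integrable_eval_gaussianReal (p : ℝ[X]) :
    Integrable (fun x => p.eval x) (gaussianReal 0 1) := by
  simp only [Polynomial.eval_eq_sum_range]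
  refine integrable_finsetSum _ fun n _ => Integrable.const_mul ?_ _
  have h := (memLp_id_gaussianReal' (μ := 0) (v := 1) n (by simp)).integrable_norm_pow'
  refine (integrable_norm_iff (by fun_prop)).1 ?_
  simpa using h

theorem integral_gaussianReal_std (f : ℝ → ℝ) :
    ∫ x, f x ∂(gaussianReal 0 1) =
      (√(2 * Real.pi))⁻¹ * ∫ x, f x * Real.exp (-x ^ 2 / 2) := by
  rw [integral_gaussianReal_eq_integral_smul one_ne_zero, ← integral_const_mul]
  refine integral_congr_ae (ae_of_all _ fun x => ?_)
  simp [gaussianPDFReal]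
  ring

theorem integrable_gaussianReal_std {f : ℝ → ℝ} (hf : Integrable f (gaussianReal 0 1)) :
    Integrable fun x => f x * Real.exp (-x ^ 2 / 2) := by
  rw [gaussianReal_of_var_ne_zero _ one_ne_zero, integrable_withDensity_iff (by fun_prop)
    (by simp [gaussianPDF])] at hf
  refine (hf.const_mul (√(2 * Real.pi))).congr (ae_of_all _ fun x => ?_)
  have : √(2 * Real.pi) ≠ 0 := by positivity
  simp only [toReal_gaussianPDF, gaussianPDFReal, NNReal.coe_one, mul_one, sub_zero]
  field_simp

open Polynomial in
/-- Gaussian integration by parts for polynomials. -/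
theorem stein_polynomial (p : ℝ[X]) :
    ∫ x, x * p.eval x ∂(gaussianReal 0 1) = ∫ x, p.derivative.eval x ∂(gaussianReal 0 1) := by
  have hX : Integrable (fun x => x * p.eval x) (gaussianReal 0 1) := by
    have := integrable_eval_gaussianReal (X * p)
    simpa only [eval_mul, eval_X] using this
  have hp' := integrable_gaussianReal_std (integrable_eval_gaussianReal p.derivative)
  have hXp := integrable_gaussianReal_std hX
  have h := integral_eq_zero_of_hasDerivAt_of_integrable
    (f := fun x => p.eval x * Real.exp (-x ^ 2 / 2))
    (f' := fun x => p.derivative.eval x * Real.exp (-x ^ 2 / 2) -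
      x * p.eval x * Real.exp (-x ^ 2 / 2))
    (fun x => by
      have h1 := p.hasDerivAt x
      have h2 : HasDerivAt (fun x : ℝ => Real.exp (-x ^ 2 / 2)) (Real.exp (-x ^ 2 / 2) * (-x)) x := by
        have h3 : HasDerivAt (fun x : ℝ => -x ^ 2 / 2) (-x) x := by
          have := ((hasDerivAt_pow 2 x).neg).div_const 2
          convert! this using 1
          simp
          ring
        exact h3.exp
      convert! h1.mul h2 using 1
      ring)
    (hp'.sub hXp) (integrable_gaussianReal_std (integrable_eval_gaussianReal p))
  rw [integral_sub hp' hXp, sub_eq_zero] at h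
  rw [integral_gaussianReal_std, integral_gaussianReal_std, h]

variable {Ω : Type*} [MeasurableSpace Ω] {P : Measure Ω}

/-- `X` and `Y` are jointly Gaussian, standard, with correlation `ρ`; expressed by the
characteristic function of the pair. -/
structure IsCorrelatedPair (X Y : Ω → ℝ) (ρ : ℝ) (P : Measure Ω) : Prop where
  aemeasurable_fst : AEMeasurable X P
  aemeasurable_snd : AEMeasurable Y P
  abs_le : |ρ| ≤ 1
  charFun : ∀ a b : ℝ, ∫ ω, Complex.exp (((a * X ω + b * Y ω : ℝ) : ℂ) * Complex.I) ∂P =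
    Complex.exp (-((a ^ 2 + 2 * a * b * ρ + b ^ 2) / 2 : ℝ))

theorem charFun_gaussianReal_std (a : ℝ) :
    ∫ x : ℝ, Complex.exp ((a * x : ℝ) * Complex.I) ∂(gaussianReal 0 1) =
      Complex.exp (-(a ^ 2 / 2 : ℝ)) := by
  have h := charFun_gaussianReal (μ := 0) (v := 1) a
  rw [charFun_apply_real] at h
  push_cast at h ⊢
  rw [h]
  congr 1
  simp

/-- The pair is distributed like `(N, ρ N + √(1 - ρ²) N')` with `N`, `N'` independent. -/
theorem IsCorrelatedPair.map_eq [IsProbabilityMeasure P] {X Y : Ω → ℝ} {ρ : ℝ}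
    (h : IsCorrelatedPair X Y ρ P) :
    P.map (fun ω => (X ω, Y ω)) = ((gaussianReal 0 1).prod (gaussianReal 0 1)).map
      (fun v : ℝ × ℝ => (v.1, ρ * v.1 + √(1 - ρ ^ 2) * v.2)) := by
  have hm : AEMeasurable (fun ω => (X ω, Y ω)) P := h.aemeasurable_fst.prodMk h.aemeasurable_snd
  have hm' : Measurable (fun v : ℝ × ℝ => (v.1, ρ * v.1 + √(1 - ρ ^ 2) * v.2)) := by fun_prop
  have : IsProbabilityMeasure (P.map (fun ω => (X ω, Y ω))) := Measure.isProbabilityMeasure_map hm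
  have : IsProbabilityMeasure (((gaussianReal 0 1).prod (gaussianReal 0 1)).map
      (fun v : ℝ × ℝ => (v.1, ρ * v.1 + √(1 - ρ ^ 2) * v.2))) :=
    Measure.isProbabilityMeasure_map hm'.aemeasurable
  refine Measure.ext_of_charFunDual (funext fun L => ?_)
  set a := L (1, 0)
  set b := L (0, 1)
  have hL : ∀ x y : ℝ, L (x, y) = a * x + b * y := fun x y => by
    have e : ((x, y) : ℝ × ℝ) = x • (1, 0) + y • (0, 1) := by simp
    rw [e, map_add, map_smul, map_smul]
    simp only [smul_eq_mul, a, b]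
    ring
  rw [charFunDual_apply, charFunDual_apply, integral_map hm (by fun_prop),
    integral_map hm'.aemeasurable (by fun_prop)]
  simp only [hL]
  rw [h.charFun]
  have e : ∀ v : ℝ × ℝ, Complex.exp (((a * v.1 + b * (ρ * v.1 + √(1 - ρ ^ 2) * v.2) : ℝ) : ℂ) *
      Complex.I) = Complex.exp (((a + b * ρ) * v.1 : ℝ) * Complex.I) *
        Complex.exp ((b * √(1 - ρ ^ 2) * v.2 : ℝ) * Complex.I) := fun v => by
    rw [← Complex.exp_add]
    push_cast
    ring_nf
  simp only [e]
  rw [integral_prod_mul (fun x : ℝ => Complex.exp (((a + b * ρ) * x : ℝ) * Complex.I))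
    (fun x : ℝ => Complex.exp ((b * √(1 - ρ ^ 2) * x : ℝ) * Complex.I)),
    charFun_gaussianReal_std, charFun_gaussianReal_std, ← Complex.exp_add]
  have hs : √(1 - ρ ^ 2) ^ 2 = 1 - ρ ^ 2 :=
    Real.sq_sqrt (by nlinarith [sq_abs ρ, abs_nonneg ρ, h.abs_le])
  congr 1
  rw [← Complex.ofReal_neg, ← Complex.ofReal_neg, ← Complex.ofReal_neg, ← Complex.ofReal_add,
    mul_pow, hs]
  congr 1
  ring

theorem IsCorrelatedPair.map_fst [IsProbabilityMeasure P] {X Y : Ω → ℝ} {ρ : ℝ}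
    (h : IsCorrelatedPair X Y ρ P) : P.map X = gaussianReal 0 1 := by
  have : IsProbabilityMeasure (P.map X) := Measure.isProbabilityMeasure_map h.aemeasurable_fst
  refine Measure.ext_of_charFun (funext fun a => ?_)
  have h1 := h.charFun a 0
  rw [charFun_apply_real, charFun_apply_real, integral_map h.aemeasurable_fst (by fun_prop)]
  have h2 := charFun_gaussianReal_std a
  push_cast at h1 h2 ⊢
  rw [h2]
  simpa using h1

theorem IsCorrelatedPair.symm {X Y : Ω → ℝ} {ρ : ℝ}
    (h : IsCorrelatedPair X Y ρ P) : IsCorrelatedPair Y X ρ P where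
  aemeasurable_fst := h.aemeasurable_snd
  aemeasurable_snd := h.aemeasurable_fst
  abs_le := h.abs_le
  charFun a b := by
    have := h.charFun b a
    rw [show a ^ 2 + 2 * a * b * ρ + b ^ 2 = b ^ 2 + 2 * b * a * ρ + a ^ 2 by ring, ← this]
    simp only [add_comm]

open Polynomial in
theorem IsCorrelatedPair.memLp_eval [IsProbabilityMeasure P] {X Y : Ω → ℝ} {ρ : ℝ}
    (h : IsCorrelatedPair X Y ρ P) (p : ℝ[X]) : MemLp (fun ω => p.eval (X ω)) 2 P := by
  refine (memLp_two_iff_integrable_sq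
    (p.continuous.comp_aestronglyMeasurable h.aemeasurable_fst.aestronglyMeasurable)).2 ?_
  have h1 := integrable_eval_gaussianReal (p ^ 2)
  rw [← h.map_fst] at h1
  have h2 := h1.comp_aemeasurable h.aemeasurable_fst
  simpa only [eval_pow, Function.comp_def] using h2

open Polynomial in
theorem IsCorrelatedPair.integrable_mul [IsProbabilityMeasure P] {X Y : Ω → ℝ} {ρ : ℝ}
    (h : IsCorrelatedPair X Y ρ P) (p g : ℝ[X]) :
    Integrable (fun ω => p.eval (X ω) * g.eval (Y ω)) P :=
  (h.memLp_eval p).integrable_mul (h.symm.memLp_eval g)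

open Polynomial in
/-- Integration by parts for a pair of correlated Gaussian variables. -/
theorem IsCorrelatedPair.stein [IsProbabilityMeasure P] {X Y : Ω → ℝ} {ρ : ℝ}
    (h : IsCorrelatedPair X Y ρ P) (p g : ℝ[X]) :
    ∫ ω, X ω * p.eval (X ω) * g.eval (Y ω) ∂P =
      ∫ ω, p.derivative.eval (X ω) * g.eval (Y ω) ∂P +
        ρ * ∫ ω, p.eval (X ω) * g.derivative.eval (Y ω) ∂P := by
  set s := √(1 - ρ ^ 2)
  set γ := gaussianReal 0 1
  have hm : AEMeasurable (fun ω => (X ω, Y ω)) P := h.aemeasurable_fst.prodMk h.aemeasurable_snd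
  have hm' : Measurable (fun v : ℝ × ℝ => (v.1, ρ * v.1 + s * v.2)) := by fun_prop
  have key : ∀ p g : ℝ[X],
      Integrable (fun v : ℝ × ℝ => p.eval v.1 * g.eval (ρ * v.1 + s * v.2)) (γ.prod γ) ∧
      ∫ ω, p.eval (X ω) * g.eval (Y ω) ∂P =
        ∫ z, ∫ x, p.eval x * g.eval (ρ * x + s * z) ∂γ ∂γ := by
    intro p g
    have hc : Continuous fun v : ℝ × ℝ => p.eval v.1 * g.eval v.2 :=
      (p.continuous.comp continuous_fst).mul (g.continuous.comp continuous_snd)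
    have hi : Integrable (fun v : ℝ × ℝ => p.eval v.1 * g.eval v.2)
        (P.map fun ω => (X ω, Y ω)) :=
      (integrable_map_measure hc.aestronglyMeasurable hm).2 (h.integrable_mul p g)
    have hi' := hi
    rw [h.map_eq] at hi'
    have hi2 := (integrable_map_measure hc.aestronglyMeasurable hm'.aemeasurable).1 hi'
    refine ⟨hi2, ?_⟩
    rw [← integral_map (f := fun v : ℝ × ℝ => p.eval v.1 * g.eval v.2) hm hc.aestronglyMeasurable,
      h.map_eq, integral_map hm'.aemeasurable hc.aestronglyMeasurable]
    exact integral_prod_symm _ hi2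
  have e1 := (key (Polynomial.X * p) g).2
  simp only [eval_mul, eval_X] at e1
  rw [e1, (key (derivative p) g).2, (key p (derivative g)).2, ← integral_const_mul,
    ← integral_add (key (derivative p) g).1.integral_prod_right
      ((key p (derivative g)).1.integral_prod_right.const_mul ρ)]
  -- With the independent component `z` fixed, this is the one-dimensional formula for the
  -- polynomial `x ↦ p(x) g(ρ x + s z)`.
  refine integral_congr_ae (ae_of_all _ fun z => ?_)
  set G : ℝ[X] := g.comp (C ρ * Polynomial.X + C (s * z))
  set G' : ℝ[X] := g.derivative.comp (C ρ * Polynomial.X + C (s * z))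
  have hG : ∀ x, G.eval x = g.eval (ρ * x + s * z) := fun x => by simp [G]
  have hG' : ∀ x, G'.eval x = g.derivative.eval (ρ * x + s * z) := fun x => by simp [G']
  have hd : (p * G).derivative = p.derivative * G + C ρ * (p * G') := by
    rw [derivative_mul, derivative_comp]
    simp [G, G']
    ring
  have hst := stein_polynomial (p * G)
  rw [hd] at hst
  simp only [eval_mul, eval_add, eval_C] at hst
  rw [integral_add, integral_const_mul] at hst
  · simp only [← hG, ← hG']
    rw [← hst]
    exact integral_congr_ae (ae_of_all _ fun x => by ring)
  · simpa using integrable_eval_gaussianReal (derivative p * G)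
  · simpa using (integrable_eval_gaussianReal (p * G')).const_mul ρ

open Polynomial in
/-- The Hermite polynomial as a real polynomial. -/
def hermiteR (n : ℕ) : ℝ[X] := (hermite n).map (Int.castRingHom ℝ)

open Polynomial in
theorem aeval_hermite (n : ℕ) (x : ℝ) : aeval x (hermite n) = (hermiteR n).eval x := by
  rw [aeval_def, eval₂_eq_eval_map]
  rfl

open Polynomial in
theorem hermiteR_succ (n : ℕ) : hermiteR (n + 1) = X * hermiteR n - derivative (hermiteR n) := by
  simp [hermiteR, hermite_succ, derivative_map]

open Polynomial in
theorem iterate_derivative_hermiteR (n : ℕ) :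
    derivative^[n] (hermiteR n) = C (n.factorial : ℝ) := by
  have hmonic : (hermiteR n).Monic := (hermite_monic n).map _
  have hdeg : (hermiteR n).natDegree = n := by
    rw [hermiteR, (hermite_monic n).natDegree_map, natDegree_hermite]
  have h0 : (derivative^[n] (hermiteR n)).natDegree = 0 := by
    have := natDegree_iterate_derivative (hermiteR n) n
    omega
  rw [eq_C_of_natDegree_eq_zero h0, coeff_iterate_derivative]
  have : (hermiteR n).coeff n = 1 := by
    have := hmonic.coeff_natDegree
    rwa [hdeg] at this
  simp [this, Nat.descFactorial_self]

open Polynomial in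
/-- The Hermite polynomial acts by differentiation: the recursion `H_{n+1} = X Hₙ - Hₙ'` cancels the
first term of the integration by parts formula. -/
theorem IsCorrelatedPair.integral_hermite_mul [IsProbabilityMeasure P] {X Y : Ω → ℝ} {ρ : ℝ}
    (h : IsCorrelatedPair X Y ρ P) (n : ℕ) (g : ℝ[X]) :
    ∫ ω, (hermiteR n).eval (X ω) * g.eval (Y ω) ∂P =
      ρ ^ n * ∫ ω, (derivative^[n] g).eval (Y ω) ∂P := by
  induction n generalizing g with
  | zero => simp [hermiteR]
  | succ n ih =>
    have e : ∀ ω, (hermiteR (n + 1)).eval (X ω) * g.eval (Y ω) =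
        X ω * (hermiteR n).eval (X ω) * g.eval (Y ω) -
          (derivative (hermiteR n)).eval (X ω) * g.eval (Y ω) := fun ω => by
      rw [hermiteR_succ]
      simp
      ring
    have hi : Integrable (fun ω => X ω * (hermiteR n).eval (X ω) * g.eval (Y ω)) P := by
      have := h.integrable_mul (Polynomial.X * hermiteR n) g
      simpa only [eval_mul, eval_X] using this
    simp only [e]
    rw [integral_sub hi (h.integrable_mul _ _), h.stein, ih, Function.iterate_succ_apply]
    ring

/-- `E[Hₙ(X) Hₙ(Y)] = n! ρⁿ` for standard Gaussian variables with correlation `ρ`. -/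
theorem IsCorrelatedPair.integral_hermite_mul_hermite [IsProbabilityMeasure P] {X Y : Ω → ℝ}
    {ρ : ℝ} (h : IsCorrelatedPair X Y ρ P) (n : ℕ) :
    ∫ ω, (hermiteR n).eval (X ω) * (hermiteR n).eval (Y ω) ∂P = n.factorial * ρ ^ n := by
  rw [h.integral_hermite_mul, iterate_derivative_hermiteR]
  simp [mul_comm]

end Hermite

/-! ### The isometry property of the multiple integrals -/

section MultInt

variable {Ω : Type*} [MeasurableSpace Ω] {d : ℕ} [NeZero d] {H : ℝ}
  {B : ℝ≥0 → Ω → EuclideanSpace ℝ (Fin d)} {P : Measure Ω} [IsProbabilityMeasure P]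

theorem IsFBM.isCorrelatedPair (hB : IsFBM H B P) (f g : Metric.sphere (0 : HSpaceD B P) 1) :
    IsCorrelatedPair (isonormal B P (f : HSpaceD B P)) (isonormal B P (g : HSpaceD B P))
      (inner ℝ (f : HSpaceD B P) (g : HSpaceD B P)) P where
  aemeasurable_fst := (Lp.aestronglyMeasurable _).aemeasurable
  aemeasurable_snd := (Lp.aestronglyMeasurable _).aemeasurable
  abs_le := by
    have := abs_real_inner_le_norm (f : HSpaceD B P) (g : HSpaceD B P)
    simpa using this
  charFun a b := by
    have h := hB.charFun_isonormal (a • (f : HSpaceD B P) + b • (g : HSpaceD B P))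
    have e : isonormal B P (a • (f : HSpaceD B P) + b • (g : HSpaceD B P)) =
        a • isonormal B P (f : HSpaceD B P) + b • isonormal B P (g : HSpaceD B P) := by
      simp only [← isonormalL_apply, map_add, map_smul]
    have hf : ‖(f : HSpaceD B P)‖ = 1 := by simp
    have hg : ‖(g : HSpaceD B P)‖ = 1 := by simp
    rw [e, norm_add_sq_real, norm_smul, norm_smul, inner_smul_left, inner_smul_right, hf, hg,
      mul_one, mul_one, Real.norm_eq_abs, Real.norm_eq_abs, sq_abs, sq_abs, conj_trivial] at h
    rw [show a ^ 2 + 2 * a * b * inner ℝ (f : HSpaceD B P) (g : HSpaceD B P) + b ^ 2 =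
      a ^ 2 + 2 * (a * (b * inner ℝ (f : HSpaceD B P) (g : HSpaceD B P))) + b ^ 2 by ring, ← h]
    refine integral_congr_ae ?_
    filter_upwards [Lp.coeFn_add (a • isonormal B P (f : HSpaceD B P))
      (b • isonormal B P (g : HSpaceD B P)), Lp.coeFn_smul a (isonormal B P (f : HSpaceD B P)),
      Lp.coeFn_smul b (isonormal B P (g : HSpaceD B P))] with ω h1 h2 h3
    rw [h1, Pi.add_apply, h2, h3, mul_comm]
    simp

/-- The random variable `Hₙ(B(f))` as an element of `L²`. -/
def hermiteL2 (B : ℝ≥0 → Ω → EuclideanSpace ℝ (Fin d)) (P : Measure Ω) (n : ℕ)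
    (f : Metric.sphere (0 : HSpaceD B P) 1) : Lp ℝ 2 P :=
  toL2 P (fun ω => Polynomial.aeval (isonormal B P (f : HSpaceD B P) ω) (Polynomial.hermite n))

theorem IsFBM.inner_hermiteL2 (hB : IsFBM H B P) (n : ℕ)
    (f g : Metric.sphere (0 : HSpaceD B P) 1) :
    inner ℝ (hermiteL2 B P n f) (hermiteL2 B P n g) =
      n.factorial * inner ℝ (symPow n f) (symPow n g) := by
  have h := hB.isCorrelatedPair f g
  have e : (inner ℝ (symPow n f) (symPow n g) : ℝ) =
      inner ℝ (tens fun _ : Fin n => (f : HSpaceD B P)) (tens fun _ : Fin n => (g : HSpaceD B P)) :=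
    rfl
  rw [hermiteL2, hermiteL2]
  simp only [aeval_hermite]
  rw [inner_toL2 (h.memLp_eval _) (h.symm.memLp_eval _), h.integral_hermite_mul_hermite, e,
    inner_tens]
  simp

theorem denseRange_linearCombination_symPow {K : Type*} [NormedAddCommGroup K]
    [InnerProductSpace ℝ K] (n : ℕ) :
    DenseRange (Finsupp.linearCombination ℝ (symPow (K := K) n)) := by
  have hr : Set.range (Finsupp.linearCombination ℝ (symPow (K := K) n)) =
      (Submodule.span ℝ (Set.range (symPow (K := K) n)) : Set (symTensor n K)) := by
    rw [← Finsupp.range_linearCombination, LinearMap.coe_range]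
  intro x
  rw [hr, closure_subtype]
  have e : (Subtype.val '' (Submodule.span ℝ (Set.range (symPow (K := K) n)) :
      Set (symTensor n K))) = (Submodule.span ℝ (Set.range fun f : Metric.sphere (0 : K) 1 =>
        tens (fun _ : Fin n => (f : K))) : Set (HTensor n K)) := by
    have := Submodule.map_span (symTensor n K).subtype (Set.range (symPow (K := K) n))
    rw [← Set.range_comp] at this
    exact congrArg (fun S : Submodule ℝ (HTensor n K) => (S : Set (HTensor n K))) this
  rw [e]
  exact x.2

/-- The multiple integral on the symmetric tensor power: the continuous extension of
`f^{⊗ n} ↦ Hₙ(B(f))`, `‖f‖ = 1`. -/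
def symInt (B : ℝ≥0 → Ω → EuclideanSpace ℝ (Fin d)) (P : Measure Ω) (n : ℕ) :
    symTensor n (HSpaceD B P) →L[ℝ] Lp ℝ 2 P :=
  (Finsupp.linearCombination ℝ (hermiteL2 B P n)).extendOfNorm
    (Finsupp.linearCombination ℝ (symPow (K := HSpaceD B P) n))

theorem IsFBM.inner_linearCombination_hermiteL2 (hB : IsFBM H B P) (n : ℕ)
    (c c' : Metric.sphere (0 : HSpaceD B P) 1 →₀ ℝ) :
    inner ℝ (Finsupp.linearCombination ℝ (hermiteL2 B P n) c)
        (Finsupp.linearCombination ℝ (hermiteL2 B P n) c') =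
      n.factorial * inner ℝ (Finsupp.linearCombination ℝ (symPow (K := HSpaceD B P) n) c)
        (Finsupp.linearCombination ℝ (symPow (K := HSpaceD B P) n) c') := by
  simp only [Finsupp.linearCombination_apply, Finsupp.sum, sum_inner, inner_sum, inner_smul_left,
    inner_smul_right, hB.inner_hermiteL2, Finset.mul_sum, conj_trivial]
  exact Finset.sum_congr rfl fun _ _ => Finset.sum_congr rfl fun _ _ => by ring

theorem IsFBM.inner_symInt (hB : IsFBM H B P) (n : ℕ) (h h' : symTensor n (HSpaceD B P)) :
    inner ℝ (symInt B P n h) (symInt B P n h') = n.factorial * inner ℝ h h' := by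
  have hd := denseRange_linearCombination_symPow (K := HSpaceD B P) n
  have hn : ∃ C : ℝ, ∀ c, ‖Finsupp.linearCombination ℝ (hermiteL2 B P n) c‖ ≤
      C * ‖Finsupp.linearCombination ℝ (symPow (K := HSpaceD B P) n) c‖ := by
    refine ⟨√n.factorial, fun c => ?_⟩
    rw [norm_eq_sqrt_real_inner, hB.inner_linearCombination_hermiteL2,
      Real.sqrt_mul (by positivity), ← norm_eq_sqrt_real_inner]
  refine hd.induction_on h (p := fun h => inner ℝ (symInt B P n h) (symInt B P n h') =
    n.factorial * inner ℝ h h') (isClosed_eq (by fun_prop) (by fun_prop)) fun c => ?_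
  refine hd.induction_on h' (p := fun h' => inner ℝ (symInt B P n _) (symInt B P n h') =
    n.factorial * inner ℝ _ h') (isClosed_eq (by fun_prop) (by fun_prop)) fun c' => ?_
  rw [symInt, LinearMap.extendOfNorm_eq hd hn, LinearMap.extendOfNorm_eq hd hn,
    hB.inner_linearCombination_hermiteL2]

/-- The isometry property of the multiple integral on symmetric tensors. -/
theorem IsFBM.integral_multInt_mul (hB : IsFBM H B P) (n : ℕ) {h h' : HTensor n (HSpaceD B P)}
    (hh : h ∈ symTensor n (HSpaceD B P)) (hh' : h' ∈ symTensor n (HSpaceD B P)) :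
    ∫ ω, multInt B P n h ω * multInt B P n h' ω ∂P = n.factorial * inner ℝ h h' := by
  have e : ∀ {h : HTensor n (HSpaceD B P)} (hh : h ∈ symTensor n (HSpaceD B P)),
      multInt B P n h = symInt B P n ⟨h, hh⟩ := fun {h} hh =>
    congrArg (symInt B P n)
      (Submodule.orthogonalProjectionOnto_mem_subspace_eq_self (⟨h, hh⟩ : symTensor n (HSpaceD B P)))
  have h1 := hB.inner_symInt n ⟨h, hh⟩ ⟨h', hh'⟩
  rw [← e hh, ← e hh', L2.inner_def] at h1
  refine Eq.trans (integral_congr_ae (ae_of_all _ fun ω => ?_)) h1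
  simp [mul_comm]

end MultInt


/-! ### Gaussian moments and the constants of the chaos expansion -/

section GaussianMoments

/-- The `n`-th moment of the standard Gaussian distribution. -/
def stdMoment (n : ℕ) : ℝ := ∫ x, x ^ n ∂(gaussianReal 0 1)

theorem integrable_pow_gaussianReal (n : ℕ) : Integrable (fun x : ℝ => x ^ n) (gaussianReal 0 1) := by
  simpa using integrable_eval_gaussianReal (Polynomial.X ^ n)

theorem stdMoment_zero : stdMoment 0 = 1 := by simp [stdMoment]

theorem stdMoment_one : stdMoment 1 = 0 := by simp [stdMoment]

theorem stdMoment_add_two (n : ℕ) : stdMoment (n + 2) = (n + 1) * stdMoment n := by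
  have h := stein_polynomial (Polynomial.X ^ (n + 1))
  simp only [Polynomial.eval_pow, Polynomial.eval_X, Polynomial.derivative_X_pow,
    Polynomial.eval_mul, Polynomial.eval_C, Nat.add_sub_cancel, integral_const_mul] at h
  rw [stdMoment, stdMoment]
  rw [← Nat.cast_succ, Nat.succ_eq_add_one, ← h]
  exact integral_congr_ae (ae_of_all _ fun x => by ring)

theorem stdMoment_odd (m : ℕ) : stdMoment (2 * m + 1) = 0 := by
  induction m with
  | zero => exact stdMoment_one
  | succ m ih => rw [show 2 * (m + 1) + 1 = 2 * m + 1 + 2 by ring, stdMoment_add_two, ih, mul_zero]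

theorem stdMoment_even (m : ℕ) :
    stdMoment (2 * m) * (2 ^ m * m.factorial) = (2 * m).factorial := by
  induction m with
  | zero => simp [stdMoment_zero]
  | succ m ih =>
    rw [show 2 * (m + 1) = 2 * m + 2 by ring, stdMoment_add_two, Nat.factorial_succ,
      Nat.factorial_succ (2 * m + 1), Nat.factorial_succ (2 * m)]
    push_cast
    rw [← ih]
    ring

theorem stdMoment_sq_div (m : ℕ) :
    stdMoment (2 * m) ^ 2 / (2 * m).factorial =
      ((2 * m).factorial : ℝ) / (m.factorial : ℝ) ^ 2 / 4 ^ m := by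
  have h := stdMoment_even m
  have h1 : (m.factorial : ℝ) ≠ 0 := by positivity
  have h2 : ((2 * m).factorial : ℝ) ≠ 0 := by positivity
  have h3 : stdMoment (2 * m) = (2 * m).factorial / (2 ^ m * m.factorial) := by
    rw [← h]; field_simp
  rw [h3, show (4 : ℝ) ^ m = (2 ^ m) ^ 2 by rw [← pow_mul, mul_comm, pow_mul]; norm_num]
  field_simp

/-- The standard Gaussian measure on `ℝ^d`. -/
abbrev stdGauss (d : ℕ) : Measure (Fin d → ℝ) := Measure.pi fun _ : Fin d => gaussianReal 0 1

variable {d : ℕ}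

theorem integrable_monomial (k : Fin d → ℕ) :
    Integrable (fun x : Fin d → ℝ => ∏ j, x j ^ k j) (stdGauss d) :=
  Integrable.fintype_prod (f := fun j (x : ℝ) => x ^ k j) fun j => integrable_pow_gaussianReal (k j)

theorem integral_monomial (k : Fin d → ℕ) :
    ∫ x : Fin d → ℝ, ∏ j, x j ^ k j ∂(stdGauss d) = ∏ j, stdMoment (k j) :=
  integral_fintype_prod_eq_prod (fun j (x : ℝ) => x ^ k j)

theorem prod_comp_eq_monomial {n : ℕ} (i : Fin n → Fin d) (x : Fin d → ℝ) :
    ∏ k, x (i k) = ∏ j, x j ^ (Finset.univ.filter fun k => i k = j).card := by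
  rw [← Finset.prod_fiberwise' Finset.univ i x]
  simp

theorem integrable_prod_comp {n : ℕ} (i : Fin n → Fin d) :
    Integrable (fun x : Fin d → ℝ => ∏ k, x (i k)) (stdGauss d) := by
  simp only [prod_comp_eq_monomial]
  exact integrable_monomial _

/-- Both sides are `E[(X · Y)ⁿ]` for independent standard Gaussian vectors `X` and `Y`. -/
theorem sum_gaussMoment_sq (d n : ℕ) :
    ∑ i : Fin n → Fin d, gaussMoment i ^ 2 =
      ∑ k ∈ (Finset.univ : Finset (Fin d)).piAntidiag n,
        (Nat.multinomial Finset.univ k : ℝ) * ∏ j, stdMoment (k j) ^ 2 := by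
  have e : ∀ x y : Fin d → ℝ, ∑ i : Fin n → Fin d, (∏ k, x (i k)) * ∏ k, y (i k) =
      ∑ k ∈ (Finset.univ : Finset (Fin d)).piAntidiag n,
        (Nat.multinomial Finset.univ k : ℝ) * ((∏ j, x j ^ k j) * ∏ j, y j ^ k j) := fun x y => by
    have h := Finset.sum_pow_eq_sum_piAntidiag Finset.univ (fun j => x j * y j) n
    have h' : (∑ j, x j * y j) ^ n = ∑ i : Fin n → Fin d, ∏ k, x (i k) * y (i k) := by
      rw [Finset.sum_pow', Fintype.piFinset_univ]
    rw [h'] at h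
    simp only [← Finset.prod_mul_distrib, ← mul_pow]
    exact h
  have h1 : ∫ x, ∫ y, ∑ i : Fin n → Fin d, (∏ k, x (i k)) * ∏ k, y (i k)
      ∂(stdGauss d) ∂(stdGauss d) = ∑ i : Fin n → Fin d, gaussMoment i ^ 2 := by
    have h2 : ∀ x : Fin d → ℝ, ∫ y, ∑ i : Fin n → Fin d, (∏ k, x (i k)) * ∏ k, y (i k)
        ∂(stdGauss d) = ∑ i : Fin n → Fin d, (∏ k, x (i k)) * gaussMoment i := fun x => by
      rw [integral_finsetSum _ fun i _ => (integrable_prod_comp i).const_mul _]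
      exact Finset.sum_congr rfl fun i _ => integral_const_mul _ _
    simp only [h2]
    rw [integral_finsetSum _ fun i _ => (integrable_prod_comp i).mul_const _]
    refine Finset.sum_congr rfl fun i _ => ?_
    rw [integral_mul_const, sq]
    rfl
  rw [← h1]
  simp only [e]
  have h2 : ∀ x : Fin d → ℝ, ∫ y, ∑ k ∈ (Finset.univ : Finset (Fin d)).piAntidiag n,
      (Nat.multinomial Finset.univ k : ℝ) * ((∏ j, x j ^ k j) * ∏ j, y j ^ k j) ∂(stdGauss d) =
      ∑ k ∈ (Finset.univ : Finset (Fin d)).piAntidiag n,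
      (Nat.multinomial Finset.univ k : ℝ) * ((∏ j, x j ^ k j) * ∏ j, stdMoment (k j)) := fun x => by
    rw [integral_finsetSum _ fun k _ => ((integrable_monomial k).const_mul _).const_mul _]
    refine Finset.sum_congr rfl fun k _ => ?_
    rw [integral_const_mul, integral_const_mul, integral_monomial]
  simp only [h2]
  rw [integral_finsetSum _ fun k _ => ((integrable_monomial k).mul_const _).const_mul _]
  refine Finset.sum_congr rfl fun k _ => ?_
  rw [integral_const_mul, integral_mul_const, integral_monomial, Finset.prod_pow, sq]

/-- Odd moments vanish, so only the multi-indices `2k` with `|k| = q` contribute. -/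
theorem sum_gaussMoment_sq_eq_alphaConst (d q : ℕ) :
    (∑ i : Fin (2 * q) → Fin d, gaussMoment i ^ 2) / (2 * q).factorial =
      alphaConst d q / 4 ^ q := by
  have hmult : ∀ k ∈ (Finset.univ : Finset (Fin d)).piAntidiag (2 * q),
      (Nat.multinomial Finset.univ k : ℝ) * ∏ j, stdMoment (k j) ^ 2 =
        (2 * q).factorial * ∏ j, (stdMoment (k j) ^ 2 / (k j).factorial) := fun k hk => by
    have hk' : ∑ j, k j = 2 * q := (Finset.mem_piAntidiag.1 hk).1
    have h := Nat.multinomial_spec (Finset.univ : Finset (Fin d)) k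
    rw [hk'] at h
    rw [← h, Finset.prod_div_distrib]
    have h0 : (∏ j, ((k j).factorial : ℝ)) ≠ 0 :=
      Finset.prod_ne_zero_iff.2 fun j _ => by positivity
    push_cast
    field_simp
  rw [sum_gaussMoment_sq, Finset.sum_congr rfl hmult, ← Finset.mul_sum, mul_div_cancel_left₀ _
    (by positivity)]
  have hsub := Finset.map_nsmul_piAntidiag_univ (ι := Fin d) q two_ne_zero
  have hf : ∑ k ∈ (Finset.univ : Finset (Fin d)).piAntidiag (2 * q),
      ∏ j, (stdMoment (k j) ^ 2 / (k j).factorial) =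
      ∑ k ∈ {f ∈ (Finset.univ : Finset (Fin d)).piAntidiag (2 * q) | ∀ i, 2 ∣ f i},
      ∏ j, (stdMoment (k j) ^ 2 / (k j).factorial) := by
    refine (Finset.sum_filter_of_ne fun k _ hne i => ?_).symm
    by_contra hi
    refine hne (Finset.prod_eq_zero (Finset.mem_univ i) ?_)
    obtain ⟨m, hm⟩ : Odd (k i) := Nat.not_even_iff_odd.1 fun h => hi h.two_dvd
    rw [hm, stdMoment_odd]
    simp
  have hsub' : {f ∈ (Finset.univ : Finset (Fin d)).piAntidiag (2 * q) | ∀ i, 2 ∣ f i} =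
      (Finset.univ.piAntidiag q).map ⟨(2 • ·), nsmul_right_injective two_ne_zero⟩ := by
    convert! hsub.symm
  rw [hf, hsub', Finset.sum_map, alphaConst, Finset.sum_div]
  refine Finset.sum_congr rfl fun k hk => ?_
  have hk' : ∑ j, k j = q := (Finset.mem_piAntidiag.1 hk).1
  rw [← hk', ← Finset.prod_pow_eq_pow_sum, ← Finset.prod_div_distrib]
  refine Finset.prod_congr rfl fun j _ => ?_
  exact stdMoment_sq_div (k j)

/-- `E[exp(z N² / 2)] = (1 - z)^{-1/2}`, expanded in powers of `z`. -/
theorem hasSum_centralBinom {z : ℝ} (h0 : 0 ≤ z) (h1 : z < 1) :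
    HasSum (fun m : ℕ => ((2 * m).factorial : ℝ) / (m.factorial : ℝ) ^ 2 * (z / 4) ^ m)
      ((1 - z) ^ (-(1 / 2) : ℝ)) := by
  have hlim : ∀ x : ℝ, HasSum (fun m : ℕ => (z * x ^ 2 / 2) ^ m / m.factorial)
      (Real.exp (z * x ^ 2 / 2)) := fun x => by
    rw [Real.exp_eq_exp_ℝ]
    exact NormedSpace.expSeries_div_hasSum_exp (𝔸 := ℝ) (z * x ^ 2 / 2)
  have hb : 0 < (1 - z) / 2 := by linarith
  have e : ∀ x : ℝ, Real.exp (z * x ^ 2 / 2) * Real.exp (-x ^ 2 / 2) =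
      Real.exp (-((1 - z) / 2) * x ^ 2) := fun x => by
    rw [← Real.exp_add]; ring_nf
  have hint : Integrable (fun x : ℝ => Real.exp (z * x ^ 2 / 2)) (gaussianReal 0 1) := by
    rw [gaussianReal_of_var_ne_zero _ one_ne_zero, integrable_withDensity_iff (by fun_prop)
      (by simp [gaussianPDF])]
    refine ((integrable_exp_neg_mul_sq hb).const_mul (√(2 * Real.pi))⁻¹).congr
      (ae_of_all _ fun x => ?_)
    simp only [toReal_gaussianPDF, gaussianPDFReal, NNReal.coe_one, mul_one, sub_zero]
    rw [← e x]
    ring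
  have hnn : ∀ (m : ℕ) (x : ℝ), 0 ≤ (z * x ^ 2 / 2) ^ m / m.factorial := fun m x => by positivity
  have h := hasSum_integral_of_dominated_convergence (μ := gaussianReal 0 1)
    (F := fun (m : ℕ) (x : ℝ) => (z * x ^ 2 / 2) ^ m / m.factorial)
    (f := fun x => Real.exp (z * x ^ 2 / 2))
    (fun (m : ℕ) (x : ℝ) => (z * x ^ 2 / 2) ^ m / m.factorial)
    (fun m => by fun_prop)
    (fun m => ae_of_all _ fun x => by rw [Real.norm_of_nonneg (hnn m x)])
    (ae_of_all _ fun x => (hlim x).summable)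
    (by simpa only [(hlim _).tsum_eq] using hint)
    (ae_of_all _ hlim)
  convert! h using 1
  · funext m
    have e2 : ∀ x : ℝ, (z * x ^ 2 / 2) ^ m / m.factorial =
        (z / 2) ^ m / m.factorial * x ^ (2 * m) := fun x => by
      rw [pow_mul, div_mul_eq_mul_div, ← mul_pow]
      ring
    simp only [e2, integral_const_mul]
    have h3 := stdMoment_even m
    rw [stdMoment] at h3
    rw [← h3, div_pow, div_pow, show (4 : ℝ) ^ m = (2 ^ m) ^ 2 by
      rw [← pow_mul, mul_comm, pow_mul]; norm_num]
    have : (m.factorial : ℝ) ≠ 0 := by positivity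
    field_simp
  · rw [integral_gaussianReal_std]
    simp only [e]
    rw [integral_gaussian, ← Real.sqrt_inv, ← Real.sqrt_mul (by positivity),
      show (2 * Real.pi)⁻¹ * (Real.pi / ((1 - z) / 2)) = (1 - z)⁻¹ by
        have := Real.pi_pos.ne'
        have : 1 - z ≠ 0 := by linarith
        field_simp,
      Real.sqrt_eq_rpow, Real.rpow_neg (by linarith), Real.inv_rpow (by linarith)]

/-- The power series with the central binomial coefficients. -/
def centralSeries : PowerSeries ℝ :=
  PowerSeries.mk fun m => ((2 * m).factorial : ℝ) / (m.factorial : ℝ) ^ 2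

theorem coeff_centralSeries_pow (d q : ℕ) :
    PowerSeries.coeff q (centralSeries ^ d) = alphaConst d q := by
  have h := PowerSeries.coeff_prod (fun _ : Fin d => centralSeries) q Finset.univ
  rw [Finset.prod_const, Finset.card_univ, Fintype.card_fin] at h
  rw [h, alphaConst]
  refine Finset.sum_bij (fun l _ => (l : Fin d → ℕ)) (fun l hl => ?_) (fun a _ b _ hab => ?_)
    (fun k hk => ?_) (fun l _ => ?_)
  · rw [Finset.mem_finsuppAntidiag] at hl
    exact Finset.mem_piAntidiag.2 ⟨hl.1, fun _ _ => Finset.mem_univ _⟩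
  · exact DFunLike.coe_injective hab
  · refine ⟨Finsupp.equivFunOnFinite.symm k, ?_, rfl⟩
    rw [Finset.mem_finsuppAntidiag]
    exact ⟨(Finset.mem_piAntidiag.1 hk).1, Finset.subset_univ _⟩
  · simp [centralSeries]

/-- `(1 - z)^{-d/2}` is the generating function of the numbers `α_q`. -/
theorem hasSum_alphaConst (d : ℕ) {z : ℝ} (h0 : 0 ≤ z) (h1 : z < 1) :
    HasSum (fun q : ℕ => alphaConst d q * (z / 4) ^ q) ((1 - z) ^ (-(d : ℝ) / 2)) := by
  have hs := hasSum_centralBinom h0 h1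
  have hcoeff : ∀ d q, 0 ≤ PowerSeries.coeff q (centralSeries ^ d) := fun d q => by
    rw [coeff_centralSeries_pow, alphaConst]
    positivity
  have key : ∀ n : ℕ, HasSum (fun q : ℕ => PowerSeries.coeff q (centralSeries ^ n) * (z / 4) ^ q)
      (((1 - z) ^ (-(1 / 2) : ℝ)) ^ n) := by
    intro n
    induction n with
    | zero =>
      have := hasSum_ite_eq (0 : ℕ) (1 : ℝ)
      convert! this using 1
      · funext q
        rw [pow_zero, PowerSeries.coeff_one]
        split_ifs with h <;> simp [h]
    | succ n ih =>
      have hnn : ∀ q : ℕ, 0 ≤ PowerSeries.coeff q (centralSeries ^ n) * (z / 4) ^ q := fun q =>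
        mul_nonneg (hcoeff n q) (by positivity)
      have hnn' : ∀ m : ℕ, 0 ≤ ((2 * m).factorial : ℝ) / (m.factorial : ℝ) ^ 2 * (z / 4) ^ m :=
        fun m => by positivity
      have ha : Summable fun q : ℕ => ‖PowerSeries.coeff q (centralSeries ^ n) * (z / 4) ^ q‖ := by
        simpa only [Real.norm_of_nonneg (hnn _)] using ih.summable
      have hb : Summable fun m : ℕ =>
          ‖((2 * m).factorial : ℝ) / (m.factorial : ℝ) ^ 2 * (z / 4) ^ m‖ := by
        simpa only [Real.norm_of_nonneg (hnn' _)] using hs.summable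
      have hc := tsum_mul_tsum_eq_tsum_sum_antidiagonal_of_summable_norm ha hb
      have hd := (summable_norm_sum_mul_antidiagonal_of_summable_norm ha hb).of_norm
      rw [ih.tsum_eq, hs.tsum_eq] at hc
      rw [pow_succ ((1 - z) ^ (-(1 / 2) : ℝ)), hc]
      convert! hd.hasSum using 1
      funext q
      rw [pow_succ centralSeries, PowerSeries.coeff_mul, Finset.sum_mul]
      refine Finset.sum_congr rfl fun kl hkl => ?_
      rw [← Finset.HasAntidiagonal.mem_antidiagonal.1 hkl, pow_add]
      simp only [centralSeries, PowerSeries.coeff_mk]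
      ring
  have h := key d
  simp only [coeff_centralSeries_pow] at h
  rwa [← Real.rpow_natCast, ← Real.rpow_mul (by linarith),
    show -(1 / 2) * (d : ℝ) = -(d : ℝ) / 2 by ring] at h

theorem alphaConst_pos (d q : ℕ) [NeZero d] : 0 < alphaConst d q := by
  refine Finset.sum_pos (fun m _ => Finset.prod_pos fun j _ => by positivity) ?_
  refine ⟨Pi.single 0 q, ?_⟩
  simp [Finset.mem_piAntidiag]

theorem alphaConst_zero (d : ℕ) : alphaConst d 0 = 1 := by
  simp [alphaConst]

end GaussianMoments


/-! ### Elementary tensors -/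

section ElementaryTensors

variable {K : Type*} [NormedAddCommGroup K] [InnerProductSpace ℝ K]

/-- The elementary tensor as a multilinear map. -/
def tensM (n : ℕ) (K : Type*) [NormedAddCommGroup K] [InnerProductSpace ℝ K] :
    MultilinearMap ℝ (fun _ : Fin n => K) (HTensor n K) :=
  (UniformSpace.Completion.toComplL (𝕜 := ℝ) (E := AlgTensor n K)).toLinearMap.compMultilinearMap
    (show MultilinearMap ℝ (fun _ : Fin n => K) (AlgTensor n K) from PiTensorProduct.tprod ℝ)

theorem tensM_apply {n : ℕ} (x : Fin n → K) : tensM n K x = tens x := rfl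

theorem norm_tens {n : ℕ} (x : Fin n → K) : ‖tens x‖ = ∏ k, ‖x k‖ := by
  rw [norm_eq_sqrt_real_inner, inner_tens]
  simp only [real_inner_self_eq_norm_sq]
  rw [Finset.prod_pow, Real.sqrt_sq (Finset.prod_nonneg fun _ _ => norm_nonneg _)]

theorem continuous_tens (n : ℕ) : Continuous (tens : (Fin n → K) → HTensor n K) :=
  ((tensM n K).mkContinuous 1 fun x => by rw [tensM_apply, norm_tens, one_mul]).cont

/-- Powers of arbitrary vectors are symmetric, although `symTensor` is generated by the powers of unit
vectors only. For `n = 0` this fails if `K` is trivial, as there are no unit vectors. -/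
theorem tens_const_mem_symTensor {n : ℕ} (hn : n ≠ 0) (v : K) :
    tens (fun _ : Fin n => v) ∈ symTensor n K := by
  obtain rfl | hv := eq_or_ne v 0
  · have : tens (fun _ : Fin n => (0 : K)) = 0 := by
      rw [← norm_eq_zero, norm_tens]
      simp [hn]
    rw [this]
    exact Submodule.zero_mem _
  · have hv' : ‖v‖ ≠ 0 := norm_ne_zero_iff.2 hv
    have hu : ‖(‖v‖⁻¹ • v)‖ = 1 := by rw [norm_smul, norm_inv, norm_norm, inv_mul_cancel₀ hv']
    have e : tens (fun _ : Fin n => v) = ‖v‖ ^ n • tens (fun _ : Fin n => ‖v‖⁻¹ • v) := by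
      have h := (tensM n K).map_smul_univ (fun _ => ‖v‖) (fun _ => ‖v‖⁻¹ • v)
      simpa [tensM_apply, smul_smul, mul_inv_cancel₀ hv'] using h
    rw [e]
    exact Submodule.smul_mem _ _ (symPow n ⟨‖v‖⁻¹ • v, by simpa using hu⟩).2

end ElementaryTensors

section Kernels

variable {Ω : Type*} [MeasurableSpace Ω] {d : ℕ} [NeZero d] {H : ℝ}
  {B : ℝ≥0 → Ω → EuclideanSpace ℝ (Fin d)} {P : Measure Ω}

/-- The tensor of the vectors `1_{[s,t]} e_{i₁}, …, 1_{[s,t]} e_{iₙ}` of `ℌ^d`. -/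
def indTens (B : ℝ≥0 → Ω → EuclideanSpace ℝ (Fin d)) (P : Measure Ω) {n : ℕ} (i : Fin n → Fin d)
    (v : HSpace B P) : HTensor n (HSpaceD B P) :=
  tens fun k => (WithLp.toLp 2 (Pi.single (i k) v) : HSpaceD B P)

theorem inner_indTens {n : ℕ} (i i' : Fin n → Fin d) (v v' : HSpace B P) :
    inner ℝ (indTens B P i v) (indTens B P i' v') = if i = i' then inner ℝ v v' ^ n else 0 := by
  have e : ∀ a b : Fin d, (inner ℝ (WithLp.toLp 2 (Pi.single a v) : HSpaceD B P)
      (WithLp.toLp 2 (Pi.single b v') : HSpaceD B P) : ℝ) = if a = b then inner ℝ v v' else 0 := by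
    intro a b
    rw [PiLp.inner_apply, Finset.sum_eq_single a]
    · split_ifs with h
      · subst h; simp
      · simp [Pi.single_eq_of_ne h]
    · intro c _ hc
      simp [Pi.single_eq_of_ne hc]
    · simp
  rw [indTens, indTens, inner_tens]
  simp only [e]
  split_ifs with h
  · subst h; simp
  · obtain ⟨k, hk⟩ := Function.ne_iff.1 h
    exact Finset.prod_eq_zero (Finset.mem_univ k) (if_neg hk)

theorem continuous_indTens {n : ℕ} (i : Fin n → Fin d) :
    Continuous fun v : HSpace B P => indTens B P i v := by
  refine (continuous_tens n).comp (continuous_pi fun k => ?_)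
  exact (PiLp.continuous_toLp 2 (fun _ : Fin d => HSpace B P)).comp
    (continuous_single (A := fun _ : Fin d => HSpace B P) (i k))

/-- The tensor is the Gaussian average of the powers `(X ⊗ v)^{⊗ n}`, hence symmetric. -/
theorem sum_gaussMoment_indTens_mem {n : ℕ} (hn : n ≠ 0) (v : HSpace B P) :
    ∑ i : Fin n → Fin d, gaussMoment i • indTens B P i v ∈ symTensor n (HSpaceD B P) := by
  have hint : ∀ i : Fin n → Fin d, Integrable
      (fun x : Fin d → ℝ => (∏ k, x (i k)) • indTens B P i v) (stdGauss d) := fun i =>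
    (integrable_prod_comp i).smul_const _
  have e : ∫ x : Fin d → ℝ, ∑ i : Fin n → Fin d, (∏ k, x (i k)) • indTens B P i v ∂(stdGauss d) =
      ∑ i : Fin n → Fin d, gaussMoment i • indTens B P i v := by
    rw [integral_finsetSum _ fun i _ => hint i]
    exact Finset.sum_congr rfl fun i _ => integral_smul_const _ _
  rw [← e]
  refine Convex.integral_mem (s := (symTensor n (HSpaceD B P) : Set (HTensor n (HSpaceD B P))))
    (Submodule.convex _) (Submodule.isClosed_topologicalClosure _) (ae_of_all _ fun x => ?_)
    (integrable_finsetSum _ fun i _ => hint i)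
  have h := (tensM n (HSpaceD B P)).map_sum fun (_ : Fin n) (j : Fin d) =>
    (x j • (WithLp.toLp 2 (Pi.single j v) : HSpaceD B P))
  have h2 : ∀ i : Fin n → Fin d, (tensM n (HSpaceD B P)) (fun k =>
      (x (i k) • (WithLp.toLp 2 (Pi.single (i k) v) : HSpaceD B P))) =
        (∏ k, x (i k)) • indTens B P i v := fun i =>
    (tensM n (HSpaceD B P)).map_smul_univ (fun k => x (i k)) _
  simp only [h2] at h
  rw [← h]
  exact tens_const_mem_symTensor hn _

theorem kernelInc_eq (q : ℕ) (ε s t : ℝ) :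
    kernelInc H B P q ε s t =
      ((-1) ^ q * ((2 * Real.pi) ^ (-(d : ℝ) / 2) / (Nat.factorial (2 * q) : ℝ)) *
      (ε + (t - s) ^ (2 * H)) ^ (-(d : ℝ) / 2 - q)) •
        ∑ i : Fin (2 * q) → Fin d, gaussMoment i • indTens B P i (ind B P s.toNNReal t.toNNReal) := by
  rw [kernelInc, Finset.smul_sum]
  refine Finset.sum_congr rfl fun i _ => ?_
  rw [smul_smul, indTens]
  congr 1
  ring

theorem kernelInc_mem {q : ℕ} (hq : 1 ≤ q) (ε s t : ℝ) :
    kernelInc H B P q ε s t ∈ symTensor (2 * q) (HSpaceD B P) := by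
  rw [kernelInc_eq]
  exact Submodule.smul_mem _ _ (sum_gaussMoment_indTens_mem (by omega) _)

theorem inner_sum_indTens {n : ℕ} (v v' : HSpace B P) :
    inner ℝ (∑ i : Fin n → Fin d, gaussMoment i • indTens B P i v)
      (∑ i : Fin n → Fin d, gaussMoment i • indTens B P i v') =
      (∑ i : Fin n → Fin d, gaussMoment i ^ 2) * inner ℝ v v' ^ n := by
  simp only [sum_inner, inner_sum, inner_smul_left, inner_smul_right, inner_indTens, conj_trivial]
  rw [Finset.sum_mul]
  refine Finset.sum_congr rfl fun i _ => ?_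
  simp
  ring

/-! ### The second moments of the chaos components -/

/-- The covariance of the increments of fractional Brownian motion over `[s,t]` and `[s',t']`. -/
def incCov (H s t s' t' : ℝ) : ℝ :=
  (|t - s'| ^ (2 * H) + |s - t'| ^ (2 * H) - |t - t'| ^ (2 * H) - |s - s'| ^ (2 * H)) / 2

/-- The integrand of the second moment of a chaos component. -/
def chaosCov (H : ℝ) (d q : ℕ) (ε : ℝ) (p p' : ℝ × ℝ) : ℝ :=
  (ε + (p.2 - p.1) ^ (2 * H)) ^ (-(d : ℝ) / 2 - q) *
    (ε + (p'.2 - p'.1) ^ (2 * H)) ^ (-(d : ℝ) / 2 - q) * incCov H p.1 p.2 p'.1 p'.2 ^ (2 * q)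

/-- The domain `0 ≤ s ≤ t ≤ T`. -/
def simplex (T : ℝ) : Set (ℝ × ℝ) := {p | 0 ≤ p.1 ∧ p.1 ≤ p.2 ∧ p.2 ≤ T}

theorem isCompact_simplex (T : ℝ) : IsCompact (simplex T) := by
  refine IsCompact.of_isClosed_subset (isCompact_Icc (a := ((0, 0) : ℝ × ℝ)) (b := (T, T))) ?_ ?_
  · exact (isClosed_le continuous_const continuous_fst).inter
      ((isClosed_le continuous_fst continuous_snd).inter (isClosed_le continuous_snd continuous_const))
  · rintro ⟨s, t⟩ ⟨h1, h2, h3⟩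
    simp only at h1 h2 h3
    exact ⟨⟨h1, h1.trans h2⟩, ⟨h2.trans h3, h3⟩⟩

theorem IsFBM.factorial_mul_inner_kernelInc (hB : IsFBM H B P) (q : ℕ) (ε : ℝ) {s t s' t' : ℝ}
    (hs : 0 ≤ s) (ht : 0 ≤ t) (hs' : 0 ≤ s') (ht' : 0 ≤ t') :
    (2 * q).factorial * inner ℝ (kernelInc H B P q ε s t) (kernelInc H B P q ε s' t') =
      betaConst d q * chaosCov H d q ε (s, t) (s', t') := by
  have h := sum_gaussMoment_sq_eq_alphaConst d q
  have hf : ((2 * q).factorial : ℝ) ≠ 0 := by positivity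
  rw [div_eq_iff hf] at h
  rw [kernelInc_eq, kernelInc_eq, inner_smul_left, inner_smul_right, inner_sum_indTens, h,
    hB.inner_ind, Real.coe_toNNReal _ hs, Real.coe_toNNReal _ ht, Real.coe_toNNReal _ hs',
    Real.coe_toNNReal _ ht', conj_trivial, chaosCov, incCov, betaConst]
  have h1 : ((-1 : ℝ) ^ q) * (-1) ^ q = 1 := by rw [← mul_pow]; simp
  have h2 : (2 * Real.pi) ^ (-(d : ℝ) / 2) * (2 * Real.pi) ^ (-(d : ℝ) / 2) =
      ((2 * Real.pi) ^ d)⁻¹ := by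
    rw [← Real.rpow_add (by positivity), ← Real.rpow_natCast, ← Real.rpow_neg (by positivity)]
    ring_nf
  have h3 : (2 : ℝ) ^ (2 * q) = 4 ^ q := by rw [pow_mul]; norm_num
  rw [h3]
  generalize (2 * Real.pi) ^ (-(d : ℝ) / 2) = a at *
  generalize (-1 : ℝ) ^ q = b at *
  simp only
  generalize (ε + (t - s) ^ (2 * H)) ^ (-(d : ℝ) / 2 - q) = u
  generalize (ε + (t' - s') ^ (2 * H)) ^ (-(d : ℝ) / 2 - q) = u'
  generalize ((|t - s'| ^ (2 * H) + |s - t'| ^ (2 * H) - |t - t'| ^ (2 * H) -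
    |s - s'| ^ (2 * H)) / 2) ^ (2 * q) = w
  have e : ((2 * q).factorial : ℝ) * (b * (a / (2 * q).factorial) * u *
      (b * (a / (2 * q).factorial) * u' * (alphaConst d q / 4 ^ q * (2 * q).factorial * w))) =
      (b * b) * (a * a) * (alphaConst d q / 4 ^ q) * (u * u' * w) := by
    field_simp
  rw [e, h1, h2]
  have : (2 * Real.pi) ^ d ≠ 0 := by positivity
  field_simp

theorem IsFBM.continuousOn_kernelInc (hB : IsFBM H B P) (hH : 0 < H) (q : ℕ) {ε : ℝ} (hε : 0 < ε)
    (T : ℝ) : ContinuousOn (fun p : ℝ × ℝ => kernelInc H B P q ε p.1 p.2) (simplex T) := by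
  have hind : Continuous fun p : ℝ × ℝ => ind B P p.1.toNNReal p.2.toNNReal := by
    have h := hB.continuous_indZero hH
    simp only [ind_eq_sub]
    exact (h.comp (continuous_real_toNNReal.comp continuous_snd)).sub
      (h.comp (continuous_real_toNNReal.comp continuous_fst))
  have hscal : ContinuousOn
      (fun p : ℝ × ℝ => (ε + (p.2 - p.1) ^ (2 * H)) ^ (-(d : ℝ) / 2 - q)) (simplex T) := by
    refine ContinuousOn.rpow_const ?_ fun p hp => Or.inl ?_
    · refine continuousOn_const.add (ContinuousOn.rpow_const (by fun_prop) fun p hp =>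
        Or.inr (by positivity))
    · have := Real.rpow_nonneg (sub_nonneg.2 hp.2.1) (2 * H)
      positivity
  have hvec : Continuous fun p : ℝ × ℝ => ∑ i : Fin (2 * q) → Fin d,
      gaussMoment i • indTens B P i (ind B P p.1.toNNReal p.2.toNNReal) := by
    refine continuous_finsetSum _ fun i _ => ?_
    have h : Continuous fun p : ℝ × ℝ => indTens B P i (ind B P p.1.toNNReal p.2.toNNReal) :=
      (continuous_indTens i).comp hind
    exact (continuous_const (y := (gaussMoment i : ℝ))).smul h
  have hscal' : ContinuousOn (fun p : ℝ × ℝ =>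
      (-1) ^ q * ((2 * Real.pi) ^ (-(d : ℝ) / 2) / (Nat.factorial (2 * q) : ℝ)) *
      (ε + (p.2 - p.1) ^ (2 * H)) ^ (-(d : ℝ) / 2 - q)) (simplex T) :=
    continuousOn_const.mul hscal
  simp only [kernelInc_eq]
  exact ContinuousOn.smul hscal' hvec.continuousOn

theorem IsFBM.integrableOn_kernelInc (hB : IsFBM H B P) (hH : 0 < H) (q : ℕ) {ε : ℝ} (hε : 0 < ε)
    (T : ℝ) : IntegrableOn (fun p : ℝ × ℝ => kernelInc H B P q ε p.1 p.2) (simplex T) :=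
  (hB.continuousOn_kernelInc hH q hε T).integrableOn_compact (isCompact_simplex T)

/-- The integral stays in the closed subspace of symmetric tensors. -/
theorem IsFBM.kernel_mem (hB : IsFBM H B P) (hH : 0 < H) {q : ℕ} (hq : 1 ≤ q) {ε : ℝ} (hε : 0 < ε)
    (T : ℝ) : kernel H B P q ε T ∈ symTensor (2 * q) (HSpaceD B P) := by
  have h := (symTensor (2 * q) (HSpaceD B P)).starProjection.integral_comp_comm
    (hB.integrableOn_kernelInc hH q hε T)
  have e : ∀ p : ℝ × ℝ, (symTensor (2 * q) (HSpaceD B P)).starProjection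
      (kernelInc H B P q ε p.1 p.2) = kernelInc H B P q ε p.1 p.2 := fun p =>
    Submodule.starProjection_eq_self_iff.2 (kernelInc_mem hq _ _ _)
  simp only [e] at h
  exact Submodule.starProjection_eq_self_iff.1 h.symm

/-- The isometry property turns the second moment of a chaos component into a double integral of
increment covariances. -/
theorem IsFBM.integral_multInt_kernel [IsProbabilityMeasure P] (hB : IsFBM H B P) (hH : 0 < H)
    {q : ℕ} (hq : 1 ≤ q) {ε : ℝ} (hε : 0 < ε) (T T' : ℝ) :
    ∫ ω, multInt B P (2 * q) (kernel H B P q ε T) ω *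
      multInt B P (2 * q) (kernel H B P q ε T') ω ∂P =
      betaConst d q * ∫ p in simplex T, ∫ p' in simplex T', chaosCov H d q ε p p' := by
  have hi := hB.integrableOn_kernelInc hH q hε T
  have hi' := hB.integrableOn_kernelInc hH q hε T'
  rw [hB.integral_multInt_mul _ (hB.kernel_mem hH hq hε T) (hB.kernel_mem hH hq hε T')]
  have h1 : (inner ℝ (kernel H B P q ε T) (kernel H B P q ε T') : ℝ) =
      ∫ p in simplex T, ∫ p' in simplex T',
        inner ℝ (kernelInc H B P q ε p.1 p.2) (kernelInc H B P q ε p'.1 p'.2) := by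
    rw [real_inner_comm]
    refine (integral_inner hi _).symm.trans ?_
    refine integral_congr_ae (ae_of_all _ fun p => ?_)
    simp only
    rw [real_inner_comm]
    exact (integral_inner hi' _).symm
  rw [h1, ← integral_const_mul, ← integral_const_mul]
  refine setIntegral_congr_fun (isCompact_simplex T).measurableSet fun p hp => ?_
  rw [← integral_const_mul, ← integral_const_mul]
  refine setIntegral_congr_fun (isCompact_simplex T').measurableSet fun p' hp' => ?_
  exact hB.factorial_mul_inner_kernelInc q ε hp.1 (hp.1.trans hp.2.1) hp'.1 (hp'.1.trans hp'.2.1)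

end Kernels


/-! ### Local nondeterminism of fractional Brownian motion -/

section LocalNondeterminism

/-- The hat function, supported in `[-1, 1]`. -/
def hat (x : ℝ) : ℝ := max 0 (1 - |x|)

theorem continuous_hat : Continuous hat := by unfold hat; fun_prop

theorem hat_nonneg (x : ℝ) : 0 ≤ hat x := le_max_left _ _

theorem hat_eq_zero {x : ℝ} (h : 1 ≤ |x|) : hat x = 0 := max_eq_left (by linarith)

theorem abs_hat_sub_le (x y : ℝ) : |hat x - hat y| ≤ |x - y| := by
  have h := abs_max_sub_max_le_abs (1 - |x|) (1 - |y|) 0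
  rw [max_comm _ (0 : ℝ), max_comm _ (0 : ℝ)] at h
  refine h.trans ?_
  rw [show (1 - |x|) - (1 - |y|) = |y| - |x| by ring, abs_sub_comm x y]
  exact abs_abs_sub_abs_le y x

theorem hasCompactSupport_hat : HasCompactSupport hat :=
  HasCompactSupport.intro (isCompact_Icc (a := (-1 : ℝ)) (b := 1)) fun x hx => hat_eq_zero <| by
    by_contra h
    exact hx (Set.mem_Icc.2 (abs_le.1 (not_le.1 h).le))

theorem integrable_hat_mul_hat (a b : ℝ) : Integrable fun x => hat (x - a) * hat (x - b) := by
  refine Continuous.integrable_of_hasCompactSupport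
    ((continuous_hat.comp (by fun_prop)).mul (continuous_hat.comp (by fun_prop))) ?_
  refine HasCompactSupport.mul_right ?_
  exact hasCompactSupport_hat.comp_homeomorph (Homeomorph.subRight a)

/-- The autocorrelation of the hat function: a positive definite function with support in
`[-2, 2]`. -/
def hatCorr (z : ℝ) : ℝ := ∫ x, hat (x - z) * hat x

theorem integral_hat_mul_hat (a b : ℝ) : ∫ x, hat (x - a) * hat (x - b) = hatCorr (a - b) := by
  rw [hatCorr, ← integral_add_right_eq_self (fun x => hat (x - a) * hat (x - b)) b]
  refine integral_congr_ae (ae_of_all _ fun x => ?_)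
  simp only
  ring_nf

theorem hatCorr_neg (z : ℝ) : hatCorr (-z) = hatCorr z := by
  have h1 := integral_hat_mul_hat 0 z
  have h2 := integral_hat_mul_hat z 0
  rw [zero_sub] at h1
  rw [sub_zero] at h2
  rw [← h1, ← h2]
  simp only [mul_comm]

theorem hatCorr_nonneg (z : ℝ) : 0 ≤ hatCorr z :=
  integral_nonneg fun _ => mul_nonneg (hat_nonneg _) (hat_nonneg _)

theorem hatCorr_eq_zero {z : ℝ} (h : 2 ≤ |z|) : hatCorr z = 0 := by
  rw [hatCorr]
  refine integral_eq_zero_of_ae (ae_of_all _ fun x => ?_)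
  by_cases hx : 1 ≤ |x|
  · simp [hat_eq_zero hx]
  · have : 1 ≤ |x - z| := by
      have := abs_sub_abs_le_abs_sub z x
      rw [abs_sub_comm z x] at this
      linarith
    simp [hat_eq_zero this]

theorem hatCorr_zero_pos : 0 < hatCorr 0 := by
  have hc : Continuous fun x => hat (x - 0) * hat x :=
    (continuous_hat.comp (by fun_prop)).mul continuous_hat
  refine hc.integral_pos_of_hasCompactSupport_nonneg_nonzero (x := 0) ?_
    (fun x => mul_nonneg (hat_nonneg _) (hat_nonneg _)) ?_
  · exact HasCompactSupport.mul_left hasCompactSupport_hat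
  · simp [hat]

theorem measurable_hatCorr : Measurable hatCorr := by
  have h : StronglyMeasurable (fun p : ℝ × ℝ => hat (p.2 - p.1) * hat p.2) :=
    ((continuous_hat.comp (by fun_prop)).mul (continuous_hat.comp (by fun_prop))).stronglyMeasurable
  exact (h.integral_prod_right (ν := volume)).measurable

/-- `hatCorr` is positive definite: the sum is the integral of the square of `∑ cᵢ hat(· - tᵢ)`. -/
theorem sum_hatCorr_nonneg {ι : Type*} [Fintype ι] (c t : ι → ℝ) :
    0 ≤ ∑ i, ∑ j, c i * c j * hatCorr (t i - t j) := by
  have e : ∑ i, ∑ j, c i * c j * hatCorr (t i - t j) = ∫ x, (∑ i, c i * hat (x - t i)) ^ 2 := by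
    have h1 : ∀ x, (∑ i, c i * hat (x - t i)) ^ 2 =
        ∑ i, ∑ j, c i * c j * (hat (x - t i) * hat (x - t j)) := fun x => by
      rw [sq, Finset.sum_mul_sum]
      exact Finset.sum_congr rfl fun i _ => Finset.sum_congr rfl fun j _ => by ring
    simp only [h1]
    rw [integral_finsetSum _ fun i _ => integrable_finsetSum _ fun j _ =>
      (integrable_hat_mul_hat _ _).const_mul _]
    refine Finset.sum_congr rfl fun i _ => ?_
    rw [integral_finsetSum _ fun j _ => (integrable_hat_mul_hat _ _).const_mul _]
    refine Finset.sum_congr rfl fun j _ => ?_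
    rw [integral_const_mul, integral_hat_mul_hat]
  rw [e]
  exact integral_nonneg fun x => sq_nonneg _

theorem hatCorr_zero_sub (z : ℝ) :
    hatCorr 0 - hatCorr z = (∫ x, (hat (x - z) - hat x) ^ 2) / 2 := by
  have h0 := integral_hat_mul_hat 0 0
  have hz := integral_hat_mul_hat z z
  have h1 := integral_hat_mul_hat z 0
  simp only [sub_self, sub_zero] at h0 hz h1
  have e : ∀ x, (hat (x - z) - hat x) ^ 2 =
      hat (x - z) * hat (x - z) + hat x * hat x - 2 * (hat (x - z) * hat x) := fun x => by ring
  have i0 := integrable_hat_mul_hat 0 0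
  have iz := integrable_hat_mul_hat z z
  have i1 := integrable_hat_mul_hat z 0
  simp only [sub_zero] at i0 iz i1
  simp only [e]
  have iz0 : Integrable fun x => hat (x - z) * hat (x - z) + hat x * hat x := iz.add i0
  rw [integral_sub iz0 (i1.const_mul 2), integral_add iz i0, integral_const_mul, h0, hz, h1]
  ring

theorem hatCorr_zero_sub_nonneg (z : ℝ) : 0 ≤ hatCorr 0 - hatCorr z := by
  rw [hatCorr_zero_sub]
  have : 0 ≤ ∫ x, (hat (x - z) - hat x) ^ 2 := integral_nonneg fun x => sq_nonneg _
  positivity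

/-- The quadratic behaviour at `0` makes the mixture below converge for `H < 1`. -/
theorem hatCorr_zero_sub_le (z : ℝ) : hatCorr 0 - hatCorr z ≤ 2 * z ^ 2 := by
  rw [hatCorr_zero_sub]
  set g : ℝ → ℝ := (Set.Icc (-1 : ℝ) 1).indicator fun _ => z ^ 2 with hg
  have hgi : Integrable g :=
    (integrable_indicator_iff measurableSet_Icc).2 (integrableOn_const (by simp))
  have hgI : ∫ x, g x = 2 * z ^ 2 := by
    rw [hg, integral_indicator measurableSet_Icc, setIntegral_const]
    simp
    norm_num
  have hle : ∫ x, (hat (x - z) - hat x) ^ 2 ≤ ∫ x, g (x - z) + g x := by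
    refine integral_mono_of_nonneg (ae_of_all _ fun x => sq_nonneg _) ((hgi.comp_sub_right z).add hgi)
      (ae_of_all _ fun x => ?_)
    have hgn : ∀ y, 0 ≤ g y := fun y => Set.indicator_nonneg (fun _ _ => sq_nonneg z) y
    have hgm : ∀ y, |y| < 1 → g y = z ^ 2 := fun y hy =>
      Set.indicator_of_mem (Set.mem_Icc.2 (abs_le.1 hy.le)) _
    have hb : (hat (x - z) - hat x) ^ 2 ≤ z ^ 2 := by
      have := abs_hat_sub_le (x - z) x
      rw [show x - z - x = -z by ring, abs_neg] at this
      exact sq_le_sq.2 this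
    simp only
    by_cases h1 : |x| < 1
    · rw [hgm x h1]
      linarith [hgn (x - z)]
    · by_cases h2 : |x - z| < 1
      · rw [hgm _ h2]
        linarith [hgn x]
      · rw [hat_eq_zero (not_lt.1 h1), hat_eq_zero (not_lt.1 h2)]
        have := add_nonneg (hgn (x - z)) (hgn x)
        simpa using this
  rw [integral_add (hgi.comp_sub_right z) hgi, integral_sub_right_eq_self g z, hgI] at hle
  linarith

variable {H : ℝ}

theorem integrableOn_hatCorr (h0 : 0 < H) (h1 : H < 1) (t : ℝ) :
    IntegrableOn (fun w => (hatCorr 0 - hatCorr (t * w)) * w ^ (-(2 * H) - 1)) (Set.Ioi 0) := by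
  have hm : Measurable (fun w : ℝ => (hatCorr 0 - hatCorr (t * w)) * w ^ (-(2 * H) - 1)) :=
    (measurable_const.sub (measurable_hatCorr.comp (by fun_prop))).mul (by fun_prop)
  rw [← Set.Ioc_union_Ioi_eq_Ioi (zero_le_one' ℝ)]
  refine IntegrableOn.union ?_ ?_
  · have hi : IntegrableOn (fun w : ℝ => 2 * t ^ 2 * w ^ (1 - 2 * H)) (Set.Ioc 0 1) :=
      ((intervalIntegrable_iff_integrableOn_Ioc_of_le zero_le_one).1
        (intervalIntegral.intervalIntegrable_rpow' (by linarith))).const_mul _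
    refine hi.mono' hm.aestronglyMeasurable ?_
    refine (ae_restrict_iff' measurableSet_Ioc).2 (ae_of_all _ fun w hw => ?_)
    have hw0 : 0 < w := hw.1
    rw [Real.norm_of_nonneg (mul_nonneg (hatCorr_zero_sub_nonneg _) (by positivity))]
    calc (hatCorr 0 - hatCorr (t * w)) * w ^ (-(2 * H) - 1)
        ≤ 2 * (t * w) ^ 2 * w ^ (-(2 * H) - 1) := by
          gcongr
          exact hatCorr_zero_sub_le _
      _ = 2 * t ^ 2 * w ^ (1 - 2 * H) := by
          rw [show 1 - 2 * H = 2 + (-(2 * H) - 1) by ring, Real.rpow_add hw0, Real.rpow_two]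
          ring
  · have hi : IntegrableOn (fun w : ℝ => hatCorr 0 * w ^ (-(2 * H) - 1)) (Set.Ioi 1) :=
      (integrableOn_Ioi_rpow_of_lt (by linarith) zero_lt_one).const_mul _
    refine hi.mono' hm.aestronglyMeasurable ?_
    refine (ae_restrict_iff' measurableSet_Ioi).2 (ae_of_all _ fun w hw => ?_)
    have hw0 : 0 < w := zero_lt_one.trans hw
    rw [Real.norm_of_nonneg (mul_nonneg (hatCorr_zero_sub_nonneg _) (by positivity))]
    gcongr
    linarith [hatCorr_nonneg (t * w)]

/-- The constant in the representation of `|t|^{2H}` as a mixture of rescaled functions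
`hatCorr 0 - hatCorr`. -/
def mixConst (H : ℝ) : ℝ :=
  ∫ w in Set.Ioi (0 : ℝ), (hatCorr 0 - hatCorr w) * w ^ (-(2 * H) - 1)

theorem integral_hatCorr_eq (h0 : 0 < H) (t : ℝ) :
    ∫ w in Set.Ioi (0 : ℝ), (hatCorr 0 - hatCorr (t * w)) * w ^ (-(2 * H) - 1) =
      |t| ^ (2 * H) * mixConst H := by
  have hpos : ∀ t : ℝ, 0 < t →
      ∫ w in Set.Ioi (0 : ℝ), (hatCorr 0 - hatCorr (t * w)) * w ^ (-(2 * H) - 1) =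
        t ^ (2 * H) * mixConst H := by
    intro t ht
    have h := integral_comp_mul_left_Ioi
      (fun v : ℝ => (hatCorr 0 - hatCorr v) * v ^ (-(2 * H) - 1)) 0 ht
    rw [mul_zero] at h
    have e : ∫ w in Set.Ioi (0 : ℝ), (hatCorr 0 - hatCorr (t * w)) * w ^ (-(2 * H) - 1) =
        t ^ (2 * H + 1) * ∫ w in Set.Ioi (0 : ℝ),
          (hatCorr 0 - hatCorr (t * w)) * (t * w) ^ (-(2 * H) - 1) := by
      rw [← integral_const_mul]
      refine setIntegral_congr_fun measurableSet_Ioi fun w hw => ?_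
      change (hatCorr 0 - hatCorr (t * w)) * w ^ (-(2 * H) - 1) =
        t ^ (2 * H + 1) * ((hatCorr 0 - hatCorr (t * w)) * (t * w) ^ (-(2 * H) - 1))
      rw [Real.mul_rpow ht.le (le_of_lt hw)]
      have : t ^ (2 * H + 1) * t ^ (-(2 * H) - 1) = 1 := by
        rw [← Real.rpow_add ht]; ring_nf; exact Real.rpow_zero t
      linear_combination (hatCorr 0 - hatCorr (t * w)) * w ^ (-(2 * H) - 1) * (-this)
    rw [e, h, mixConst, smul_eq_mul, ← mul_assoc, Real.rpow_add ht, Real.rpow_one,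
      mul_assoc _ t, mul_inv_cancel₀ ht.ne', mul_one]
  rcases lt_trichotomy t 0 with ht | ht | ht
  · rw [abs_of_neg ht, ← hpos (-t) (by linarith)]
    refine setIntegral_congr_fun measurableSet_Ioi fun w _ => ?_
    rw [neg_mul, hatCorr_neg]
  · simp [ht, Real.zero_rpow (by positivity : 2 * H ≠ 0)]
  · rw [abs_of_pos ht, hpos t ht]

/-- The variance of `∑ cᵢ B_{tᵢ}` when `∑ cᵢ = 0`. -/
def fbmVar (H : ℝ) {ι : Type*} [Fintype ι] (c t : ι → ℝ) : ℝ :=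
  -(∑ i, ∑ j, c i * c j * |t i - t j| ^ (2 * H)) / 2

variable {ι : Type*} [Fintype ι]

/-- The variance of an increment combination is a mixture of quadratic forms of rescaled `hatCorr`;
the constants `hatCorr 0` cancel because `∑ cᵢ = 0`. -/
theorem mixConst_mul_fbmVar (h0 : 0 < H) (h1 : H < 1) {c : ι → ℝ} (hc : ∑ i, c i = 0)
    (t : ι → ℝ) :
    IntegrableOn (fun w => (∑ i, ∑ j, c i * c j * hatCorr (t i * w - t j * w)) *
        w ^ (-(2 * H) - 1)) (Set.Ioi 0) ∧
    ∫ w in Set.Ioi (0 : ℝ), (∑ i, ∑ j, c i * c j * hatCorr (t i * w - t j * w)) *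
        w ^ (-(2 * H) - 1) = 2 * (mixConst H * fbmVar H c t) := by
  have e : ∀ w : ℝ, (∑ i, ∑ j, c i * c j * hatCorr (t i * w - t j * w)) * w ^ (-(2 * H) - 1) =
      ∑ i, ∑ j, -(c i * c j) *
        ((hatCorr 0 - hatCorr ((t i - t j) * w)) * w ^ (-(2 * H) - 1)) := fun w => by
    have hz : ∑ i, ∑ j, c i * c j * hatCorr 0 = 0 := by
      simp only [← Finset.sum_mul, ← Finset.mul_sum, hc]
      simp
    have : ∑ i, ∑ j, -(c i * c j) * ((hatCorr 0 - hatCorr ((t i - t j) * w)) * w ^ (-(2 * H) - 1)) =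
        (∑ i, ∑ j, c i * c j * hatCorr (t i * w - t j * w)) * w ^ (-(2 * H) - 1) -
          (∑ i, ∑ j, c i * c j * hatCorr 0) * w ^ (-(2 * H) - 1) := by
      simp only [Finset.sum_mul, ← Finset.sum_sub_distrib]
      exact Finset.sum_congr rfl fun i _ => Finset.sum_congr rfl fun j _ => by
        rw [sub_mul (t i)]; ring
    rw [this, hz]
    ring
  have hi : ∀ i j, IntegrableOn (fun w : ℝ => -(c i * c j) *
      ((hatCorr 0 - hatCorr ((t i - t j) * w)) * w ^ (-(2 * H) - 1))) (Set.Ioi 0) := fun i j =>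
    (integrableOn_hatCorr h0 h1 (t i - t j)).const_mul _
  simp only [e]
  refine ⟨integrable_finsetSum _ fun i _ => integrable_finsetSum _ fun j _ => hi i j, ?_⟩
  rw [integral_finsetSum _ fun i _ => integrable_finsetSum _ fun j _ => hi i j]
  have e2 : ∀ i, ∫ w in Set.Ioi (0 : ℝ), ∑ j, -(c i * c j) *
      ((hatCorr 0 - hatCorr ((t i - t j) * w)) * w ^ (-(2 * H) - 1)) =
      ∑ j, -(c i * c j * |t i - t j| ^ (2 * H)) * mixConst H := fun i => by
    rw [integral_finsetSum _ fun j _ => hi i j]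
    refine Finset.sum_congr rfl fun j _ => ?_
    rw [integral_const_mul, integral_hatCorr_eq h0]
    ring
  simp only [e2, ← Finset.sum_mul, Finset.sum_neg_distrib]
  rw [fbmVar]
  ring

theorem mixConst_mul_fbmVar_nonneg (h0 : 0 < H) (h1 : H < 1) {c : ι → ℝ} (hc : ∑ i, c i = 0)
    (t : ι → ℝ) : 0 ≤ mixConst H * fbmVar H c t := by
  have h := (mixConst_mul_fbmVar h0 h1 hc t).2
  have h2 : 0 ≤ ∫ w in Set.Ioi (0 : ℝ), (∑ i, ∑ j, c i * c j * hatCorr (t i * w - t j * w)) *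
      w ^ (-(2 * H) - 1) :=
    setIntegral_nonneg measurableSet_Ioi fun w hw =>
      mul_nonneg (sum_hatCorr_nonneg c fun i => t i * w) (Real.rpow_nonneg (le_of_lt hw) _)
  linarith

/-- `hatCorr` vanishes beyond distance `2`, so a point this far from the others decouples. -/
theorem sum_hatCorr_ge {c : ι → ℝ} {t : ι → ℝ} {i₀ : ι}
    (ht : ∀ j, j ≠ i₀ → 2 ≤ |t i₀ - t j|) :
    c i₀ ^ 2 * hatCorr 0 ≤ ∑ i, ∑ j, c i * c j * hatCorr (t i - t j) := by
  classical
  set c' : ι → ℝ := fun i => if i = i₀ then 0 else c i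
  have e : ∀ i j, c i * c j * hatCorr (t i - t j) = c' i * c' j * hatCorr (t i - t j) +
      if i = i₀ then (if j = i₀ then c i₀ ^ 2 * hatCorr 0 else 0) else 0 := by
    intro i j
    by_cases hi : i = i₀
    · by_cases hj : j = i₀
      · simp [c', hi, hj, sq]
      · simp [c', hi, hj, hatCorr_eq_zero (ht j hj)]
    · by_cases hj : j = i₀
      · have := ht i hi
        rw [abs_sub_comm] at this
        simp [c', hi, hj, hatCorr_eq_zero this]
      · simp [c', hi, hj]
  have := sum_hatCorr_nonneg c' t
  simp only [e, Finset.sum_add_distrib]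
  simp
  linarith

/-- In the mixture representation only the scales `w > 2 / R` are kept, at which `i₀` decouples. -/
theorem mixConst_mul_fbmVar_ge (h0 : 0 < H) (h1 : H < 1) {c : ι → ℝ} (hc : ∑ i, c i = 0)
    {t : ι → ℝ} {i₀ : ι} {R : ℝ} (hR : 0 < R) (ht : ∀ j, j ≠ i₀ → R ≤ |t i₀ - t j|) :
    hatCorr 0 * 2 ^ (-(2 * H)) / (4 * H) * (c i₀ ^ 2 * R ^ (2 * H)) ≤
      mixConst H * fbmVar H c t := by
  obtain ⟨hint, h⟩ := mixConst_mul_fbmVar h0 h1 hc t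
  have hR2 : 0 < 2 / R := by positivity
  have h3 : ∫ w in Set.Ioi (2 / R), c i₀ ^ 2 * hatCorr 0 * w ^ (-(2 * H) - 1) ≤
      ∫ w in Set.Ioi (2 / R), (∑ i, ∑ j, c i * c j * hatCorr (t i * w - t j * w)) *
        w ^ (-(2 * H) - 1) := by
    refine setIntegral_mono_on ((integrableOn_Ioi_rpow_of_lt (by linarith) hR2).const_mul _)
      (hint.mono_set (Set.Ioi_subset_Ioi hR2.le)) measurableSet_Ioi fun w hw => ?_
    have hw0 : 0 < w := hR2.trans hw
    refine mul_le_mul_of_nonneg_right ?_ (Real.rpow_nonneg hw0.le _)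
    refine sum_hatCorr_ge (t := fun i => t i * w) fun j hj => ?_
    rw [← sub_mul, abs_mul, abs_of_pos hw0]
    calc (2 : ℝ) = R * (2 / R) := by field_simp
      _ ≤ |t i₀ - t j| * w := by
        have := ht j hj
        gcongr
        exact le_of_lt hw
  have h4 : ∫ w in Set.Ioi (2 / R), (∑ i, ∑ j, c i * c j * hatCorr (t i * w - t j * w)) *
        w ^ (-(2 * H) - 1) ≤ ∫ w in Set.Ioi (0 : ℝ),
        (∑ i, ∑ j, c i * c j * hatCorr (t i * w - t j * w)) * w ^ (-(2 * H) - 1) := by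
    refine setIntegral_mono_set hint ?_ (Set.Ioi_subset_Ioi hR2.le).eventuallyLE
    refine (ae_restrict_iff' measurableSet_Ioi).2 (ae_of_all _ fun w hw => ?_)
    exact mul_nonneg (sum_hatCorr_nonneg c fun i => t i * w) (Real.rpow_nonneg (le_of_lt hw) _)
  rw [integral_const_mul, integral_Ioi_rpow_of_lt (by linarith) hR2] at h3
  have h5 := h3.trans h4
  rw [h, show -(2 * H) - 1 + 1 = -(2 * H) by ring, Real.div_rpow two_pos.le hR.le,
    Real.rpow_neg hR.le] at h5
  have hRp : 0 < R ^ (2 * H) := by positivity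
  have : c i₀ ^ 2 * hatCorr 0 * (-(2 ^ (-(2 * H)) / (R ^ (2 * H))⁻¹) / -(2 * H)) =
      2 * (hatCorr 0 * 2 ^ (-(2 * H)) / (4 * H) * (c i₀ ^ 2 * R ^ (2 * H))) := by
    field_simp
    ring
  rw [this] at h5
  linarith

theorem mixConst_pos (h0 : 0 < H) (h1 : H < 1) : 0 < mixConst H := by
  have h := mixConst_mul_fbmVar_ge h0 h1 (c := ![1, -1]) (t := ![0, 1]) (i₀ := 0) (R := 1)
    (by simp) one_pos (fun j hj => by fin_cases j <;> simp_all)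
  have e : fbmVar H ![1, -1] ![0, 1] = 1 := by
    simp [fbmVar, Fin.sum_univ_two, Real.zero_rpow (by positivity : 2 * H ≠ 0)]
  rw [e, mul_one] at h
  have := hatCorr_zero_pos
  refine lt_of_lt_of_le ?_ h
  simp
  positivity

theorem fbmVar_nonneg (h0 : 0 < H) (h1 : H < 1) {c : ι → ℝ} (hc : ∑ i, c i = 0)
    (t : ι → ℝ) : 0 ≤ fbmVar H c t :=
  nonneg_of_mul_nonneg_right (mixConst_mul_fbmVar_nonneg h0 h1 hc t) (mixConst_pos h0 h1)

/-- Strong local nondeterminism: an increment combination that charges an isolated point has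
variance bounded below by a power of the distance of this point to the others. -/
theorem exists_fbmVar_ge (h0 : 0 < H) (h1 : H < 1) :
    ∃ κ : ℝ, 0 < κ ∧ κ ≤ 1 ∧ ∀ (c t : Fin 4 → ℝ) (i₀ : Fin 4) (R : ℝ), ∑ i, c i = 0 → 0 ≤ R →
      (∀ j, j ≠ i₀ → R ≤ |t i₀ - t j|) → κ * (c i₀ ^ 2 * R ^ (2 * H)) ≤ fbmVar H c t := by
  have hm := mixConst_pos h0 h1
  have hp := hatCorr_zero_pos
  set a := hatCorr 0 * 2 ^ (-(2 * H)) / (4 * H)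
  have ha : 0 < a := by positivity
  refine ⟨min (a / mixConst H) 1, by positivity, min_le_right _ _, fun c t i₀ R hc hR ht => ?_⟩
  rcases hR.eq_or_lt with rfl | hR
  · rw [Real.zero_rpow (by positivity : 2 * H ≠ 0), mul_zero, mul_zero]
    exact fbmVar_nonneg h0 h1 hc t
  · have h := mixConst_mul_fbmVar_ge h0 h1 hc hR ht
    calc min (a / mixConst H) 1 * (c i₀ ^ 2 * R ^ (2 * H))
        ≤ a / mixConst H * (c i₀ ^ 2 * R ^ (2 * H)) := by
          gcongr
          exact min_le_left _ _
      _ = a * (c i₀ ^ 2 * R ^ (2 * H)) / mixConst H := by ring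
      _ ≤ fbmVar H c t := by
          rw [div_le_iff₀ hm, mul_comm (fbmVar H c t)]
          exact h

end LocalNondeterminism


/-! ### Covariances of two increments -/

section Estimates

variable {H : ℝ}

/-- The covariance of `B_{u₁}` and `B_{x+u₂} - B_x`. For negative `x` it describes the increments
in the opposite order. -/
def covMu (H x u₁ u₂ : ℝ) : ℝ :=
  (|x + u₂| ^ (2 * H) + |u₁ - x| ^ (2 * H) - |x| ^ (2 * H) - |x + u₂ - u₁| ^ (2 * H)) / 2

/-- The constant `κ` is admissible in the local nondeterminism bound for four points, the endpoints
of two increments. -/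
def IsNondetConst (H κ : ℝ) : Prop :=
  0 < κ ∧ κ ≤ 1 ∧ ∀ (c t : Fin 4 → ℝ) (i₀ : Fin 4) (R : ℝ), ∑ i, c i = 0 → 0 ≤ R →
      (∀ j, j ≠ i₀ → R ≤ |t i₀ - t j|) → κ * (c i₀ ^ 2 * R ^ (2 * H)) ≤ fbmVar H c t

/-- The variance of `α B_{u₁} + β (B_{x+u₂} - B_x)`. -/
theorem fbmVar_two_increments (h0 : 0 < H) (α β x u₁ u₂ : ℝ) :
    fbmVar H ![-α, α, -β, β] ![0, u₁, x, x + u₂] =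
      α ^ 2 * |u₁| ^ (2 * H) + 2 * α * β * covMu H x u₁ u₂ + β ^ 2 * |u₂| ^ (2 * H) := by
  have hz : (0 : ℝ) ^ (2 * H) = 0 := Real.zero_rpow (by positivity)
  simp only [fbmVar, covMu, Fin.sum_univ_four, Matrix.cons_val, sub_self, abs_zero, hz, zero_sub,
    sub_zero, abs_neg]
  rw [abs_sub_comm x u₁, abs_sub_comm u₁ (x + u₂), abs_sub_comm x (x + u₂), add_sub_cancel_left]
  ring

theorem covMu_zero_left (x u₂ : ℝ) : covMu H x 0 u₂ = 0 := by
  simp only [covMu, zero_sub, abs_neg, sub_zero]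
  ring

theorem covMu_zero_right (x u₁ : ℝ) : covMu H x u₁ 0 = 0 := by
  simp only [covMu, add_zero]
  rw [abs_sub_comm x u₁]
  ring

/-- The Cauchy-Schwarz inequality for the covariance. -/
theorem covMu_sq_le (h0 : 0 < H) (h1 : H < 1) (x : ℝ) {u₁ u₂ : ℝ} (hu₁ : 0 ≤ u₁) (hu₂ : 0 ≤ u₂) :
    covMu H x u₁ u₂ ^ 2 ≤ u₁ ^ (2 * H) * u₂ ^ (2 * H) := by
  rcases hu₁.eq_or_lt with rfl | hu
  · rw [covMu_zero_left]; simp; positivity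
  have h := fbmVar_nonneg h0 h1 (c := ![-(-covMu H x u₁ u₂), -covMu H x u₁ u₂,
    -(u₁ ^ (2 * H)), u₁ ^ (2 * H)]) (by simp [Fin.sum_univ_four]) ![0, u₁, x, x + u₂]
  rw [fbmVar_two_increments h0, abs_of_nonneg hu₁, abs_of_nonneg hu₂] at h
  have hp : 0 < u₁ ^ (2 * H) := by positivity
  nlinarith

/-- Local nondeterminism at the endpoint `x + u₂`, for the residual of the regression of
`B_{x+u₂} - B_x` on `B_{u₁}`. -/
theorem IsNondetConst.det_ge_right {κ : ℝ} (hκ : IsNondetConst H κ) (h0 : 0 < H)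
    {x u₁ u₂ R : ℝ} (hu₁ : 0 ≤ u₁) (hu₂ : 0 ≤ u₂) (hR : 0 ≤ R)
    (hR1 : R ≤ |x + u₂|) (hR2 : R ≤ |x + u₂ - u₁|) (hR3 : R ≤ u₂) :
    κ * (u₁ ^ (2 * H) * R ^ (2 * H)) ≤
      u₁ ^ (2 * H) * u₂ ^ (2 * H) - covMu H x u₁ u₂ ^ 2 := by
  rcases hu₁.eq_or_lt with rfl | hu
  · rw [covMu_zero_left, Real.zero_rpow (by positivity)]; simp
  have h := hκ.2.2 ![-(-covMu H x u₁ u₂), -covMu H x u₁ u₂, -(u₁ ^ (2 * H)), u₁ ^ (2 * H)]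
    ![0, u₁, x, x + u₂] 3 R (by simp [Fin.sum_univ_four]) hR (by
      intro j hj
      fin_cases j
      · simpa using hR1
      · simpa using hR2
      · simpa [abs_of_nonneg hu₂] using hR3
      · exact absurd rfl hj)
  rw [fbmVar_two_increments h0, abs_of_nonneg hu₁, abs_of_nonneg hu₂] at h
  simp only [Matrix.cons_val] at h
  have hp : 0 < u₁ ^ (2 * H) := by positivity
  refine le_of_mul_le_mul_left ?_ hp
  linarith

/-- Local nondeterminism at the endpoint `0`, for the residual of the regression of `B_{u₁}` on
`B_{x+u₂} - B_x`. -/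
theorem IsNondetConst.det_ge_zero {κ : ℝ} (hκ : IsNondetConst H κ) (h0 : 0 < H)
    {x u₁ u₂ R : ℝ} (hu₁ : 0 ≤ u₁) (hu₂ : 0 ≤ u₂) (hR : 0 ≤ R)
    (hR1 : R ≤ u₁) (hR2 : R ≤ |x|) (hR3 : R ≤ |x + u₂|) :
    κ * (u₂ ^ (2 * H) * R ^ (2 * H)) ≤
      u₁ ^ (2 * H) * u₂ ^ (2 * H) - covMu H x u₁ u₂ ^ 2 := by
  rcases hu₂.eq_or_lt with rfl | hu
  · rw [covMu_zero_right, Real.zero_rpow (by positivity)]; simp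
  have h := hκ.2.2 ![-(u₂ ^ (2 * H)), u₂ ^ (2 * H), -(-covMu H x u₁ u₂), -covMu H x u₁ u₂]
    ![0, u₁, x, x + u₂] 0 R (by simp [Fin.sum_univ_four]) hR (by
      intro j hj
      fin_cases j
      · exact absurd rfl hj
      · simpa [abs_of_nonneg hu₁] using hR1
      · simpa using hR2
      · simpa [← abs_neg (x + u₂)] using hR3)
  rw [fbmVar_two_increments h0, abs_of_nonneg hu₁, abs_of_nonneg hu₂] at h
  simp only [Matrix.cons_val] at h
  have hp : 0 < u₂ ^ (2 * H) := by positivity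
  refine le_of_mul_le_mul_left ?_ hp
  linarith

/-- Local nondeterminism at the endpoint `u₁`, for the residual of the regression of `B_{u₁}` on
`B_{x+u₂} - B_x`. -/
theorem IsNondetConst.det_ge_left {κ : ℝ} (hκ : IsNondetConst H κ) (h0 : 0 < H)
    {x u₁ u₂ R : ℝ} (hu₁ : 0 ≤ u₁) (hu₂ : 0 ≤ u₂) (hR : 0 ≤ R)
    (hR1 : R ≤ u₁) (hR2 : R ≤ |u₁ - x|) (hR3 : R ≤ |u₁ - (x + u₂)|) :
    κ * (u₂ ^ (2 * H) * R ^ (2 * H)) ≤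
      u₁ ^ (2 * H) * u₂ ^ (2 * H) - covMu H x u₁ u₂ ^ 2 := by
  rcases hu₂.eq_or_lt with rfl | hu
  · rw [covMu_zero_right, Real.zero_rpow (by positivity)]; simp
  have h := hκ.2.2 ![-(u₂ ^ (2 * H)), u₂ ^ (2 * H), -(-covMu H x u₁ u₂), -covMu H x u₁ u₂]
    ![0, u₁, x, x + u₂] 1 R (by simp [Fin.sum_univ_four]) hR (by
      intro j hj
      fin_cases j
      · simpa [abs_of_nonneg hu₁] using hR1
      · exact absurd rfl hj
      · simpa using hR2
      · simpa using hR3)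
  rw [fbmVar_two_increments h0, abs_of_nonneg hu₁, abs_of_nonneg hu₂] at h
  simp only [Matrix.cons_val] at h
  have hp : 0 < u₂ ^ (2 * H) := by positivity
  refine le_of_mul_le_mul_left ?_ hp
  linarith

theorem one_add_rpow_le (h0 : 0 < H) (h1 : H < 1) {y : ℝ} (hy : 0 ≤ y) :
    (1 + y) ^ (2 * H) ≤ 4 * (1 + y ^ (2 * H)) := by
  have h4 : (2 : ℝ) ^ (2 * H) ≤ 4 := by
    calc (2 : ℝ) ^ (2 * H) ≤ 2 ^ (2 : ℝ) := by
          apply Real.rpow_le_rpow_of_exponent_le <;> linarith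
      _ = 4 := by norm_num
  have hp : 0 ≤ y ^ (2 * H) := by positivity
  rcases le_total y 1 with h | h
  · calc (1 + y) ^ (2 * H) ≤ 2 ^ (2 * H) := by
          apply Real.rpow_le_rpow <;> linarith
      _ ≤ 4 * (1 + y ^ (2 * H)) := by linarith
  · calc (1 + y) ^ (2 * H) ≤ (2 * y) ^ (2 * H) := by
          apply Real.rpow_le_rpow <;> linarith
      _ = 2 ^ (2 * H) * y ^ (2 * H) := Real.mul_rpow two_pos.le hy
      _ ≤ 4 * y ^ (2 * H) := by gcongr
      _ ≤ 4 * (1 + y ^ (2 * H)) := by linarith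

/-- The second difference of `y ↦ y^{2H}`, by two applications of the mean value inequality. -/
theorem abs_second_difference_le (h0 : 0 < H) (h1 : H < 1) {a b c : ℝ} (ha : 0 ≤ a) (hb : 0 < b)
    (hc : 0 ≤ c) :
    |(a + b + c) ^ (2 * H) + b ^ (2 * H) - (a + b) ^ (2 * H) - (b + c) ^ (2 * H)| ≤
      2 * (a * c * b ^ (2 * H - 2)) := by
  have hg : ∀ y, b ≤ y → |(y + c) ^ (2 * H - 1) - y ^ (2 * H - 1)| ≤ b ^ (2 * H - 2) * c := by
    intro y hy
    have h := (convex_Ici b).norm_image_sub_le_of_norm_hasDerivWithin_le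
      (f := fun y : ℝ => y ^ (2 * H - 1)) (f' := fun y => (2 * H - 1) * y ^ (2 * H - 1 - 1))
      (C := b ^ (2 * H - 2)) (x := y) (y := y + c)
      (fun z hz => (Real.hasDerivAt_rpow_const (Or.inl (hb.trans_le hz).ne')).hasDerivWithinAt)
      (fun z hz => by
        have hz0 : 0 < z := hb.trans_le hz
        rw [norm_mul, Real.norm_eq_abs, Real.norm_of_nonneg (by positivity)]
        calc |2 * H - 1| * z ^ (2 * H - 1 - 1) ≤ 1 * b ^ (2 * H - 1 - 1) := by
              gcongr ?_ * ?_
              · exact abs_le.2 ⟨by linarith, by linarith⟩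
              · exact Real.rpow_le_rpow_of_nonpos hb hz (by linarith)
          _ = b ^ (2 * H - 2) := by rw [one_mul]; ring_nf)
      hy (show b ≤ y + c by linarith)
    rw [add_sub_cancel_left, Real.norm_of_nonneg hc] at h
    exact h
  have h := (convex_Ici b).norm_image_sub_le_of_norm_hasDerivWithin_le
    (f := fun y : ℝ => (y + c) ^ (2 * H) - y ^ (2 * H))
    (f' := fun y => 2 * H * (y + c) ^ (2 * H - 1) - 2 * H * y ^ (2 * H - 1))
    (C := 2 * (b ^ (2 * H - 2) * c)) (x := b) (y := a + b)
    (fun z hz => by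
      have hz0 : 0 < z := hb.trans_le hz
      refine (HasDerivAt.sub ?_
        (Real.hasDerivAt_rpow_const (Or.inl hz0.ne'))).hasDerivWithinAt
      have := ((hasDerivAt_id z).add_const c).rpow_const (p := 2 * H) (Or.inl (by positivity))
      simpa using this)
    (fun z hz => by
      rw [← mul_sub, norm_mul, Real.norm_eq_abs, Real.norm_eq_abs]
      gcongr
      · rw [abs_of_pos (by positivity)]; linarith
      · exact hg z hz)
    (show b ≤ b from le_rfl) (show b ≤ a + b by linarith)
  rw [add_sub_cancel_right, Real.norm_of_nonneg ha, Real.norm_eq_abs] at h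
  calc _ = |(a + b + c) ^ (2 * H) - (a + b) ^ (2 * H) - ((b + c) ^ (2 * H) - b ^ (2 * H))| := by
        congr 1; ring
    _ ≤ _ := h
    _ = _ := by ring

theorem rpow_add_sub_rpow_le (h0 : 0 < H) (h1 : H < 1) {a b : ℝ} (ha : 0 ≤ a) (hb : 0 ≤ b) :
    0 ≤ (a + b) ^ (2 * H) - a ^ (2 * H) ∧
      (a + b) ^ (2 * H) - a ^ (2 * H) ≤ 2 * ((1 + b) * (1 + a + b) ^ (2 * H - 1)) := by
  refine ⟨sub_nonneg.2 (Real.rpow_le_rpow ha (by linarith) (by positivity)), ?_⟩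
  have hab := add_nonneg ha hb
  rcases hab.eq_or_lt with h | h
  · have ha' : a = 0 := by linarith
    have hb' : b = 0 := by linarith
    subst ha' hb'
    simp
  set y := a + b
  set s := a / y
  have hs0 : 0 ≤ s := by positivity
  have hs1 : s ≤ 1 := (div_le_one h).2 (by simp only [y]; linarith)
  have ha' : a ^ (2 * H) = y ^ (2 * H) * s ^ (2 * H) := by
    rw [← Real.mul_rpow h.le hs0]; congr 1; simp only [s]; field_simp
  have hs : 2 * s - 1 ≤ s ^ (2 * H) := by
    rcases hs0.eq_or_lt with hs | hs
    · rw [← hs]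
      have : (0 : ℝ) ≤ 0 ^ (2 * H) := by positivity
      linarith
    · have h2 : s ^ (2 : ℝ) ≤ s ^ (2 * H) :=
        Real.rpow_le_rpow_of_exponent_ge hs hs1 (by linarith)
      rw [Real.rpow_two] at h2
      nlinarith [sq_nonneg (s - 1)]
  have hy : 1 - s = b / y := by
    simp only [s]
    rw [eq_div_iff h.ne', sub_mul, div_mul_cancel₀ _ h.ne']
    simp only [y]
    ring
  have hby : b / y ≤ (1 + b) / (1 + a + b) := by
    rw [div_le_div_iff₀ h (by linarith)]
    simp only [y]
    nlinarith
  have hpow : y ^ (2 * H) ≤ (1 + a + b) ^ (2 * H) :=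
    Real.rpow_le_rpow h.le (by simp only [y]; linarith) (by positivity)
  have hpos : (0 : ℝ) < 1 + a + b := by linarith
  calc y ^ (2 * H) - a ^ (2 * H) = y ^ (2 * H) * (1 - s ^ (2 * H)) := by rw [ha']; ring
    _ ≤ y ^ (2 * H) * (2 * (b / y)) := by
        rw [← hy]
        gcongr
        linarith
    _ ≤ (1 + a + b) ^ (2 * H) * (2 * ((1 + b) / (1 + a + b))) := by gcongr
    _ = 2 * ((1 + b) * (1 + a + b) ^ (2 * H - 1)) := by
        rw [Real.rpow_sub hpos, Real.rpow_one]; ring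

/-- The determinant `(1 + u₁^{2H}) (1 + u₂^{2H}) - μ²`. -/
def detD (H x u₁ u₂ : ℝ) : ℝ := (1 + u₁ ^ (2 * H)) * (1 + u₂ ^ (2 * H)) - covMu H x u₁ u₂ ^ 2

/-- The squared correlation `μ² / ((1 + u₁^{2H}) (1 + u₂^{2H}))`. -/
def corrSq (H x u₁ u₂ : ℝ) : ℝ :=
  covMu H x u₁ u₂ ^ 2 / ((1 + u₁ ^ (2 * H)) * (1 + u₂ ^ (2 * H)))

theorem one_le_detD (h0 : 0 < H) (h1 : H < 1) (x : ℝ) {u₁ u₂ : ℝ} (hu₁ : 0 ≤ u₁) (hu₂ : 0 ≤ u₂) :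
    1 ≤ detD H x u₁ u₂ := by
  have h := covMu_sq_le h0 h1 x hu₁ hu₂
  have h2 : 0 ≤ u₁ ^ (2 * H) := by positivity
  have h3 : 0 ≤ u₂ ^ (2 * H) := by positivity
  rw [detD]
  nlinarith

theorem corrSq_nonneg (x : ℝ) {u₁ u₂ : ℝ} (hu₁ : 0 ≤ u₁) (hu₂ : 0 ≤ u₂) :
    0 ≤ corrSq H x u₁ u₂ := by
  rw [corrSq]; positivity

theorem corrSq_lt_one (h0 : 0 < H) (h1 : H < 1) (x : ℝ) {u₁ u₂ : ℝ} (hu₁ : 0 ≤ u₁)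
    (hu₂ : 0 ≤ u₂) : corrSq H x u₁ u₂ < 1 := by
  have h := one_le_detD h0 h1 x hu₁ hu₂
  rw [corrSq, div_lt_one (by positivity)]
  rw [detD] at h
  linarith

end Estimates


/-! ### Bounds for disjoint, overlapping and nested increments -/

section Regions

variable {H : ℝ}

/-- The function dominating `F`, up to a constant. -/
def domF (H : ℝ) (d : ℕ) (x u₁ u₂ : ℝ) : ℝ :=
  corrSq H x u₁ u₂ * detD H x u₁ u₂ ^ (-(d : ℝ) / 2)

theorem rpow_detD_le {d : ℕ} {D κ y : ℝ} (hκ : 0 < κ) (hy : 0 < y) (h : κ * y ≤ D) :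
    D ^ (-(d : ℝ) / 2) ≤ κ ^ (-(d : ℝ) / 2) * y ^ (-(d : ℝ) / 2) := by
  rw [← Real.mul_rpow hκ.le hy.le]
  refine Real.rpow_le_rpow_of_nonpos (by positivity) h ?_
  have : (0 : ℝ) ≤ d := by positivity
  linarith

theorem one_add_mul_one_add_ge (h0 : 0 < H) (h1 : H < 1) {a b : ℝ} (ha : 0 ≤ a) (hb : 0 ≤ b) :
    ((1 + a) * (1 + b)) ^ (2 * H) ≤ 16 * ((1 + a ^ (2 * H)) * (1 + b ^ (2 * H))) := by
  rw [Real.mul_rpow (by positivity) (by positivity)]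
  calc (1 + a) ^ (2 * H) * (1 + b) ^ (2 * H)
      ≤ (4 * (1 + a ^ (2 * H))) * (4 * (1 + b ^ (2 * H))) := by
        gcongr
        · exact one_add_rpow_le h0 h1 ha
        · exact one_add_rpow_le h0 h1 hb
    _ = _ := by ring

/-- For the increments over `[0, a]` and `[a + b, a + b + c]` the covariance is a second difference of
`y ↦ y^{2H}`, which gains two powers of the gap `b`. Interpolation with the trivial bound `1` gives
all smaller exponents `γ`. -/
theorem corrSq_le_of_disjoint (h0 : 0 < H) (h1 : H < 1) {γ : ℝ} (hγ0 : 0 ≤ γ)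
    (hγ : γ ≤ 2 - 2 * H) {a b c : ℝ} (ha : 0 ≤ a) (hb : 0 ≤ b) (hc : 0 ≤ c) :
    corrSq H (a + b) a c ≤ 256 * ((1 + a) * (1 + c) / (1 + b) ^ 2) ^ γ := by
  set ξ := (1 + a) * (1 + c) / (1 + b) ^ 2 with hξ
  have hξ0 : 0 < ξ := by positivity
  have hle1 : corrSq H (a + b) a c ≤ 1 := (corrSq_lt_one h0 h1 _ ha hc).le
  rcases le_total 1 ξ with h | h
  · have := Real.one_le_rpow h hγ0
    linarith
  have hξγ : ξ ^ (2 - 2 * H) ≤ ξ ^ γ := Real.rpow_le_rpow_of_exponent_ge hξ0 h hγ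
  suffices hs : corrSq H (a + b) a c ≤ 256 * ξ ^ (2 - 2 * H) by linarith
  have h4 : (4 : ℝ) ^ (2 - 2 * H) ≤ 16 := by
    calc (4 : ℝ) ^ (2 - 2 * H) ≤ 4 ^ (2 : ℝ) := by
          apply Real.rpow_le_rpow_of_exponent_le <;> linarith
      _ = 16 := by norm_num
  rcases le_total b 1 with hb1 | hb1
  · have h5 : 1 ≤ 4 * ξ := by
      rw [hξ, ← mul_div_assoc, le_div_iff₀ (by positivity)]
      nlinarith [mul_nonneg ha hc]
    have h6 : 1 ≤ (4 * ξ) ^ (2 - 2 * H) := Real.one_le_rpow h5 (by linarith)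
    rw [Real.mul_rpow (by norm_num) hξ0.le] at h6
    have : 0 < ξ ^ (2 - 2 * H) := by positivity
    nlinarith
  · have hb0 : 0 < b := by linarith
    have hm := abs_second_difference_le h0 h1 ha hb0 hc
    have hcov : covMu H (a + b) a c =
        ((a + b + c) ^ (2 * H) + b ^ (2 * H) - (a + b) ^ (2 * H) - (b + c) ^ (2 * H)) / 2 := by
      rw [covMu, abs_of_nonneg (by positivity : 0 ≤ a + b + c), show a - (a + b) = -b by ring,
        abs_neg, abs_of_nonneg hb, abs_of_nonneg (by positivity : 0 ≤ a + b),
        show a + b + c - a = b + c by ring, abs_of_nonneg (by positivity : 0 ≤ b + c)]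
    have hcov2 : covMu H (a + b) a c ^ 2 ≤ (a * c * b ^ (2 * H - 2)) ^ 2 := by
      rw [sq_le_sq, hcov, abs_div, abs_of_pos (two_pos : (0 : ℝ) < 2),
        abs_of_nonneg (by positivity : 0 ≤ a * c * b ^ (2 * H - 2))]
      linarith
    have h7 := one_add_mul_one_add_ge h0 h1 ha hc
    have hac : 0 < (1 + a) * (1 + c) := by positivity
    have hb2 : (b ^ (2 * H - 2)) ^ 2 ≤ 16 * (((1 + b) ^ 2)⁻¹) ^ (2 - 2 * H) := by
      have e1 : (b ^ (2 * H - 2)) ^ 2 = ((b ^ 2)⁻¹) ^ (2 - 2 * H) := by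
        rw [Real.inv_rpow (by positivity), ← Real.rpow_neg (by positivity), ← Real.rpow_natCast,
          ← Real.rpow_natCast, ← Real.rpow_mul hb0.le, ← Real.rpow_mul hb0.le]
        congr 1
        push_cast
        ring
      calc (b ^ (2 * H - 2)) ^ 2 = ((b ^ 2)⁻¹) ^ (2 - 2 * H) := e1
        _ ≤ (4 * ((1 + b) ^ 2)⁻¹) ^ (2 - 2 * H) := by
            refine Real.rpow_le_rpow (by positivity) ?_ (by linarith)
            rw [← div_eq_mul_inv, inv_eq_one_div, div_le_div_iff₀ (by positivity) (by positivity)]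
            nlinarith
        _ = 4 ^ (2 - 2 * H) * (((1 + b) ^ 2)⁻¹) ^ (2 - 2 * H) :=
            Real.mul_rpow (by norm_num) (by positivity)
        _ ≤ _ := by gcongr
    have hac2 : (a * c) ^ 2 ≤ ((1 + a) * (1 + c)) ^ (2 - 2 * H) * ((1 + a) * (1 + c)) ^ (2 * H) := by
      rw [← Real.rpow_add hac, show 2 - 2 * H + 2 * H = 2 by ring, Real.rpow_two]
      gcongr <;> linarith
    rw [corrSq, div_le_iff₀ (by positivity)]
    calc covMu H (a + b) a c ^ 2 ≤ (a * c) ^ 2 * (b ^ (2 * H - 2)) ^ 2 := by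
          rw [← mul_pow]; exact hcov2
      _ ≤ (((1 + a) * (1 + c)) ^ (2 - 2 * H) * (16 * ((1 + a ^ (2 * H)) * (1 + c ^ (2 * H))))) *
          (16 * (((1 + b) ^ 2)⁻¹) ^ (2 - 2 * H)) := by
          refine mul_le_mul (hac2.trans ?_) hb2 (by positivity) (by positivity)
          gcongr
      _ = 256 * ξ ^ (2 - 2 * H) * ((1 + a ^ (2 * H)) * (1 + c ^ (2 * H))) := by
          rw [hξ, div_eq_mul_inv, Real.mul_rpow hac.le (by positivity)]
          ring

/-- The increments over `[0, a]` and `[a + b, a + b + c]`. -/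
theorem domF_le_of_disjoint {κ : ℝ} (hκ : IsNondetConst H κ) (h0 : 0 < H) (h1 : H < 1) (d : ℕ)
    {γ : ℝ} (hγ0 : 0 ≤ γ) (hγ : γ ≤ 2 - 2 * H) {a b c : ℝ} (ha : 0 ≤ a) (hb : 0 ≤ b)
    (hc : 0 ≤ c) :
    domF H d (a + b) a c ≤ 256 * (κ / 16) ^ (-(d : ℝ) / 2) *
      ((1 + a) ^ (-(H * d - γ)) * ((1 + b) ^ (-(2 * γ)) * (1 + c) ^ (-(H * d - γ)))) := by
  have hκ0 := hκ.1
  have hr := corrSq_le_of_disjoint h0 h1 hγ0 hγ ha hb hc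
  have hdet := hκ.det_ge_right h0 (x := a + b) ha hc hc
    (by rw [abs_of_nonneg (by positivity)]; linarith)
    (by rw [abs_of_nonneg (by linarith)]; linarith) le_rfl
  have h7 := one_add_mul_one_add_ge h0 h1 ha hc
  have hl : 0 ≤ a ^ (2 * H) := by positivity
  have hρ : 0 ≤ c ^ (2 * H) := by positivity
  have hD : κ / 16 * ((1 + a) * (1 + c)) ^ (2 * H) ≤ detD H (a + b) a c := by
    calc κ / 16 * ((1 + a) * (1 + c)) ^ (2 * H)
        ≤ κ / 16 * (16 * ((1 + a ^ (2 * H)) * (1 + c ^ (2 * H)))) := by gcongr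
      _ = κ * (1 + a ^ (2 * H) + c ^ (2 * H)) + κ * (a ^ (2 * H) * c ^ (2 * H)) := by ring
      _ ≤ 1 * (1 + a ^ (2 * H) + c ^ (2 * H)) +
          (a ^ (2 * H) * c ^ (2 * H) - covMu H (a + b) a c ^ 2) := by
          gcongr
          exact hκ.2.1
      _ = detD H (a + b) a c := by rw [detD]; ring
  have hD2 := rpow_detD_le (d := d) (by positivity) (by positivity) hD
  have hDp : 0 ≤ detD H (a + b) a c ^ (-(d : ℝ) / 2) :=
    Real.rpow_nonneg (zero_le_one.trans (one_le_detD h0 h1 _ ha hc)) _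
  rw [domF]
  calc _ ≤ 256 * ((1 + a) * (1 + c) / (1 + b) ^ 2) ^ γ *
        ((κ / 16) ^ (-(d : ℝ) / 2) * (((1 + a) * (1 + c)) ^ (2 * H)) ^ (-(d : ℝ) / 2)) := by
        gcongr
    _ = _ := by
        have hA : 0 < 1 + a := by linarith
        have hB : 0 < 1 + b := by linarith
        have hC : 0 < 1 + c := by linarith
        rw [Real.div_rpow (by positivity) (by positivity), Real.mul_rpow hA.le hC.le,
          Real.mul_rpow hA.le hC.le, Real.mul_rpow (by positivity) (by positivity),
          ← Real.rpow_mul hA.le, ← Real.rpow_mul hC.le, ← Real.rpow_natCast (1 + b),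
          ← Real.rpow_mul hB.le, div_eq_mul_inv, ← Real.rpow_neg hB.le,
          show -(H * d - γ) = γ + 2 * H * (-(d : ℝ) / 2) by ring, Real.rpow_add hA,
          Real.rpow_add hC]
        push_cast
        ring

/-- The increments over `[0, a + b]` and `[a, a + b + c]`; here the squared correlation is only bounded
by `1`, and the determinant alone provides the decay. -/
theorem domF_le_of_overlap {κ : ℝ} (hκ : IsNondetConst H κ) (h0 : 0 < H) (h1 : H < 1) (d : ℕ)
    {a b c : ℝ} (ha : 0 ≤ a) (hb : 0 ≤ b) (hc : 0 ≤ c) :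
    domF H d a (a + b) (b + c) ≤ (κ / 16) ^ (-(d : ℝ) / 2) *
      ((1 + a) ^ (-(2 * (H * d) / 3)) *
        ((1 + b) ^ (-(2 * (H * d) / 3)) * (1 + c) ^ (-(2 * (H * d) / 3)))) := by
  have hκ0 := hκ.1
  have hab : 0 ≤ a + b := by linarith
  have hbc : 0 ≤ b + c := by linarith
  have hl : 0 ≤ (a + b) ^ (2 * H) := by positivity
  have hρ : 0 ≤ (b + c) ^ (2 * H) := by positivity
  have hA : 0 < 1 + a := by linarith
  have hB : 0 < 1 + b := by linarith
  have hC : 0 < 1 + c := by linarith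
  have hdet := hκ.det_ge_right h0 (x := a) hab hbc hc
    (by rw [abs_of_nonneg (by linarith)]; linarith)
    (by rw [abs_of_nonneg (by linarith)]; linarith) (by linarith)
  have hdet' := hκ.det_ge_zero h0 (x := a) hab hbc ha (by linarith)
    (by rw [abs_of_nonneg ha]) (by rw [abs_of_nonneg (by linarith)]; linarith)
  have hcl : c ^ (2 * H) ≤ (b + c) ^ (2 * H) := by gcongr; linarith
  have hal : a ^ (2 * H) ≤ (a + b) ^ (2 * H) := by gcongr; linarith
  have hD1 : κ / 16 * ((1 + (a + b)) * (1 + c)) ^ (2 * H) ≤ detD H a (a + b) (b + c) := by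
    calc κ / 16 * ((1 + (a + b)) * (1 + c)) ^ (2 * H)
        ≤ κ / 16 * (16 * ((1 + (a + b) ^ (2 * H)) * (1 + c ^ (2 * H)))) := by
          gcongr
          exact one_add_mul_one_add_ge h0 h1 hab hc
      _ = κ * (1 + (a + b) ^ (2 * H) + c ^ (2 * H)) + κ * ((a + b) ^ (2 * H) * c ^ (2 * H)) := by ring
      _ ≤ 1 * (1 + (a + b) ^ (2 * H) + (b + c) ^ (2 * H)) +
          ((a + b) ^ (2 * H) * (b + c) ^ (2 * H) - covMu H a (a + b) (b + c) ^ 2) := by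
          gcongr
          exact hκ.2.1
      _ = detD H a (a + b) (b + c) := by rw [detD]; ring
  have hD2 : κ / 16 * ((1 + a) * (1 + (b + c))) ^ (2 * H) ≤ detD H a (a + b) (b + c) := by
    calc κ / 16 * ((1 + a) * (1 + (b + c))) ^ (2 * H)
        ≤ κ / 16 * (16 * ((1 + a ^ (2 * H)) * (1 + (b + c) ^ (2 * H)))) := by
          gcongr
          exact one_add_mul_one_add_ge h0 h1 ha hbc
      _ = κ * (1 + a ^ (2 * H) + (b + c) ^ (2 * H)) + κ * ((b + c) ^ (2 * H) * a ^ (2 * H)) := by ring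
      _ ≤ 1 * (1 + (a + b) ^ (2 * H) + (b + c) ^ (2 * H)) +
          ((a + b) ^ (2 * H) * (b + c) ^ (2 * H) - covMu H a (a + b) (b + c) ^ 2) := by
          gcongr
          exact hκ.2.1
      _ = detD H a (a + b) (b + c) := by rw [detD]; ring
  -- The two bounds are combined into their geometric mean, after estimating
  -- `1 + a + b` from below by `(1 + a)^{1/3} (1 + b)^{2/3}`.
  have hDp : 0 < detD H a (a + b) (b + c) :=
    zero_lt_one.trans_le (one_le_detD h0 h1 _ hab hbc)
  set Y := (1 + a) * ((1 + b) * (1 + c)) with hY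
  have hY0 : 0 < Y := by positivity
  have hcube : Y ^ 4 ≤ ((1 + (a + b)) * (1 + c) * ((1 + a) * (1 + (b + c)))) ^ 3 := by
    have e1 : (1 + a) * (1 + b) ^ 2 ≤ (1 + (a + b)) ^ 3 := by
      calc (1 + a) * (1 + b) ^ 2 ≤ (1 + (a + b)) * (1 + (a + b)) ^ 2 := by gcongr <;> linarith
        _ = _ := by ring
    have e2 : (1 + c) * (1 + b) ^ 2 ≤ (1 + (b + c)) ^ 3 := by
      calc (1 + c) * (1 + b) ^ 2 ≤ (1 + (b + c)) * (1 + (b + c)) ^ 2 := by gcongr <;> linarith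
        _ = _ := by ring
    calc Y ^ 4 = ((1 + a) * (1 + b) ^ 2) * ((1 + c) * (1 + b) ^ 2) * ((1 + a) ^ 3 * (1 + c) ^ 3) := by
          rw [hY]; ring
      _ ≤ (1 + (a + b)) ^ 3 * (1 + (b + c)) ^ 3 * ((1 + a) ^ 3 * (1 + c) ^ 3) := by gcongr
      _ = _ := by ring
  have hD : κ / 16 * (Y ^ (2 / 3 : ℝ)) ^ (2 * H) ≤ detD H a (a + b) (b + c) := by
    have hsq : (Y ^ (2 / 3 : ℝ)) ^ 2 ≤ (1 + (a + b)) * (1 + c) * ((1 + a) * (1 + (b + c))) := by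
      refine le_of_pow_le_pow_left₀ three_ne_zero (by positivity) ?_
      refine le_trans (le_of_eq ?_) hcube
      rw [← Real.rpow_natCast, ← Real.rpow_natCast, ← Real.rpow_mul hY0.le, ← Real.rpow_mul hY0.le,
        ← Real.rpow_natCast]
      norm_num
    refine le_of_pow_le_pow_left₀ two_ne_zero hDp.le ?_
    calc (κ / 16 * (Y ^ (2 / 3 : ℝ)) ^ (2 * H)) ^ 2
        = (κ / 16) ^ 2 * ((Y ^ (2 / 3 : ℝ)) ^ 2) ^ (2 * H) := by
          rw [mul_pow, Real.rpow_pow_comm (by positivity)]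
      _ ≤ (κ / 16) ^ 2 * ((1 + (a + b)) * (1 + c) * ((1 + a) * (1 + (b + c)))) ^ (2 * H) := by
          gcongr
      _ = (κ / 16 * ((1 + (a + b)) * (1 + c)) ^ (2 * H)) *
          (κ / 16 * ((1 + a) * (1 + (b + c))) ^ (2 * H)) := by
          rw [Real.mul_rpow (by positivity) (by positivity)]; ring
      _ ≤ detD H a (a + b) (b + c) * detD H a (a + b) (b + c) := by gcongr
      _ = detD H a (a + b) (b + c) ^ 2 := by ring
  have hfin := rpow_detD_le (d := d) (by positivity) (by positivity) hD
  have hDp' : 0 ≤ detD H a (a + b) (b + c) ^ (-(d : ℝ) / 2) := by positivity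
  rw [domF]
  calc _ ≤ 1 * detD H a (a + b) (b + c) ^ (-(d : ℝ) / 2) := by
        gcongr
        exact (corrSq_lt_one h0 h1 _ hab hbc).le
    _ ≤ (κ / 16) ^ (-(d : ℝ) / 2) * ((Y ^ (2 / 3 : ℝ)) ^ (2 * H)) ^ (-(d : ℝ) / 2) := by
        rw [one_mul]; exact hfin
    _ = _ := by
        rw [← Real.rpow_mul hY0.le, ← Real.rpow_mul hY0.le, hY,
          Real.mul_rpow (by positivity) (by positivity),
          Real.mul_rpow (by positivity) (by positivity),
          show 2 / 3 * (2 * H) * (-(d : ℝ) / 2) = -(2 * (H * d) / 3) by ring]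

/-- The weight that controls the squared correlation of nested increments. -/
def nestedWeight (H a b c : ℝ) : ℝ :=
  (1 + b) ^ 2 * ((1 + a + b) ^ (2 * H - 1)) ^ 2 / ((1 + (a + b + c)) * (1 + b)) ^ (2 * H)

theorem nestedWeight_eq {a b c : ℝ} (ha : 0 ≤ a) (hb : 0 ≤ b) (hc : 0 ≤ c) :
    nestedWeight H a b c = ((1 + b) / (1 + a + b)) ^ (2 - 4 * H) *
      ((1 + b) / (1 + (a + b + c))) ^ (2 * H) := by
  have hB : 0 < 1 + b := by linarith
  have hA : 0 < 1 + a + b := by linarith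
  have hL : 0 < 1 + (a + b + c) := by linarith
  rw [nestedWeight, Real.div_rpow hB.le hA.le, Real.div_rpow hB.le hL.le,
    Real.mul_rpow hL.le hB.le, ← Real.rpow_natCast ((1 + a + b) ^ (2 * H - 1)),
    ← Real.rpow_mul hA.le, ← Real.rpow_two,
    show (2 * H - 1) * ((2 : ℕ) : ℝ) = -(2 - 4 * H) by push_cast; ring, Real.rpow_neg hA.le,
    show (2 : ℝ) = (2 - 4 * H) + 2 * H + 2 * H by ring, Real.rpow_add hB, Real.rpow_add hB]
  rw [show (2 - 4 * H) + 2 * H + 2 * H = 2 by ring]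
  have : (1 + b) ^ (2 * H) ≠ 0 := by positivity
  field_simp

theorem nestedWeight_le {a b c : ℝ} (hH : 1 / 2 ≤ H) (ha : 0 ≤ a)
    (hb : 0 ≤ b) (hc : 0 ≤ c) :
    nestedWeight H a b c ≤ ((1 + b) / (1 + (a + b + c))) ^ (2 - 2 * H) := by
  have hB : 0 < 1 + b := by linarith
  have hL : 0 < 1 + (a + b + c) := by linarith
  rw [nestedWeight_eq ha hb hc]
  calc _ ≤ ((1 + b) / (1 + (a + b + c))) ^ (2 - 4 * H) *
        ((1 + b) / (1 + (a + b + c))) ^ (2 * H) := by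
        refine mul_le_mul_of_nonneg_right ?_ (by positivity)
        refine Real.rpow_le_rpow_of_nonpos (by positivity) ?_ (by linarith)
        exact div_le_div_of_nonneg_left hB.le (by linarith) (by linarith)
    _ = _ := by
        rw [← Real.rpow_add (by positivity)]
        congr 1
        ring

theorem nestedWeight_le_one {a b c : ℝ} (h0 : 0 < H) (h1 : H < 1) (ha : 0 ≤ a)
    (hb : 0 ≤ b) (hc : 0 ≤ c) : nestedWeight H a b c ≤ 1 := by
  have hq : (1 + b) / (1 + (a + b + c)) ≤ 1 := (div_le_one (by linarith)).2 (by linarith)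
  have hq' : (1 + b) / (1 + a + b) ≤ 1 := (div_le_one (by linarith)).2 (by linarith)
  rcases le_total (1 / 2) H with h | h
  · exact (nestedWeight_le h ha hb hc).trans
      (Real.rpow_le_one (by positivity) hq (by linarith))
  · rw [nestedWeight_eq ha hb hc]
    exact mul_le_one₀ (Real.rpow_le_one (by positivity) hq' (by linarith)) (by positivity)
      (Real.rpow_le_one (by positivity) hq (by linarith))

/-- The increments over `[0, a + b + c]` and `[a, a + b]`; each of the two weights comes from one of the
first differences of `y ↦ y^{2H}` that make up the covariance. -/
theorem corrSq_le_of_nested (h0 : 0 < H) (h1 : H < 1) {a b c : ℝ} (ha : 0 ≤ a) (hb : 0 ≤ b)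
    (hc : 0 ≤ c) :
    corrSq H a (a + b + c) b ≤ 32 * (nestedWeight H a b c + nestedWeight H c b a) := by
  obtain ⟨hma, hma'⟩ := rpow_add_sub_rpow_le h0 h1 ha hb
  obtain ⟨hmc, hmc'⟩ := rpow_add_sub_rpow_le h0 h1 hc hb
  have hcov : covMu H a (a + b + c) b = (((a + b) ^ (2 * H) - a ^ (2 * H)) +
      ((c + b) ^ (2 * H) - c ^ (2 * H))) / 2 := by
    rw [covMu, abs_of_nonneg (by positivity : 0 ≤ a + b), show a + b + c - a = c + b by ring,
      abs_of_nonneg (by positivity : 0 ≤ c + b), abs_of_nonneg ha,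
      show a + b - (a + b + c) = -c by ring, abs_neg, abs_of_nonneg hc]
    ring
  have h7 := one_add_mul_one_add_ge h0 h1 (by positivity : 0 ≤ a + b + c) hb
  set m := (a + b) ^ (2 * H) - a ^ (2 * H)
  set m' := (c + b) ^ (2 * H) - c ^ (2 * H)
  have hm2 : m ^ 2 ≤ 4 * ((1 + b) ^ 2 * ((1 + a + b) ^ (2 * H - 1)) ^ 2) := by
    calc m ^ 2 ≤ (2 * ((1 + b) * (1 + a + b) ^ (2 * H - 1))) ^ 2 := by gcongr
      _ = _ := by ring
  have hm2' : m' ^ 2 ≤ 4 * ((1 + b) ^ 2 * ((1 + c + b) ^ (2 * H - 1)) ^ 2) := by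
    calc m' ^ 2 ≤ (2 * ((1 + b) * (1 + c + b) ^ (2 * H - 1))) ^ 2 := by gcongr
      _ = _ := by ring
  rw [nestedWeight, nestedWeight, show c + b + a = a + b + c by ring, ← add_div, corrSq, hcov,
    ← mul_div_assoc, div_le_div_iff₀ (by positivity) (by positivity)]
  have hS : ((m + m') / 2) ^ 2 ≤ 2 * ((1 + b) ^ 2 * ((1 + a + b) ^ (2 * H - 1)) ^ 2 +
      (1 + b) ^ 2 * ((1 + c + b) ^ (2 * H - 1)) ^ 2) := by
    linarith [sq_nonneg (m - m'), hm2, hm2', add_sq m m', sub_sq m m',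
      show ((m + m') / 2) ^ 2 = (m + m') ^ 2 / 4 by ring]
  calc _ ≤ _ := mul_le_mul hS h7 (by positivity) (by positivity)
    _ = _ := by ring

/-- The decay `N^{-Hd}` is shared between `a` and `c`. For `H ≥ 1/2` the weight is bounded by a power of
`(1 + b) / (1 + a + b + c)` and can be shared in the same way; for `H < 1/2` a part of it decays in
`a` only, and the share of `N^{-Hd}` is shifted towards `c` to compensate. -/
theorem nestedWeight_rpow_mul_le (h0 : 0 < H) (h1 : H < 1) {d : ℕ} {γ θ : ℝ} (hθ : 0 ≤ θ)
    (hθγ : θ * (2 - 2 * H) = γ) (hγd : γ ≤ H * d) {a b c N : ℝ} (ha : 0 ≤ a) (hb : 0 ≤ b)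
    (hc : 0 ≤ c) (hNa : 1 + a ≤ N) (hNc : 1 + c ≤ N) (hNL : N ≤ 1 + (a + b + c)) :
    nestedWeight H a b c ^ θ * N ^ (-(H * d)) ≤
      (1 + b) ^ γ * ((1 + a) ^ (-((H * d + γ) / 2)) * (1 + c) ^ (-((H * d + γ) / 2))) := by
  have hA : 0 < 1 + a := by linarith
  have hB : 0 < 1 + b := by linarith
  have hC : 0 < 1 + c := by linarith
  have hL : 0 < 1 + (a + b + c) := by linarith
  have hAB : 0 < 1 + a + b := by linarith
  have hN : 0 < N := by linarith
  have hγ0 : 0 ≤ γ := hθγ ▸ mul_nonneg hθ (by linarith)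
  have hW : 0 ≤ nestedWeight H a b c := by rw [nestedWeight]; positivity
  rcases le_total (1 / 2) H with h | h
  · have hw : nestedWeight H a b c ^ θ ≤ (1 + b) ^ γ * N ^ (-γ) := by
      calc nestedWeight H a b c ^ θ ≤ (((1 + b) / (1 + (a + b + c))) ^ (2 - 2 * H)) ^ θ :=
            Real.rpow_le_rpow hW (nestedWeight_le h ha hb hc) hθ
        _ = ((1 + b) / (1 + (a + b + c))) ^ γ := by
            rw [← Real.rpow_mul (by positivity), mul_comm, hθγ]
        _ ≤ ((1 + b) / N) ^ γ := by gcongr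
        _ = _ := by rw [Real.div_rpow hB.le hN.le, Real.rpow_neg hN.le, div_eq_mul_inv]
    have hn : N ^ (-γ) * N ^ (-(H * d)) ≤
        (1 + a) ^ (-((H * d + γ) / 2)) * (1 + c) ^ (-((H * d + γ) / 2)) := by
      rw [← Real.rpow_add hN,
        show -γ + -(H * d) = -((H * d + γ) / 2) + -((H * d + γ) / 2) by ring, Real.rpow_add hN]
      gcongr ?_ * ?_
      · exact Real.rpow_le_rpow_of_nonpos hA hNa (by linarith)
      · exact Real.rpow_le_rpow_of_nonpos hC hNc (by linarith)
    calc _ ≤ (1 + b) ^ γ * N ^ (-γ) * N ^ (-(H * d)) := by gcongr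
      _ = (1 + b) ^ γ * (N ^ (-γ) * N ^ (-(H * d))) := by ring
      _ ≤ _ := by gcongr
  · set η := θ * (2 - 4 * H) with hη
    have hη0 : 0 ≤ η := mul_nonneg hθ (by linarith)
    have hηγ : η + 2 * H * θ = γ := by rw [hη, ← hθγ]; ring
    have hHθ : 0 ≤ 2 * H * θ := by positivity
    have hw : nestedWeight H a b c ^ θ ≤ (1 + b) ^ γ * ((1 + a) ^ (-η) * N ^ (-(2 * H * θ))) := by
      calc nestedWeight H a b c ^ θ =
            ((1 + b) / (1 + a + b)) ^ η * ((1 + b) / (1 + (a + b + c))) ^ (2 * H * θ) := by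
            rw [nestedWeight_eq ha hb hc, Real.mul_rpow (by positivity) (by positivity),
              ← Real.rpow_mul (by positivity), ← Real.rpow_mul (by positivity), mul_comm _ θ]
        _ ≤ ((1 + b) / (1 + a)) ^ η * ((1 + b) / N) ^ (2 * H * θ) := by
            refine mul_le_mul (Real.rpow_le_rpow (by positivity) ?_ hη0)
              (Real.rpow_le_rpow (by positivity) ?_ hHθ) (by positivity) (by positivity)
            · exact div_le_div_of_nonneg_left hB.le hA (by linarith)
            · exact div_le_div_of_nonneg_left hB.le hN hNL
        _ = _ := by
            rw [Real.div_rpow hB.le hN.le, Real.rpow_neg hN.le, Real.div_rpow hB.le hA.le,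
              Real.rpow_neg hA.le, ← hηγ, Real.rpow_add hB]
            ring
    have hn : (1 + a) ^ (-η) * N ^ (-(2 * H * θ)) * N ^ (-(H * d)) ≤
        (1 + a) ^ (-((H * d + γ) / 2)) * (1 + c) ^ (-((H * d + γ) / 2)) := by
      rw [mul_assoc, ← Real.rpow_add hN,
        show -(2 * H * θ) + -(H * d) = -((H * d + γ) / 2 - η) + -((H * d + γ) / 2) by
          rw [← hηγ]; ring, Real.rpow_add hN, ← mul_assoc]
      gcongr ?_ * ?_
      · calc (1 + a) ^ (-η) * N ^ (-((H * d + γ) / 2 - η))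
            ≤ (1 + a) ^ (-η) * (1 + a) ^ (-((H * d + γ) / 2 - η)) := by
              gcongr ?_ * ?_
              exact Real.rpow_le_rpow_of_nonpos hA hNa (by linarith)
          _ = _ := by rw [← Real.rpow_add hA]; congr 1; ring
      · exact Real.rpow_le_rpow_of_nonpos hC hNc (by linarith)
    calc _ ≤ (1 + b) ^ γ * ((1 + a) ^ (-η) * N ^ (-(2 * H * θ))) * N ^ (-(H * d)) := by gcongr
      _ = (1 + b) ^ γ * ((1 + a) ^ (-η) * N ^ (-(2 * H * θ)) * N ^ (-(H * d))) := by ring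
      _ ≤ _ := by gcongr

/-- The increments over `[0, a + b + c]` and `[a, a + b]`. -/
theorem domF_le_of_nested {κ : ℝ} (hκ : IsNondetConst H κ) (h0 : 0 < H) (h1 : H < 1) (d : ℕ)
    {γ : ℝ} (hγ0 : 0 ≤ γ) (hγ : γ ≤ 2 - 2 * H) (hγd : γ ≤ H * d) {a b c : ℝ} (ha : 0 ≤ a)
    (hb : 0 ≤ b) (hc : 0 ≤ c) :
    domF H d a (a + b + c) b ≤ 64 * (κ / 32) ^ (-(d : ℝ) / 2) *
      ((1 + b) ^ (-(H * d - γ)) * ((1 + a) ^ (-((H * d + γ) / 2)) *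
        (1 + c) ^ (-((H * d + γ) / 2)))) := by
  have hκ0 := hκ.1
  have hL : 0 ≤ a + b + c := by positivity
  have hB : 0 < 1 + b := by linarith
  have hA0 : 0 ≤ a ^ (2 * H) := by positivity
  have hB0 : 0 ≤ b ^ (2 * H) := by positivity
  have hC0 : 0 ≤ c ^ (2 * H) := by positivity
  have haL : a ^ (2 * H) ≤ (a + b + c) ^ (2 * H) := by gcongr; linarith
  have hcL : c ^ (2 * H) ≤ (a + b + c) ^ (2 * H) := by gcongr; linarith
  have hdet := hκ.det_ge_zero h0 (x := a) hL hb ha (by linarith)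
    (by rw [abs_of_nonneg ha]) (by rw [abs_of_nonneg (by linarith)]; linarith)
  have hdet' := hκ.det_ge_left h0 (x := a) hL hb hc (by linarith)
    (by rw [abs_of_nonneg (by linarith)]; linarith)
    (by rw [abs_of_nonneg (by linarith)]; linarith)
  set N := 1 + max a c with hN
  have hN0 : 0 < N := by positivity
  have hmax : 0 ≤ max a c := by positivity
  have hNle : (max a c) ^ (2 * H) ≤ a ^ (2 * H) + c ^ (2 * H) := by
    rcases max_choice a c with h | h <;> rw [h] <;> linarith
  have hD : κ / 32 * (N * (1 + b)) ^ (2 * H) ≤ detD H a (a + b + c) b := by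
    calc κ / 32 * (N * (1 + b)) ^ (2 * H)
        ≤ κ / 32 * (16 * ((1 + max a c ^ (2 * H)) * (1 + b ^ (2 * H)))) := by
          gcongr
          exact one_add_mul_one_add_ge h0 h1 hmax hb
      _ ≤ κ / 32 * (16 * ((1 + (a ^ (2 * H) + c ^ (2 * H))) * (1 + b ^ (2 * H)))) := by gcongr
      _ = κ * ((1 + (a ^ (2 * H) + c ^ (2 * H)) + b ^ (2 * H)) / 2) +
          (κ * (b ^ (2 * H) * a ^ (2 * H)) + κ * (b ^ (2 * H) * c ^ (2 * H))) / 2 := by ring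
      _ ≤ 1 * ((1 + (a ^ (2 * H) + c ^ (2 * H)) + b ^ (2 * H)) / 2) +
          (((a + b + c) ^ (2 * H) * b ^ (2 * H) - covMu H a (a + b + c) b ^ 2) +
          ((a + b + c) ^ (2 * H) * b ^ (2 * H) - covMu H a (a + b + c) b ^ 2)) / 2 := by
          gcongr
          exact hκ.2.1
      _ ≤ detD H a (a + b + c) b := by rw [detD]; linarith
  have hD2 := rpow_detD_le (d := d) (by positivity) (by positivity) hD
  have hDp : 0 ≤ detD H a (a + b + c) b ^ (-(d : ℝ) / 2) :=
    Real.rpow_nonneg (zero_le_one.trans (one_le_detD h0 h1 _ hL hb)) _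
  have hr := corrSq_le_of_nested h0 h1 ha hb hc
  set θ := γ / (2 - 2 * H) with hθ
  have h2H : 0 < 2 - 2 * H := by linarith
  have hθ0 : 0 ≤ θ := by positivity
  have hθ1 : θ ≤ 1 := (div_le_one h2H).2 hγ
  have hθγ : θ * (2 - 2 * H) = γ := div_mul_cancel₀ _ h2H.ne'
  have hpow : ∀ a c : ℝ, 0 ≤ a → 0 ≤ c → nestedWeight H a b c ≤ nestedWeight H a b c ^ θ := by
    intro a c ha hc
    have h2 := Real.rpow_le_rpow_of_exponent_ge' (x := nestedWeight H a b c)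
      (by rw [nestedWeight]; positivity) (nestedWeight_le_one h0 h1 ha hb hc) hθ0 hθ1
    rwa [Real.rpow_one] at h2
  have hNL : N ≤ 1 + (a + b + c) := by
    rcases max_choice a c with h | h <;> rw [hN, h] <;> linarith
  have hw := nestedWeight_rpow_mul_le h0 h1 hθ0 hθγ hγd ha hb hc (N := N)
    (by rw [hN]; gcongr; exact le_max_left _ _) (by rw [hN]; gcongr; exact le_max_right _ _) hNL
  have hw' := nestedWeight_rpow_mul_le h0 h1 hθ0 hθγ hγd hc hb ha (N := N)
    (by rw [hN]; gcongr; exact le_max_right _ _) (by rw [hN]; gcongr; exact le_max_left _ _)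
    (hNL.trans (by linarith))
  have hNB : ((N * (1 + b)) ^ (2 * H)) ^ (-(d : ℝ) / 2) = N ^ (-(H * d)) * (1 + b) ^ (-(H * d)) := by
    rw [← Real.rpow_mul (by positivity), Real.mul_rpow hN0.le hB.le,
      show 2 * H * (-(d : ℝ) / 2) = -(H * d) by ring]
  set A := (1 + a) ^ (-((H * d + γ) / 2))
  set C := (1 + c) ^ (-((H * d + γ) / 2))
  set W := nestedWeight H a b c ^ θ
  set W' := nestedWeight H c b a ^ θ
  have hW0 : 0 ≤ W := Real.rpow_nonneg (by rw [nestedWeight]; positivity) _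
  have hW0' : 0 ≤ W' := Real.rpow_nonneg (by rw [nestedWeight]; positivity) _
  rw [domF]
  calc _ ≤ (32 * (W + W')) *
        ((κ / 32) ^ (-(d : ℝ) / 2) * (N ^ (-(H * d)) * (1 + b) ^ (-(H * d)))) := by
        rw [← hNB]
        refine mul_le_mul (hr.trans ?_) hD2 hDp (by positivity)
        have h3 := hpow a c ha hc
        have h4 := hpow c a hc ha
        gcongr
    _ = 32 * (κ / 32) ^ (-(d : ℝ) / 2) * (1 + b) ^ (-(H * d)) *
        (W * N ^ (-(H * d)) + W' * N ^ (-(H * d))) := by ring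
    _ ≤ 32 * (κ / 32) ^ (-(d : ℝ) / 2) * (1 + b) ^ (-(H * d)) *
        ((1 + b) ^ γ * (A * C) + (1 + b) ^ γ * (C * A)) := by
        gcongr
    _ = _ := by
        rw [show -(H * d - γ) = -(H * (d : ℝ)) + γ by ring, Real.rpow_add hB]
        ring

end Regions


/-! ### Integrability over the octant -/

section Integrability

variable {H : ℝ}

theorem integrable_prod_one_add_abs {p₁ p₂ p₃ : ℝ} (h₁ : 1 < p₁) (h₂ : 1 < p₂) (h₃ : 1 < p₃) :
    Integrable fun v : ℝ × ℝ × ℝ =>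
      (1 + |v.1|) ^ (-p₁) * ((1 + |v.2.1|) ^ (-p₂) * (1 + |v.2.2|) ^ (-p₃)) := by
  have h : ∀ {p : ℝ}, 1 < p → Integrable fun y : ℝ => (1 + |y|) ^ (-p) := fun hp => by
    simpa using integrable_one_add_norm (E := ℝ) (μ := volume) (by simpa using hp)
  exact (h h₁).mul_prod ((h h₂).mul_prod (h h₃))

theorem integrable_comp_of_isLinearMap {g : ℝ × ℝ × ℝ → ℝ} (hg : Integrable g)
    {L : ℝ × ℝ × ℝ → ℝ × ℝ × ℝ} (hL : IsLinearMap ℝ L) (hinj : ∀ v, L v = 0 → v = 0) :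
    Integrable fun v => g (L v) := by
  have hi : Function.Injective hL.mk' := (injective_iff_map_eq_zero hL.mk').2 hinj
  have hdet : LinearMap.det hL.mk' ≠ 0 := fun h =>
    (LinearMap.bot_lt_ker_of_det_eq_zero h).ne' (LinearMap.ker_eq_bot.2 hi)
  have hm : Measurable hL.mk' := hL.mk'.continuous_of_finiteDimensional.measurable
  refine Integrable.comp_measurable (μ := volume) (f := hL.mk') (g := g) ?_ hm
  have : (volume : Measure (ℝ × ℝ)).IsAddHaarMeasure :=
    Measure.prod.instIsAddHaarMeasure volume volume
  have : (volume : Measure (ℝ × ℝ × ℝ)).IsAddHaarMeasure :=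
    Measure.prod.instIsAddHaarMeasure volume volume
  rw [Measure.map_linearMap_addHaar_eq_smul_addHaar _ hdet]
  exact hg.smul_measure ENNReal.ofReal_ne_top

theorem continuous_covMu (h0 : 0 < H) :
    Continuous fun v : ℝ × ℝ × ℝ => covMu H v.1 v.2.1 v.2.2 := by
  have h : Continuous fun y : ℝ => |y| ^ (2 * H) :=
    continuous_abs.rpow_const fun _ => Or.inr (by positivity)
  unfold covMu
  exact ((((h.comp (by fun_prop : Continuous fun v : ℝ × ℝ × ℝ => v.1 + v.2.2)).add
    (h.comp (by fun_prop : Continuous fun v : ℝ × ℝ × ℝ => v.2.1 - v.1))).sub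
    (h.comp (by fun_prop : Continuous fun v : ℝ × ℝ × ℝ => v.1))).sub
    (h.comp (by fun_prop : Continuous fun v : ℝ × ℝ × ℝ => v.1 + v.2.2 - v.2.1))).div_const 2

theorem measurable_covMu (h0 : 0 < H) :
    Measurable fun v : ℝ × ℝ × ℝ => covMu H v.1 v.2.1 v.2.2 :=
  (continuous_covMu h0).measurable

theorem measurable_corrSq (h0 : 0 < H) :
    Measurable fun v : ℝ × ℝ × ℝ => corrSq H v.1 v.2.1 v.2.2 := by
  have := measurable_covMu h0
  unfold corrSq
  fun_prop

theorem measurable_detD (h0 : 0 < H) :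
    Measurable fun v : ℝ × ℝ × ℝ => detD H v.1 v.2.1 v.2.2 := by
  have := measurable_covMu h0
  unfold detD
  fun_prop

theorem measurableSet_octant : MeasurableSet octant :=
  (measurableSet_le measurable_const (by fun_prop : Measurable fun v : ℝ × ℝ × ℝ => v.1)).inter
    ((measurableSet_le measurable_const (by fun_prop : Measurable fun v : ℝ × ℝ × ℝ => v.2.1)).inter
      (measurableSet_le measurable_const (by fun_prop : Measurable fun v : ℝ × ℝ × ℝ => v.2.2)))

theorem domF_nonneg (h0 : 0 < H) (h1 : H < 1) (d : ℕ) (x : ℝ) {u₁ u₂ : ℝ} (hu₁ : 0 ≤ u₁)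
    (hu₂ : 0 ≤ u₂) : 0 ≤ domF H d x u₁ u₂ :=
  mul_nonneg (corrSq_nonneg x hu₁ hu₂)
    (Real.rpow_nonneg (zero_le_one.trans (one_le_detD h0 h1 x hu₁ hu₂)) _)

/-- The octant splits according to whether the increments over `[0, u₁]` and `[x, x + u₂]` are
disjoint, overlapping or nested. In each of the three regions the lengths of the three successive
intervals between the endpoints are linear coordinates, in which the bound is a product of
integrable functions of one variable. -/
theorem integrableOn_domF {d : ℕ} (h0 : 0 < H) (hH : H < 3 / 4) (hd : 3 / 2 < H * d) :
    IntegrableOn (fun v : ℝ × ℝ × ℝ => domF H d v.1 v.2.1 v.2.2) octant := by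
  have h1 : H < 1 := by linarith
  obtain ⟨κ, hκ⟩ : ∃ κ, IsNondetConst H κ := exists_fbmVar_ge h0 h1
  -- Both hypotheses on `H` enter through this choice of the exponent.
  obtain ⟨γ, hγ1, hγ2, hγ3⟩ : ∃ γ : ℝ, 1 / 2 < γ ∧ γ ≤ 2 - 2 * H ∧ γ < H * d - 1 :=
    ⟨min (2 - 2 * H) ((H * d - 1 / 2) / 2), lt_min (by linarith) (by linarith), min_le_left _ _,
      (min_le_right _ _).trans_lt (by linarith)⟩
  have i1 := integrable_comp_of_isLinearMap
    (integrable_prod_one_add_abs (p₁ := H * d - γ) (p₂ := 2 * γ) (p₃ := H * d - γ)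
      (by linarith) (by linarith) (by linarith))
    (L := fun v => (v.2.1, v.1 - v.2.1, v.2.2)) ⟨fun v w => by ext <;> simp; ring,
      fun c v => by ext <;> simp; ring⟩ (by
      rintro ⟨x, u₁, u₂⟩ h
      simp only [Prod.mk_eq_zero] at h ⊢
      exact ⟨by linarith [h.1, h.2.1], h.1, h.2.2⟩)
  have i2 := integrable_comp_of_isLinearMap
    (integrable_prod_one_add_abs (p₁ := 2 * (H * d) / 3) (p₂ := 2 * (H * d) / 3)
      (p₃ := 2 * (H * d) / 3) (by linarith) (by linarith) (by linarith))
    (L := fun v => (v.1, v.2.1 - v.1, v.1 + v.2.2 - v.2.1)) ⟨fun v w => by ext <;> simp <;> ring,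
      fun c v => by ext <;> simp <;> ring⟩ (by
      rintro ⟨x, u₁, u₂⟩ h
      simp only [Prod.mk_eq_zero] at h ⊢
      exact ⟨h.1, by linarith [h.1, h.2.1], by linarith [h.1, h.2.1, h.2.2]⟩)
  have i3 := integrable_comp_of_isLinearMap
    (integrable_prod_one_add_abs (p₁ := H * d - γ) (p₂ := (H * d + γ) / 2)
      (p₃ := (H * d + γ) / 2) (by linarith) (by linarith) (by linarith))
    (L := fun v => (v.2.2, v.1, v.2.1 - v.1 - v.2.2)) ⟨fun v w => by ext <;> simp; ring,
      fun c v => by ext <;> simp; ring⟩ (by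
      rintro ⟨x, u₁, u₂⟩ h
      simp only [Prod.mk_eq_zero] at h ⊢
      exact ⟨h.2.1, by linarith [h.1, h.2.1, h.2.2], h.1⟩)
  have hκ0 := hκ.1
  have hm : Measurable fun v : ℝ × ℝ × ℝ => domF H d v.1 v.2.1 v.2.2 :=
    (measurable_corrSq h0).mul ((measurable_detD h0).pow_const _)
  refine Integrable.mono' (((i1.const_mul (256 * (κ / 16) ^ (-(d : ℝ) / 2))).add
    ((i2.const_mul ((κ / 16) ^ (-(d : ℝ) / 2))).add
      (i3.const_mul (64 * (κ / 32) ^ (-(d : ℝ) / 2)))))).integrableOn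
    hm.aestronglyMeasurable ((ae_restrict_iff' measurableSet_octant).2 (ae_of_all _ ?_))
  rintro ⟨x, u₁, u₂⟩ ⟨hx, hu₁, hu₂⟩
  simp only at hx hu₁ hu₂
  rw [Real.norm_of_nonneg (domF_nonneg h0 h1 d x hu₁ hu₂)]
  simp only [Pi.add_apply]
  set g₁ := 256 * (κ / 16) ^ (-(d : ℝ) / 2) * ((1 + |u₁|) ^ (-(H * d - γ)) *
    ((1 + |x - u₁|) ^ (-(2 * γ)) * (1 + |u₂|) ^ (-(H * d - γ)))) with hg₁
  set g₂ := (κ / 16) ^ (-(d : ℝ) / 2) * ((1 + |x|) ^ (-(2 * (H * d) / 3)) *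
    ((1 + |u₁ - x|) ^ (-(2 * (H * d) / 3)) * (1 + |x + u₂ - u₁|) ^ (-(2 * (H * d) / 3)))) with hg₂
  set g₃ := 64 * (κ / 32) ^ (-(d : ℝ) / 2) * ((1 + |u₂|) ^ (-(H * d - γ)) *
    ((1 + |x|) ^ (-((H * d + γ) / 2)) * (1 + |u₁ - x - u₂|) ^ (-((H * d + γ) / 2)))) with hg₃
  have p1 : 0 ≤ g₁ := by positivity
  have p2 : 0 ≤ g₂ := by positivity
  have p3 : 0 ≤ g₃ := by positivity
  rcases le_total u₁ x with h | h
  · have h2 := domF_le_of_disjoint hκ h0 h1 d (by linarith : 0 ≤ γ) hγ2 hu₁ (sub_nonneg.2 h) hu₂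
    rw [add_sub_cancel] at h2
    rw [abs_of_nonneg hu₁, abs_of_nonneg (sub_nonneg.2 h), abs_of_nonneg hu₂] at hg₁
    linarith
  · rcases le_total u₁ (x + u₂) with h' | h'
    · have h2 := domF_le_of_overlap hκ h0 h1 d hx (sub_nonneg.2 h) (sub_nonneg.2 h')
      rw [add_sub_cancel, show u₁ - x + (x + u₂ - u₁) = u₂ by ring] at h2
      rw [abs_of_nonneg hx, abs_of_nonneg (sub_nonneg.2 h), abs_of_nonneg (sub_nonneg.2 h')] at hg₂
      linarith
    · have h3 : 0 ≤ u₁ - x - u₂ := by linarith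
      have h2 := domF_le_of_nested hκ h0 h1 d (by linarith : 0 ≤ γ) hγ2 (by linarith) hx hu₂ h3
      rw [show x + u₂ + (u₁ - x - u₂) = u₁ by ring] at h2
      rw [abs_of_nonneg hu₂, abs_of_nonneg hx, abs_of_nonneg h3] at hg₃
      linarith

end Integrability


/-! ### The covariance of heat kernels along the process -/

section HeatKernel

theorem integral_exp_quadratic_gaussianReal {a : ℝ} (b : ℝ) (ha : 0 < 1 + a) :
    ∫ x, Real.exp (-(a * x ^ 2 + 2 * b * x) / 2) ∂(gaussianReal 0 1) =
      (√(1 + a))⁻¹ * Real.exp (b ^ 2 / (2 * (1 + a))) := by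
  have e : ∀ x : ℝ, Real.exp (-(a * x ^ 2 + 2 * b * x) / 2) * Real.exp (-x ^ 2 / 2) =
      Real.exp (b ^ 2 / (2 * (1 + a))) *
        Real.exp (-((1 + a) / 2) * (x + b / (1 + a)) ^ 2) := by
    intro x
    rw [← Real.exp_add, ← Real.exp_add]
    congr 1
    field_simp
    ring
  rw [integral_gaussianReal_std]
  simp only [e]
  rw [integral_const_mul, integral_add_right_eq_self
    (fun x : ℝ => Real.exp (-((1 + a) / 2) * x ^ 2)), integral_gaussian,
    show Real.pi / ((1 + a) / 2) = 2 * Real.pi / (1 + a) by field_simp,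
    Real.sqrt_div (by positivity)]
  have : √(2 * Real.pi) ≠ 0 := by positivity
  field_simp

/-- A two-dimensional Gaussian integral: the quadratic form has the Gram matrix of `f` and `g`, and the
value is `det(1 + Gram)^{-1/2}`. -/
theorem integral_exp_norm_sq_gaussian {E : Type*} [NormedAddCommGroup E] [InnerProductSpace ℝ E]
    (f g : E) :
    ∫ z : ℝ × ℝ, Real.exp (-(‖z.1 • f + z.2 • g‖ ^ 2 / 2))
      ∂((gaussianReal 0 1).prod (gaussianReal 0 1)) =
      ((1 + ‖f‖ ^ 2) * (1 + ‖g‖ ^ 2) - inner ℝ f g ^ 2) ^ (-(1 : ℝ) / 2) := by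
  have hint : Integrable (fun z : ℝ × ℝ => Real.exp (-(‖z.1 • f + z.2 • g‖ ^ 2 / 2)))
      ((gaussianReal 0 1).prod (gaussianReal 0 1)) := by
    refine Integrable.of_bound (C := 1) ?_ (ae_of_all _ fun z => ?_)
    · exact Continuous.aestronglyMeasurable (by fun_prop)
    · rw [Real.norm_of_nonneg (Real.exp_pos _).le, Real.exp_le_one_iff]
      have : 0 ≤ ‖z.1 • f + z.2 • g‖ ^ 2 := by positivity
      linarith
  set l := ‖f‖ ^ 2
  set r := ‖g‖ ^ 2
  set m : ℝ := inner ℝ f g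
  have hl : 0 ≤ l := by positivity
  have hr : 0 ≤ r := by positivity
  have hm : m ^ 2 ≤ l * r := by
    have h := abs_real_inner_le_norm f g
    calc m ^ 2 = |m| ^ 2 := (sq_abs m).symm
      _ ≤ (‖f‖ * ‖g‖) ^ 2 := by gcongr
      _ = l * r := mul_pow _ _ _
  have hr1 : 0 < 1 + r := by linarith
  have hD : 0 < 1 + (l - m ^ 2 / (1 + r)) := by
    have : m ^ 2 / (1 + r) ≤ l := by
      rw [div_le_iff₀ hr1]
      linarith
    linarith
  have e : ∀ x y : ℝ, Real.exp (-(‖x • f + y • g‖ ^ 2 / 2)) =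
      Real.exp (-(l * x ^ 2) / 2) * Real.exp (-(r * y ^ 2 + 2 * (m * x) * y) / 2) := by
    intro x y
    rw [← Real.exp_add, norm_add_sq_real, norm_smul, norm_smul, mul_pow, mul_pow,
      real_inner_smul_left, real_inner_smul_right, Real.norm_eq_abs, Real.norm_eq_abs, sq_abs,
      sq_abs]
    congr 1
    ring
  have e2 : ∀ x : ℝ, Real.exp (-(l * x ^ 2) / 2) *
      ((√(1 + r))⁻¹ * Real.exp ((m * x) ^ 2 / (2 * (1 + r)))) = (√(1 + r))⁻¹ *
        Real.exp (-((l - m ^ 2 / (1 + r)) * x ^ 2 + 2 * 0 * x) / 2) := by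
    intro x
    rw [mul_left_comm, ← Real.exp_add]
    congr 2
    field_simp
    ring
  rw [integral_prod _ hint]
  simp only [e, integral_const_mul, integral_exp_quadratic_gaussianReal _ hr1, e2,
    integral_exp_quadratic_gaussianReal _ hD]
  rw [show (0 : ℝ) ^ 2 / (2 * (1 + (l - m ^ 2 / (1 + r)))) = 0 by simp, Real.exp_zero, mul_one,
    ← mul_inv, ← Real.sqrt_mul hr1.le, neg_div, Real.rpow_neg, Real.sqrt_eq_rpow]
  · congr 2
    field_simp
    ring
  · have : 0 ≤ l * r - m ^ 2 := by linarith
    nlinarith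

variable {Ω : Type*} [MeasurableSpace Ω] {d : ℕ} [NeZero d] {H : ℝ}
  {B : ℝ≥0 → Ω → EuclideanSpace ℝ (Fin d)} {P : Measure Ω}

theorem integral_exp_linear_gaussian (a b : ℝ) :
    ∫ z : ℝ × ℝ, Complex.exp (((a * z.1 + b * z.2 : ℝ) : ℂ) * Complex.I)
      ∂((gaussianReal 0 1).prod (gaussianReal 0 1)) =
      ((Real.exp (-(a ^ 2 / 2)) * Real.exp (-(b ^ 2 / 2)) : ℝ) : ℂ) := by
  have e : ∀ z : ℝ × ℝ, Complex.exp (((a * z.1 + b * z.2 : ℝ) : ℂ) * Complex.I) =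
      Complex.exp ((a * z.1 : ℝ) * Complex.I) * Complex.exp ((b * z.2 : ℝ) * Complex.I) := by
    intro z
    rw [← Complex.exp_add]
    push_cast
    ring_nf
  simp only [e]
  rw [integral_prod_mul (fun x : ℝ => Complex.exp ((a * x : ℝ) * Complex.I))
    (fun y : ℝ => Complex.exp ((b * y : ℝ) * Complex.I)), charFun_gaussianReal_std,
    charFun_gaussianReal_std]
  push_cast
  rfl

/-- The joint characteristic function of all coordinates of `B(f)` and `B(g)`, which are independent
for different coordinates. -/
theorem IsFBM.charFun_wiener_pair [IsProbabilityMeasure P] (hB : IsFBM H B P) (f g : HSpace B P)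
    (z : Fin d → ℝ × ℝ) :
    ∫ ω, Complex.exp (((∑ j, (wiener B P j f ω * (z j).1 + wiener B P j g ω * (z j).2) : ℝ) : ℂ) *
      Complex.I) ∂P = ((∏ j, Real.exp (-(‖(z j).1 • f + (z j).2 • g‖ ^ 2 / 2)) : ℝ) : ℂ) := by
  set h : HSpaceD B P := WithLp.toLp 2 fun j => (z j).1 • f + (z j).2 • g
  have hae : ∀ᵐ ω ∂P, (isonormal B P h ω : ℝ) =
      ∑ j, (wiener B P j f ω * (z j).1 + wiener B P j g ω * (z j).2) := by
    have e : isonormal B P h =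
        ∑ j, ((z j).1 • wiener B P j f + (z j).2 • wiener B P j g) :=
      Finset.sum_congr rfl fun j _ => by simp [h]
    rw [e]
    have h1 := Lp.coeFn_finsetSum (μ := P) (p := 2) Finset.univ
      (fun j => (z j).1 • wiener B P j f + (z j).2 • wiener B P j g)
    have h2 : ∀ᵐ ω ∂P, ∀ j, ((z j).1 • wiener B P j f + (z j).2 • wiener B P j g : Lp ℝ 2 P) ω =
        wiener B P j f ω * (z j).1 + wiener B P j g ω * (z j).2 := by
      rw [ae_all_iff]
      intro j
      filter_upwards [Lp.coeFn_add ((z j).1 • wiener B P j f) ((z j).2 • wiener B P j g),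
        Lp.coeFn_smul (z j).1 (wiener B P j f), Lp.coeFn_smul (z j).2 (wiener B P j g)]
        with ω h3 h4 h5
      rw [h3, Pi.add_apply, h4, h5]
      simp [mul_comm]
    filter_upwards [h1, h2] with ω h3 h4
    rw [h3, Finset.sum_apply]
    exact Finset.sum_congr rfl fun j _ => h4 j
  have hn : ‖h‖ ^ 2 = ∑ j, ‖(z j).1 • f + (z j).2 • g‖ ^ 2 := PiLp.norm_sq_eq_of_L2 _ _
  have hc := hB.charFun_isonormal h
  rw [hn] at hc
  rw [← Real.exp_sum, Complex.ofReal_exp, Finset.sum_neg_distrib, ← Finset.sum_div, Complex.ofReal_neg,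
    ← hc]
  refine integral_congr_ae ?_
  filter_upwards [hae] with ω hω
  rw [hω, mul_comm]

/-- The Gaussian factors are characteristic functions of independent standard Gaussian variables;
after exchanging the order of integration the process is integrated first. -/
theorem IsFBM.integral_prod_exp_wiener [IsProbabilityMeasure P] (hB : IsFBM H B P)
    (f g : HSpace B P) :
    ∫ ω, ∏ j, (Real.exp (-(wiener B P j f ω ^ 2 / 2)) * Real.exp (-(wiener B P j g ω ^ 2 / 2))) ∂P =
      ((1 + ‖f‖ ^ 2) * (1 + ‖g‖ ^ 2) - inner ℝ f g ^ 2) ^ (-(d : ℝ) / 2) := by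
  set ν := (gaussianReal 0 1).prod (gaussianReal 0 1)
  have hX : ∀ j, Measurable (wiener B P j f : Ω → ℝ) := fun j =>
    (Lp.stronglyMeasurable _).measurable
  have hY : ∀ j, Measurable (wiener B P j g : Ω → ℝ) := fun j =>
    (Lp.stronglyMeasurable _).measurable
  have h1 : ∀ ω, ((∏ j, (Real.exp (-(wiener B P j f ω ^ 2 / 2)) *
      Real.exp (-(wiener B P j g ω ^ 2 / 2))) : ℝ) : ℂ) =
      ∫ z : Fin d → ℝ × ℝ, Complex.exp (((∑ j, (wiener B P j f ω * (z j).1 +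
        wiener B P j g ω * (z j).2) : ℝ) : ℂ) * Complex.I) ∂(Measure.pi fun _ => ν) := by
    intro ω
    rw [Complex.ofReal_prod]
    simp only [← integral_exp_linear_gaussian]
    rw [← integral_fintype_prod_eq_prod (μ := fun _ : Fin d => ν) (fun j (z : ℝ × ℝ) =>
      Complex.exp (((wiener B P j f ω * z.1 + wiener B P j g ω * z.2 : ℝ) : ℂ) * Complex.I))]
    refine integral_congr_ae (ae_of_all _ fun z => ?_)
    simp only
    rw [← Complex.exp_sum, ← Finset.sum_mul, Complex.ofReal_sum]
  have hint : Integrable (Function.uncurry fun (ω : Ω) (z : Fin d → ℝ × ℝ) =>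
      Complex.exp (((∑ j, (wiener B P j f ω * (z j).1 + wiener B P j g ω * (z j).2) : ℝ) : ℂ) *
        Complex.I)) (P.prod (Measure.pi fun _ => ν)) := by
    refine Integrable.of_bound (C := 1) ?_ (ae_of_all _ fun p => ?_)
    · refine Measurable.aestronglyMeasurable ?_
      unfold Function.uncurry
      refine Complex.measurable_exp.comp (Measurable.mul_const ?_ _)
      refine Complex.measurable_ofReal.comp (Finset.measurable_fun_sum _ fun j _ => ?_)
      have := hX j
      have := hY j
      fun_prop
    · rw [Function.uncurry, Complex.norm_exp_ofReal_mul_I]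
  have h2 : ((∫ ω, ∏ j, (Real.exp (-(wiener B P j f ω ^ 2 / 2)) *
      Real.exp (-(wiener B P j g ω ^ 2 / 2))) ∂P : ℝ) : ℂ) =
      ((((1 + ‖f‖ ^ 2) * (1 + ‖g‖ ^ 2) - inner ℝ f g ^ 2) ^ (-(1 : ℝ) / 2)) ^ d : ℝ) := by
    rw [← integral_complex_ofReal]
    simp only [h1]
    rw [integral_integral_swap hint]
    simp only [hB.charFun_wiener_pair]
    rw [integral_complex_ofReal, integral_fintype_prod_eq_pow (μ := ν)
      (fun z : ℝ × ℝ => Real.exp (-(‖z.1 • f + z.2 • g‖ ^ 2 / 2))),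
      integral_exp_norm_sq_gaussian, Fintype.card_fin]
  rw [Complex.ofReal_inj.1 h2, ← Real.rpow_natCast, ← Real.rpow_mul]
  · congr 1
    ring
  · have h := abs_real_inner_le_norm f g
    have : inner ℝ f g ^ 2 ≤ ‖f‖ ^ 2 * ‖g‖ ^ 2 := by
      rw [← mul_pow, ← sq_abs]
      gcongr
    nlinarith [sq_nonneg ‖f‖, sq_nonneg ‖g‖]

omit [NeZero d] in
theorem heatKernel_one (y : EuclideanSpace ℝ (Fin d)) :
    heatKernel 1 y = (2 * Real.pi) ^ (-(d : ℝ) / 2) * ∏ j, Real.exp (-(y j ^ 2 / 2)) := by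
  rw [heatKernel, ← Real.exp_sum, mul_one, mul_one, EuclideanSpace.real_norm_sq_eq,
    Finset.sum_neg_distrib]
  congr 2
  rw [neg_div, Finset.sum_div]

theorem IsFBM.wiener_indZero_ae (hB : IsFBM H B P) (t : ℝ≥0) :
    ∀ᵐ ω ∂P, ∀ j, wiener B P j (indZero B P t) ω = B t ω j := by
  rw [ae_all_iff]
  intro j
  rw [hB.wiener_indZero]
  exact toL2_coeFn (hB.memLp t j)

theorem IsFBM.wiener_ind_ae (hB : IsFBM H B P) (s t : ℝ≥0) :
    ∀ᵐ ω ∂P, ∀ j, wiener B P j (ind B P s t) ω = B t ω j - B s ω j := by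
  have h : ∀ᵐ ω ∂P, ∀ j, wiener B P j (ind B P s t) ω =
      wiener B P j (indZero B P t) ω - wiener B P j (indZero B P s) ω := by
    rw [ae_all_iff]
    intro j
    rw [ind_eq_sub, map_sub]
    exact Lp.coeFn_sub _ _
  filter_upwards [h, hB.wiener_indZero_ae t, hB.wiener_indZero_ae s] with ω h1 h2 h3 j
  rw [h1, h2, h3]

theorem IsFBM.inner_indZero_ind (hB : IsFBM H B P) {x u₁ u₂ : ℝ} (hx : 0 ≤ x) (hu₁ : 0 ≤ u₁)
    (hu₂ : 0 ≤ u₂) :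
    inner ℝ (indZero B P u₁.toNNReal) (ind B P x.toNNReal (x + u₂).toNNReal) =
      covMu H x u₁ u₂ := by
  rw [ind_eq_sub, inner_sub_right, hB.inner_indZero, hB.inner_indZero, fbmCov, fbmCov, covMu,
    Real.coe_toNNReal _ hx, Real.coe_toNNReal _ hu₁, Real.coe_toNNReal _ (add_nonneg hx hu₂),
    abs_of_nonneg hx, abs_of_nonneg (add_nonneg hx hu₂), abs_sub_comm u₁ (x + u₂)]
  ring

theorem IsFBM.mu_eq_covMu (hB : IsFBM H B P) {x u₁ u₂ : ℝ} (hx : 0 ≤ x) (hu₁ : 0 ≤ u₁)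
    (hu₂ : 0 ≤ u₂) : mu B P x u₁ u₂ = covMu H x u₁ u₂ := by
  rw [← hB.inner_indZero_ind hx hu₁ hu₂]
  have h := hB.inner_wiener 0 0 (indZero B P u₁.toNNReal) (ind B P x.toNNReal (x + u₂).toNNReal)
  rw [if_pos rfl, L2.inner_def] at h
  rw [← h, mu]
  refine integral_congr_ae ?_
  filter_upwards [hB.wiener_indZero_ae u₁.toNNReal,
    hB.wiener_ind_ae x.toNNReal (x + u₂).toNNReal] with ω h1 h2
  rw [h1, h2]
  simp [mul_comm]

theorem IsFBM.norm_indZero_sq (hB : IsFBM H B P) (hH : 0 < H) {u : ℝ} (hu : 0 ≤ u) :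
    ‖indZero B P u.toNNReal‖ ^ 2 = u ^ (2 * H) := by
  rw [← real_inner_self_eq_norm_sq, hB.inner_indZero, fbmCov, Real.coe_toNNReal _ hu, sub_self,
    abs_zero, Real.zero_rpow (by positivity)]
  ring

omit [NeZero d] in
theorem IsFBM.aemeasurable_coord (hB : IsFBM H B P) (t : ℝ≥0) :
    AEMeasurable (B t) P := (hB.gaussian.hasGaussianLaw_eval t).aemeasurable

omit [NeZero d] in
theorem memLp_heatKernel_comp [IsProbabilityMeasure P] {X : Ω → EuclideanSpace ℝ (Fin d)}
    (hX : AEMeasurable X P) : MemLp (fun ω => heatKernel 1 (X ω)) 2 P := by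
  have hc : Continuous (heatKernel (d := d) 1) := by
    unfold heatKernel
    fun_prop
  refine MemLp.of_bound (hc.measurable.comp_aemeasurable hX).aestronglyMeasurable
    ((2 * Real.pi) ^ (-(d : ℝ) / 2)) (ae_of_all _ fun ω => ?_)
  rw [heatKernel, mul_one, Real.norm_of_nonneg (by positivity)]
  refine mul_le_of_le_one_right (by positivity) (Real.exp_le_one_iff.2 ?_)
  rw [neg_div]
  exact neg_nonpos.2 (by positivity)

/-- The covariance of the heat kernels in terms of the covariances of the increments. -/
theorem IsFBM.F_one_eq [IsProbabilityMeasure P] (hB : IsFBM H B P) (hH : 0 < H) {x u₁ u₂ : ℝ}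
    (hx : 0 ≤ x) (hu₁ : 0 ≤ u₁) (hu₂ : 0 ≤ u₂) :
    F B P 1 x u₁ u₂ = ((2 * Real.pi) ^ d)⁻¹ * (detD H x u₁ u₂ ^ (-(d : ℝ) / 2) -
      ((1 + u₁ ^ (2 * H)) * (1 + u₂ ^ (2 * H))) ^ (-(d : ℝ) / 2)) := by
  set f := indZero B P u₁.toNNReal
  set g := ind B P x.toNNReal (x + u₂).toNNReal
  have hf : ‖f‖ ^ 2 = u₁ ^ (2 * H) := hB.norm_indZero_sq hH hu₁
  have hg : ‖g‖ ^ 2 = u₂ ^ (2 * H) := by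
    rw [hB.norm_ind_sq hH, Real.coe_toNNReal _ hx, Real.coe_toNNReal _ (add_nonneg hx hu₂),
      add_sub_cancel_left, abs_of_nonneg hu₂]
  have hfg : inner ℝ f g = covMu H x u₁ u₂ := hB.inner_indZero_ind hx hu₁ hu₂
  have hfae := hB.wiener_indZero_ae u₁.toNNReal
  have hgae := hB.wiener_ind_ae x.toNNReal (x + u₂).toNNReal
  set p := (2 * Real.pi) ^ (-(d : ℝ) / 2) with hp
  have hpp : p * p = ((2 * Real.pi) ^ d)⁻¹ := by
    rw [hp, ← Real.rpow_add (by positivity), ← Real.rpow_natCast, ← Real.rpow_neg (by positivity)]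
    ring_nf
  have e12 : ∫ ω, ((fun ω => heatKernel 1 (B u₁.toNNReal ω)) * fun ω =>
      heatKernel 1 (B (x + u₂).toNNReal ω - B x.toNNReal ω)) ω ∂P =
      p * p * detD H x u₁ u₂ ^ (-(d : ℝ) / 2) := by
    have h := hB.integral_prod_exp_wiener f g
    rw [hf, hg, hfg, ← detD] at h
    rw [← h, ← integral_const_mul]
    refine integral_congr_ae ?_
    filter_upwards [hfae, hgae] with ω h1 h2
    simp only [Pi.mul_apply, heatKernel_one, h1, h2, Finset.prod_mul_distrib, PiLp.sub_apply, f, g]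
    ring
  have e1 : ∫ ω, heatKernel 1 (B u₁.toNNReal ω) ∂P =
      p * (1 + u₁ ^ (2 * H)) ^ (-(d : ℝ) / 2) := by
    have h := hB.integral_prod_exp_wiener f 0
    rw [hf, inner_zero_right, norm_zero] at h
    rw [show (1 + u₁ ^ (2 * H)) * (1 + (0 : ℝ) ^ 2) - 0 ^ 2 = 1 + u₁ ^ (2 * H) by ring] at h
    rw [← h, ← integral_const_mul]
    refine integral_congr_ae ?_
    filter_upwards [hfae] with ω h1
    simp [heatKernel_one, h1, f, p]
  have e2 : ∫ ω, heatKernel 1 (B (x + u₂).toNNReal ω - B x.toNNReal ω) ∂P =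
      p * (1 + u₂ ^ (2 * H)) ^ (-(d : ℝ) / 2) := by
    have h := hB.integral_prod_exp_wiener 0 g
    rw [hg, inner_zero_left, norm_zero] at h
    rw [show (1 + (0 : ℝ) ^ 2) * (1 + u₂ ^ (2 * H)) - 0 ^ 2 = 1 + u₂ ^ (2 * H) by ring] at h
    rw [← h, ← integral_const_mul]
    refine integral_congr_ae ?_
    filter_upwards [hgae] with ω h1
    simp [heatKernel_one, h1, g, p]
  have ha := hB.aemeasurable_coord u₁.toNNReal
  have hb : AEMeasurable (fun ω => B (x + u₂).toNNReal ω - B x.toNNReal ω) P :=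
    (hB.aemeasurable_coord (x + u₂).toNNReal).sub (hB.aemeasurable_coord x.toNNReal)
  rw [F, covariance_eq_sub (memLp_heatKernel_comp ha) (memLp_heatKernel_comp hb), e12, e1, e2,
    ← hpp, Real.mul_rpow (by positivity) (by positivity)]
  ring

end HeatKernel


/-! ### The expansion of the limiting variance -/

section Series

variable {H : ℝ}

/-- The function `G^{(q)}_{ε,x}(u₁, u₂)`, with the explicit formula for the covariance; it extends
the latter to all real `x`. -/
def chaosG (H : ℝ) (d q : ℕ) (ε x u₁ u₂ : ℝ) : ℝ :=
  (ε + u₁ ^ (2 * H)) ^ (-(d : ℝ) / 2 - q) * (ε + u₂ ^ (2 * H)) ^ (-(d : ℝ) / 2 - q) *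
    covMu H x u₁ u₂ ^ (2 * q)

theorem chaosG_nonneg (d q : ℕ) (x : ℝ) {u₁ u₂ : ℝ} (hu₁ : 0 ≤ u₁) (hu₂ : 0 ≤ u₂) :
    0 ≤ chaosG H d q 1 x u₁ u₂ := by
  rw [chaosG, pow_mul]
  positivity

theorem measurable_chaosG (h0 : 0 < H) (d q : ℕ) :
    Measurable fun v : ℝ × ℝ × ℝ => chaosG H d q 1 v.1 v.2.1 v.2.2 := by
  have := measurable_covMu h0
  unfold chaosG
  fun_prop

/-- The value of `F_{1,x}(u₁, u₂)` in terms of the covariances. -/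
def covF (H : ℝ) (d : ℕ) (x u₁ u₂ : ℝ) : ℝ :=
  ((2 * Real.pi) ^ d)⁻¹ * (detD H x u₁ u₂ ^ (-(d : ℝ) / 2) -
    ((1 + u₁ ^ (2 * H)) * (1 + u₂ ^ (2 * H))) ^ (-(d : ℝ) / 2))

theorem detD_eq (x : ℝ) {u₁ u₂ : ℝ} (hu₁ : 0 ≤ u₁) (hu₂ : 0 ≤ u₂) :
    detD H x u₁ u₂ = (1 - corrSq H x u₁ u₂) * ((1 + u₁ ^ (2 * H)) * (1 + u₂ ^ (2 * H))) := by
  rw [detD, corrSq, sub_mul, one_mul, div_mul_cancel₀ _ (by positivity)]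

/-- The expansion of `(1 - z)^{-d/2}` in powers of the squared correlation `z`; subtracting the product
of the expectations removes the term `q = 0`. -/
theorem hasSum_chaosG (h0 : 0 < H) (h1 : H < 1) (d : ℕ) (x : ℝ) {u₁ u₂ : ℝ} (hu₁ : 0 ≤ u₁)
    (hu₂ : 0 ≤ u₂) :
    HasSum (fun q : ℕ => betaConst d (q + 1) * chaosG H d (q + 1) 1 x u₁ u₂)
      (covF H d x u₁ u₂) := by
  have hz := corrSq_lt_one h0 h1 x hu₁ hu₂
  set L := (1 + u₁ ^ (2 * H)) * (1 + u₂ ^ (2 * H)) with hL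
  have hL0 : 0 < L := by positivity
  set c := ((2 * Real.pi) ^ d)⁻¹ * L ^ (-(d : ℝ) / 2) with hc
  have hterm : ∀ q : ℕ, c * (alphaConst d q * (corrSq H x u₁ u₂ / 4) ^ q) =
      betaConst d q * chaosG H d q 1 x u₁ u₂ := by
    intro q
    have e : chaosG H d q 1 x u₁ u₂ = L ^ (-(d : ℝ) / 2) * (L ^ q)⁻¹ * (covMu H x u₁ u₂ ^ 2) ^ q := by
      rw [chaosG, ← Real.mul_rpow (by positivity) (by positivity), ← hL, sub_eq_add_neg,
        Real.rpow_add hL0, Real.rpow_neg hL0.le, Real.rpow_natCast, pow_mul]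
    rw [e, betaConst, corrSq, ← hL, div_pow, div_pow, pow_mul, hc]
    norm_num
    field_simp
  have h := (hasSum_alphaConst d (corrSq_nonneg x hu₁ hu₂) hz).mul_left c
  have h2 := (hasSum_nat_add_iff' 1).2 h
  simp only [hterm] at h2
  have hv : covF H d x u₁ u₂ = c * (1 - corrSq H x u₁ u₂) ^ (-(d : ℝ) / 2) -
      ∑ q ∈ Finset.range 1, betaConst d q * chaosG H d q 1 x u₁ u₂ := by
    rw [Finset.sum_range_one, ← hterm, pow_zero, alphaConst_zero, mul_one, mul_one, covF,
      detD_eq x hu₁ hu₂, ← hL, Real.mul_rpow (by linarith) hL0.le, hc]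
    ring
  rw [hv]
  exact h2

/-- Bernoulli's inequality in the form `(1 - z)^{-d/2} - 1 ≤ (d/2) z (1 - z)^{-d/2}`, valid as
`d ≥ 2`. -/
theorem covF_le (h0 : 0 < H) (h1 : H < 1) {d : ℕ} (hd : 2 ≤ d) (x : ℝ) {u₁ u₂ : ℝ}
    (hu₁ : 0 ≤ u₁) (hu₂ : 0 ≤ u₂) :
    covF H d x u₁ u₂ ≤ ((2 * Real.pi) ^ d)⁻¹ * (d / 2) * domF H d x u₁ u₂ := by
  have hz := corrSq_lt_one h0 h1 x hu₁ hu₂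
  have hd' : (1 : ℝ) ≤ d / 2 := by
    rw [le_div_iff₀ two_pos]
    exact_mod_cast hd
  rw [covF, domF, detD_eq x hu₁ hu₂]
  set L := (1 + u₁ ^ (2 * H)) * (1 + u₂ ^ (2 * H))
  have hL0 : 0 < L := by positivity
  set z := corrSq H x u₁ u₂
  have hz1 : 0 < 1 - z := by linarith
  rw [Real.mul_rpow hz1.le hL0.le, mul_assoc]
  refine mul_le_mul_of_nonneg_left ?_ (by positivity)
  -- Bernoulli's inequality for `(1 - z)^{d/2}`
  have hb := one_add_mul_self_le_rpow_one_add (s := -z) (by linarith) hd'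
  rw [← sub_eq_add_neg] at hb
  have hinv : (1 - z) ^ (-(d : ℝ) / 2) * (1 - z) ^ ((d : ℝ) / 2) = 1 := by
    rw [← Real.rpow_add hz1, neg_div, neg_add_cancel, Real.rpow_zero]
  have hp : 0 < (1 - z) ^ (-(d : ℝ) / 2) := by positivity
  have hLp : 0 < L ^ (-(d : ℝ) / 2) := by positivity
  have h2 : (1 - z) ^ (-(d : ℝ) / 2) - 1 ≤ d / 2 * z * (1 - z) ^ (-(d : ℝ) / 2) := by
    have := mul_le_mul_of_nonneg_left hb hp.le
    rw [hinv] at this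
    linarith
  have := mul_le_mul_of_nonneg_right h2 hLp.le
  linarith

theorem integrableOn_covF {d : ℕ} (hd2 : 2 ≤ d) (h0 : 0 < H) (hH : H < 3 / 4)
    (hd : 3 / 2 < H * d) :
    IntegrableOn (fun v : ℝ × ℝ × ℝ => covF H d v.1 v.2.1 v.2.2) octant := by
  have h1 : H < 1 := by linarith
  have hm : Measurable fun v : ℝ × ℝ × ℝ => covF H d v.1 v.2.1 v.2.2 := by
    have := measurable_detD h0
    unfold covF
    fun_prop
  refine Integrable.mono' ((integrableOn_domF h0 hH hd).const_mul
    (((2 * Real.pi) ^ d)⁻¹ * (d / 2))) hm.aestronglyMeasurable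
    ((ae_restrict_iff' measurableSet_octant).2 (ae_of_all _ ?_))
  rintro ⟨x, u₁, u₂⟩ ⟨-, hu₁, hu₂⟩
  simp only at hu₁ hu₂
  rw [Real.norm_of_nonneg]
  · exact covF_le h0 h1 hd2 x hu₁ hu₂
  · refine (hasSum_chaosG h0 h1 d x hu₁ hu₂).nonneg fun q => mul_nonneg ?_
      (chaosG_nonneg d _ x hu₁ hu₂)
    rw [betaConst, alphaConst]
    positivity

/-- Each term of the series is bounded by the sum. -/
theorem integrableOn_chaosG {d : ℕ} [NeZero d] (hd2 : 2 ≤ d) (h0 : 0 < H) (hH : H < 3 / 4)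
    (hd : 3 / 2 < H * d) {q : ℕ} (hq : 1 ≤ q) :
    IntegrableOn (fun v : ℝ × ℝ × ℝ => chaosG H d q 1 v.1 v.2.1 v.2.2) octant := by
  have h1 : H < 1 := by linarith
  obtain ⟨q, rfl⟩ := Nat.exists_eq_add_of_le' hq
  have hβ : ∀ k, 0 < betaConst d k := fun k => by
    have := alphaConst_pos d k
    rw [betaConst]
    positivity
  refine Integrable.mono' ((integrableOn_covF hd2 h0 hH hd).const_mul (betaConst d (q + 1))⁻¹)
    (measurable_chaosG h0 d _).aestronglyMeasurable
    ((ae_restrict_iff' measurableSet_octant).2 (ae_of_all _ ?_))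
  rintro ⟨x, u₁, u₂⟩ ⟨-, hu₁, hu₂⟩
  simp only at hu₁ hu₂
  rw [Real.norm_of_nonneg (chaosG_nonneg d _ x hu₁ hu₂), ← div_eq_inv_mul, le_div_iff₀' (hβ _)]
  exact le_hasSum (hasSum_chaosG h0 h1 d x hu₁ hu₂) q fun k _ =>
    mul_nonneg (hβ _).le (chaosG_nonneg d _ x hu₁ hu₂)

theorem hasSum_integral_chaosG {d : ℕ} [NeZero d] (hd2 : 2 ≤ d) (h0 : 0 < H) (hH : H < 3 / 4)
    (hd : 3 / 2 < H * d) :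
    HasSum (fun q : ℕ => betaConst d (q + 1) *
        ∫ v in octant, chaosG H d (q + 1) 1 v.1 v.2.1 v.2.2)
      (∫ v in octant, covF H d v.1 v.2.1 v.2.2) := by
  have h1 : H < 1 := by linarith
  have hβ : ∀ k, 0 ≤ betaConst d k := fun k => by
    rw [betaConst, alphaConst]
    positivity
  have hae : ∀ᵐ v ∂(volume.restrict octant), HasSum
      (fun q : ℕ => betaConst d (q + 1) * chaosG H d (q + 1) 1 v.1 v.2.1 v.2.2)
      (covF H d v.1 v.2.1 v.2.2) :=
    (ae_restrict_iff' measurableSet_octant).2 (ae_of_all _ fun v hv =>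
      hasSum_chaosG h0 h1 d v.1 hv.2.1 hv.2.2)
  simp only [← integral_const_mul]
  refine hasSum_integral_of_dominated_convergence
    (fun q v => betaConst d (q + 1) * chaosG H d (q + 1) 1 v.1 v.2.1 v.2.2)
    (fun q => ((measurable_chaosG h0 d _).const_mul _).aestronglyMeasurable) (fun q => ?_)
    (hae.mono fun v hv => hv.summable) ?_ hae
  · refine (ae_restrict_iff' measurableSet_octant).2 (ae_of_all _ fun v hv => le_of_eq ?_)
    exact Real.norm_of_nonneg (mul_nonneg (hβ _) (chaosG_nonneg d _ v.1 hv.2.1 hv.2.2))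
  · exact (integrableOn_covF hd2 h0 hH hd).congr (hae.mono fun v hv => hv.tsum_eq.symm)

end Series


/-! ### The scaling limit of the second moments -/

section Limit

variable {H : ℝ}

/-- The pair of intervals `[s, s + u₁]` and `[s + x, s + x + u₂]` with the coordinates
`(s, x, u₁, u₂)`. -/
def intervalPair (v : ℝ × ℝ × ℝ × ℝ) : (ℝ × ℝ) × (ℝ × ℝ) :=
  ((v.1, v.1 + v.2.2.1), (v.1 + v.2.1, v.1 + v.2.1 + v.2.2.2))

theorem measurePreserving_intervalPair : MeasurePreserving intervalPair := by
  have hσ : MeasurePreserving (fun w : ℝ × ℝ × ℝ => (w.2.1, w.1, w.2.2)) :=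
    (volume_preserving_prodAssoc (α₁ := ℝ) (β₁ := ℝ) (γ₁ := ℝ)).comp
      ((Measure.measurePreserving_swap.prod (MeasurePreserving.id volume)).comp
        ((volume_preserving_prodAssoc (α₁ := ℝ) (β₁ := ℝ) (γ₁ := ℝ)).symm _))
  have hπ : MeasurePreserving
      (fun v : ℝ × ℝ × ℝ × ℝ => (((v.1, v.2.2.1), (v.2.1, v.2.2.2)) : (ℝ × ℝ) × (ℝ × ℝ))) :=
    ((volume_preserving_prodAssoc (α₁ := ℝ) (β₁ := ℝ) (γ₁ := ℝ × ℝ)).symm _).comp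
      ((MeasurePreserving.id volume).prod hσ)
  have hA : MeasurePreserving (fun p : (ℝ × ℝ) × (ℝ × ℝ) =>
      (((p.1.1, p.1.1 + p.1.2), (p.1.1 + p.2.1, p.1.1 + p.2.1 + p.2.2)) : (ℝ × ℝ) × (ℝ × ℝ))) :=
    (measurePreserving_prod_add (volume : Measure ℝ) (volume : Measure ℝ)).skew_product
      (g := fun a b : ℝ × ℝ => (a.1 + b.1, a.1 + b.1 + b.2))
      (by unfold Function.uncurry; fun_prop) (ae_of_all _ fun a =>
        ((measurePreserving_prod_add (volume : Measure ℝ) (volume : Measure ℝ)).comp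
          ((measurePreserving_add_left volume a.1).prod (MeasurePreserving.id volume))).map_eq)
  exact hA.comp hπ

theorem measurableEmbedding_intervalPair : MeasurableEmbedding intervalPair := by
  refine Continuous.measurableEmbedding (by unfold intervalPair; fun_prop) ?_
  rintro ⟨s, x, u₁, u₂⟩ ⟨s', x', u₁', u₂'⟩ h
  simp only [intervalPair, Prod.mk.injEq] at h ⊢
  obtain ⟨⟨h1, h2⟩, h3, h4⟩ := h
  exact ⟨h1, by linarith, by linarith, by linarith⟩

theorem chaosCov_intervalPair (d q : ℕ) (ε : ℝ) (v : ℝ × ℝ × ℝ × ℝ) :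
    chaosCov H d q ε (intervalPair v).1 (intervalPair v).2 =
      chaosG H d q ε v.2.1 v.2.2.1 v.2.2.2 := by
  rw [chaosCov, chaosG, intervalPair, incCov, covMu]
  simp only
  rw [show v.1 + v.2.2.1 - (v.1 + v.2.1) = v.2.2.1 - v.2.1 by ring,
    show v.1 - (v.1 + v.2.1 + v.2.2.2) = -(v.2.1 + v.2.2.2) by ring,
    show v.1 + v.2.2.1 - (v.1 + v.2.1 + v.2.2.2) = -(v.2.1 + v.2.2.2 - v.2.2.1) by ring,
    show v.1 - (v.1 + v.2.1) = -v.2.1 by ring, abs_neg, abs_neg, abs_neg, add_sub_cancel_left,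
    add_sub_cancel_left, add_comm (|v.2.2.1 - v.2.1| ^ (2 * H)), sub_right_comm]

theorem continuousOn_chaosCov (h0 : 0 < H) (d q : ℕ) {ε : ℝ} (hε : 0 < ε) (T T' : ℝ) :
    ContinuousOn (fun z : (ℝ × ℝ) × (ℝ × ℝ) => chaosCov H d q ε z.1 z.2)
      (simplex T ×ˢ simplex T') := by
  have h : Continuous fun y : ℝ => |y| ^ (2 * H) :=
    continuous_abs.rpow_const fun _ => Or.inr (by positivity)
  have hinc : Continuous fun z : (ℝ × ℝ) × (ℝ × ℝ) => incCov H z.1.1 z.1.2 z.2.1 z.2.2 := by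
    unfold incCov
    exact ((((h.comp (by fun_prop : Continuous fun z : (ℝ × ℝ) × (ℝ × ℝ) => z.1.2 - z.2.1)).add
      (h.comp (by fun_prop : Continuous fun z : (ℝ × ℝ) × (ℝ × ℝ) => z.1.1 - z.2.2))).sub
      (h.comp (by fun_prop : Continuous fun z : (ℝ × ℝ) × (ℝ × ℝ) => z.1.2 - z.2.2))).sub
      (h.comp (by fun_prop : Continuous fun z : (ℝ × ℝ) × (ℝ × ℝ) => z.1.1 - z.2.1))).div_const 2
  have hs : ∀ T, ContinuousOn
      (fun p : ℝ × ℝ => (ε + (p.2 - p.1) ^ (2 * H)) ^ (-(d : ℝ) / 2 - q)) (simplex T) := by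
    intro T
    refine ContinuousOn.rpow_const ?_ fun p hp => Or.inl ?_
    · exact continuousOn_const.add (ContinuousOn.rpow_const (by fun_prop) fun p hp =>
        Or.inr (by positivity))
    · have := Real.rpow_nonneg (sub_nonneg.2 hp.2.1) (2 * H)
      positivity
  unfold chaosCov
  exact (((hs T).comp continuousOn_fst fun z hz => hz.1).mul
    ((hs T').comp continuousOn_snd fun z hz => hz.2)).mul (hinc.pow _).continuousOn

/-- The set of the `(s, x, u₁, u₂)` for which `[s, s + r u₁]` is contained in `[0, T]` and
`[s + r x, s + r x + r u₂]` in `[0, T']`. -/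
def scaledDomain (T T' r : ℝ) : Set (ℝ × ℝ × ℝ × ℝ) :=
  {v | (0 ≤ v.1 ∧ 0 ≤ v.2.2.1 ∧ v.1 + r * v.2.2.1 ≤ T) ∧
    (0 ≤ v.1 + r * v.2.1 ∧ 0 ≤ v.2.2.2 ∧ v.1 + r * v.2.1 + r * v.2.2.2 ≤ T')}

theorem isClosed_scaledDomain (T T' r : ℝ) : IsClosed (scaledDomain T T' r) := by
  have h : ∀ f : ℝ × ℝ × ℝ × ℝ → ℝ, Continuous f → IsClosed {v | 0 ≤ f v} := fun f hf =>
    isClosed_le continuous_const hf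
  have h' : ∀ (f : ℝ × ℝ × ℝ × ℝ → ℝ) (c : ℝ), Continuous f → IsClosed {v | f v ≤ c} :=
    fun f c hf => isClosed_le hf continuous_const
  exact ((h (fun v => v.1) (by fun_prop)).inter ((h (fun v => v.2.2.1) (by fun_prop)).inter
    (h' (fun v => v.1 + r * v.2.2.1) T (by fun_prop)))).inter
    ((h (fun v => v.1 + r * v.2.1) (by fun_prop)).inter ((h (fun v => v.2.2.2) (by fun_prop)).inter
      (h' (fun v => v.1 + r * v.2.1 + r * v.2.2.2) T' (by fun_prop))))

theorem intervalPair_preimage (T T' : ℝ) :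
    intervalPair ⁻¹' (simplex T ×ˢ simplex T') = scaledDomain T T' 1 := by
  ext v
  simp [intervalPair, simplex, scaledDomain]

theorem scaledDomain_smul {T T' r : ℝ} (hr : 0 < r) (s : ℝ) (w : ℝ × ℝ × ℝ) :
    (s, r • w) ∈ scaledDomain T T' 1 ↔ (s, w) ∈ scaledDomain T T' r := by
  simp [scaledDomain, mul_nonneg_iff_of_pos_left hr]

theorem covMu_smul {r : ℝ} (hr : 0 < r) (x u₁ u₂ : ℝ) :
    covMu H (r * x) (r * u₁) (r * u₂) = r ^ (2 * H) * covMu H x u₁ u₂ := by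
  simp only [covMu, ← mul_add, ← mul_sub, abs_mul, abs_of_pos hr,
    Real.mul_rpow hr.le (abs_nonneg _)]
  ring

/-- The self-similarity of fractional Brownian motion. -/
theorem chaosG_smul {r : ℝ} (hr : 0 < r) (d q : ℕ) (x : ℝ) {u₁ u₂ : ℝ} (hu₁ : 0 ≤ u₁)
    (hu₂ : 0 ≤ u₂) :
    chaosG H d q (r ^ (2 * H)) (r * x) (r * u₁) (r * u₂) =
      r ^ (-(2 * H * d)) * chaosG H d q 1 x u₁ u₂ := by
  have hε : 0 < r ^ (2 * H) := by positivity
  have e : ∀ u : ℝ, 0 ≤ u → (r ^ (2 * H) + (r * u) ^ (2 * H)) ^ (-(d : ℝ) / 2 - q) =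
      (r ^ (2 * H)) ^ (-(d : ℝ) / 2 - q) * (1 + u ^ (2 * H)) ^ (-(d : ℝ) / 2 - q) := by
    intro u hu
    rw [Real.mul_rpow hr.le hu, ← Real.mul_rpow hε.le (by positivity)]
    congr 1
    ring
  have e2 : (r ^ (2 * H)) ^ (-(d : ℝ) / 2 - q) * (r ^ (2 * H)) ^ (-(d : ℝ) / 2 - q) *
      (r ^ (2 * H)) ^ (2 * q) = r ^ (-(2 * H * d)) := by
    rw [← Real.rpow_natCast (r ^ (2 * H)), ← Real.rpow_add hε, ← Real.rpow_add hε,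
      ← Real.rpow_mul hr.le]
    congr 1
    push_cast
    ring
  rw [chaosG, e u₁ hu₁, e u₂ hu₂, covMu_smul hr, mul_pow, ← e2, chaosG]
  ring

/-- The part of `ℝ³` where the increments have nonnegative lengths. -/
def halfOctants : Set (ℝ × ℝ × ℝ) := {w | 0 ≤ w.2.1 ∧ 0 ≤ w.2.2}

theorem measurableSet_halfOctants : MeasurableSet halfOctants :=
  (measurableSet_le measurable_const (by fun_prop : Measurable fun v : ℝ × ℝ × ℝ => v.2.1)).inter
    (measurableSet_le measurable_const (by fun_prop : Measurable fun v : ℝ × ℝ × ℝ => v.2.2))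

/-- The exchange of the two increments. -/
def exchange (w : ℝ × ℝ × ℝ) : ℝ × ℝ × ℝ := (-w.1, w.2.2, w.2.1)

theorem measurePreserving_exchange : MeasurePreserving exchange :=
  (Measure.measurePreserving_neg (volume : Measure ℝ)).prod Measure.measurePreserving_swap

theorem measurableEmbedding_exchange : MeasurableEmbedding exchange := by
  refine Continuous.measurableEmbedding (by unfold exchange; fun_prop) ?_
  rintro ⟨x, u₁, u₂⟩ ⟨x', u₁', u₂'⟩ h
  simp only [exchange, Prod.mk.injEq, neg_inj] at h ⊢
  exact ⟨h.1, h.2.2, h.2.1⟩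

theorem chaosG_exchange (d q : ℕ) (ε : ℝ) (w : ℝ × ℝ × ℝ) :
    chaosG H d q ε (exchange w).1 (exchange w).2.1 (exchange w).2.2 =
      chaosG H d q ε w.1 w.2.1 w.2.2 := by
  have e : covMu H (-w.1) w.2.2 w.2.1 = covMu H w.1 w.2.1 w.2.2 := by
    rw [covMu, covMu, abs_neg, show -w.1 + w.2.1 = w.2.1 - w.1 by ring,
      show w.2.2 - -w.1 = w.1 + w.2.2 by ring,
      show w.2.1 - w.1 - w.2.2 = -(w.1 + w.2.2 - w.2.1) by ring, abs_neg]
    ring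
  simp only [chaosG, exchange]
  rw [e]
  ring

theorem halfOctants_eq : halfOctants = octant ∪ exchange ⁻¹' octant := by
  ext ⟨x, u₁, u₂⟩
  simp only [halfOctants, octant, exchange, Set.mem_ofPred_eq, Set.mem_union, Set.mem_preimage]
  constructor
  · rintro ⟨h1, h2⟩
    rcases le_total 0 x with h | h
    · exact Or.inl ⟨h, h1, h2⟩
    · exact Or.inr ⟨neg_nonneg.2 h, h2, h1⟩
  · rintro (h | h)
    · exact h.2
    · exact ⟨h.2.2, h.2.1⟩

theorem integrableOn_halfOctants {d q : ℕ}
    (h : IntegrableOn (fun v : ℝ × ℝ × ℝ => chaosG H d q 1 v.1 v.2.1 v.2.2) octant) :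
    IntegrableOn (fun v : ℝ × ℝ × ℝ => chaosG H d q 1 v.1 v.2.1 v.2.2) halfOctants := by
  rw [halfOctants_eq]
  refine h.union ?_
  have := (measurePreserving_exchange.integrableOn_comp_preimage measurableEmbedding_exchange).2 h
  exact this.congr_fun (fun w _ => chaosG_exchange d q 1 w)
    (measurePreserving_exchange.measurable measurableSet_octant)

/-- The exchange of the increments maps the part `x < 0` onto the part `x > 0`. -/
theorem setIntegral_halfOctants {d q : ℕ}
    (h : IntegrableOn (fun v : ℝ × ℝ × ℝ => chaosG H d q 1 v.1 v.2.1 v.2.2) octant) :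
    ∫ v in halfOctants, chaosG H d q 1 v.1 v.2.1 v.2.2 =
      2 * ∫ v in octant, chaosG H d q 1 v.1 v.2.1 v.2.2 := by
  have hm := measurePreserving_exchange.measurable measurableSet_octant
  have hi := (integrableOn_halfOctants h).mono_set
    (halfOctants_eq ▸ Set.subset_union_right : exchange ⁻¹' octant ⊆ halfOctants)
  have hd : AEDisjoint volume octant (exchange ⁻¹' octant) := by
    have h0 : (volume : Measure (ℝ × ℝ × ℝ)) (Prod.fst ⁻¹' {(0 : ℝ)}) = 0 :=
      Measure.quasiMeasurePreserving_fst.preimage_null (measure_singleton 0)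
    refine measure_mono_null ?_ h0
    rintro w ⟨h1, h2⟩
    exact le_antisymm (neg_nonneg.1 h2.1) h1.1
  have hr : ∫ v in exchange ⁻¹' octant, chaosG H d q 1 v.1 v.2.1 v.2.2 =
      ∫ v in octant, chaosG H d q 1 v.1 v.2.1 v.2.2 := by
    rw [← measurePreserving_exchange.setIntegral_preimage_emb measurableEmbedding_exchange
      (fun v => chaosG H d q 1 v.1 v.2.1 v.2.2) octant]
    exact setIntegral_congr_fun hm fun w _ => (chaosG_exchange d q 1 w).symm
  rw [halfOctants_eq, setIntegral_union₀ hd hm.nullMeasurableSet h hi, hr, two_mul]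

/-- The function that dominates the rescaled integrands. -/
def limitBound (H : ℝ) (d q : ℕ) (T : ℝ) (v : ℝ × ℝ × ℝ × ℝ) : ℝ :=
  (Set.Icc 0 T).indicator (fun _ => (1 : ℝ)) v.1 *
    halfOctants.indicator (fun w => chaosG H d q 1 w.1 w.2.1 w.2.2) v.2

theorem integrable_limitBound {d q : ℕ} (T : ℝ)
    (h : IntegrableOn (fun v : ℝ × ℝ × ℝ => chaosG H d q 1 v.1 v.2.1 v.2.2) octant) :
    Integrable (limitBound H d q T) :=
  Integrable.mul_prod ((integrable_indicator_iff measurableSet_Icc).2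
    (integrableOn_const (by simp))) ((integrable_indicator_iff measurableSet_halfOctants).2
      (integrableOn_halfOctants h))

/-- The integrand in the coordinates `(s, x, u₁, u₂)`, after the last three were divided by `r`. -/
def scaledIntegrand (H : ℝ) (d q : ℕ) (T T' r : ℝ) : ℝ × ℝ × ℝ × ℝ → ℝ :=
  (scaledDomain T T' r).indicator fun v => chaosG H d q 1 v.2.1 v.2.2.1 v.2.2.2

theorem measurable_scaledIntegrand (h0 : 0 < H) (d q : ℕ) (T T' r : ℝ) :
    Measurable (scaledIntegrand H d q T T' r) :=
  ((measurable_chaosG h0 d q).comp measurable_snd).indicator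
    (isClosed_scaledDomain T T' r).measurableSet

theorem norm_scaledIntegrand_le {d q : ℕ} {T T' r : ℝ} (hr : 0 < r) (v : ℝ × ℝ × ℝ × ℝ) :
    ‖scaledIntegrand H d q T T' r v‖ ≤ limitBound H d q T v := by
  rw [scaledIntegrand, limitBound]
  by_cases hv : v ∈ scaledDomain T T' r
  · obtain ⟨⟨h1, h2, h3⟩, h4, h5, h6⟩ := id hv
    have hs : v.1 ∈ Set.Icc 0 T := ⟨h1, by nlinarith⟩
    have hw : v.2 ∈ halfOctants := ⟨h2, h5⟩
    rw [Set.indicator_of_mem hv, Set.indicator_of_mem hs, Set.indicator_of_mem hw, one_mul,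
      Real.norm_of_nonneg (chaosG_nonneg d q _ h2 h5)]
  · rw [Set.indicator_of_notMem hv, norm_zero]
    exact mul_nonneg (Set.indicator_nonneg (fun _ _ => zero_le_one) _)
      (Set.indicator_nonneg (fun w hw => chaosG_nonneg d q _ hw.1 hw.2) _)

theorem integrable_scaledIntegrand (h0 : 0 < H) {d q : ℕ} {T T' r : ℝ} (hr : 0 < r)
    (h : IntegrableOn (fun v : ℝ × ℝ × ℝ => chaosG H d q 1 v.1 v.2.1 v.2.2) octant) :
    Integrable (scaledIntegrand H d q T T' r) :=
  Integrable.mono' (integrable_limitBound T h)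
    (measurable_scaledIntegrand h0 d q T T' r).aestronglyMeasurable
    (ae_of_all _ (norm_scaledIntegrand_le hr))

/-- Self-similarity turns the parameter `ε = r^{2H}` into the scale `r` of the domain. -/
theorem integral_chaosCov_eq (h0 : 0 < H) {d q : ℕ} {r : ℝ} (hr : 0 < r) (T T' : ℝ)
    (h : IntegrableOn (fun v : ℝ × ℝ × ℝ => chaosG H d q 1 v.1 v.2.1 v.2.2) octant) :
    ∫ p in simplex T, ∫ p' in simplex T', chaosCov H d q (r ^ (2 * H)) p p' =
      r ^ 3 * r ^ (-(2 * H * d)) * ∫ v, scaledIntegrand H d q T T' r v := by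
  set ε := r ^ (2 * H) with hε
  have hε0 : 0 < ε := by positivity
  have hS : MeasurableSet (simplex T ×ˢ simplex T') :=
    (isCompact_simplex T).measurableSet.prod (isCompact_simplex T').measurableSet
  have hi : IntegrableOn (fun z : (ℝ × ℝ) × (ℝ × ℝ) => chaosCov H d q ε z.1 z.2)
      (simplex T ×ˢ simplex T') :=
    (continuousOn_chaosCov h0 d q hε0 T T').integrableOn_compact
      ((isCompact_simplex T).prod (isCompact_simplex T'))
  have hmp := measurePreserving_intervalPair
  have hme := measurableEmbedding_intervalPair
  have e1 : ∫ p in simplex T, ∫ p' in simplex T', chaosCov H d q ε p p' =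
      ∫ v in scaledDomain T T' 1, chaosG H d q ε v.2.1 v.2.2.1 v.2.2.2 := by
    rw [← setIntegral_prod (fun z : (ℝ × ℝ) × (ℝ × ℝ) => chaosCov H d q ε z.1 z.2) hi,
      ← Measure.volume_eq_prod, ← hmp.setIntegral_preimage_emb hme, intervalPair_preimage]
    simp only [chaosCov_intervalPair]
  have hi2 : IntegrableOn (fun v : ℝ × ℝ × ℝ × ℝ => chaosG H d q ε v.2.1 v.2.2.1 v.2.2.2)
      (scaledDomain T T' 1) := by
    have h2 := (hmp.integrableOn_comp_preimage hme).2 hi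
    rw [intervalPair_preimage] at h2
    refine h2.congr_fun (fun v _ => ?_) (isClosed_scaledDomain T T' 1).measurableSet
    exact chaosCov_intervalPair d q ε v
  have hm := (isClosed_scaledDomain T T' 1).measurableSet
  have : (volume : Measure (ℝ × ℝ)).IsAddHaarMeasure :=
    Measure.prod.instIsAddHaarMeasure volume volume
  have : (volume : Measure (ℝ × ℝ × ℝ)).IsAddHaarMeasure :=
    Measure.prod.instIsAddHaarMeasure volume volume
  rw [e1, ← integral_indicator hm, Measure.volume_eq_prod,
    integral_prod _ ((integrable_indicator_iff hm).2 hi2),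
    integral_prod _ (integrable_scaledIntegrand h0 hr h), ← integral_const_mul]
  refine integral_congr_ae (ae_of_all _ fun s => ?_)
  simp only
  have hsc := Measure.integral_comp_smul (F := ℝ) (volume : Measure (ℝ × ℝ × ℝ))
    (fun w : ℝ × ℝ × ℝ => (scaledDomain T T' 1).indicator
      (fun v => chaosG H d q ε v.2.1 v.2.2.1 v.2.2.2) (s, w)) r
  have hfin : Module.finrank ℝ (ℝ × ℝ × ℝ) = 3 := by
    rw [Module.finrank_prod, Module.finrank_prod, Module.finrank_self]
  rw [hfin, abs_of_pos (by positivity), smul_eq_mul, ← div_eq_inv_mul,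
    eq_div_iff (by positivity)] at hsc
  rw [← hsc, mul_comm, mul_assoc]
  congr 1
  rw [← integral_const_mul]
  refine integral_congr_ae (ae_of_all _ fun w => ?_)
  simp only [scaledIntegrand]
  by_cases hv : (s, w) ∈ scaledDomain T T' r
  · rw [Set.indicator_of_mem hv, Set.indicator_of_mem ((scaledDomain_smul hr s w).2 hv)]
    exact chaosG_smul hr d q w.1 hv.1.2.1 hv.2.2.1
  · rw [Set.indicator_of_notMem hv, mul_zero,
      Set.indicator_of_notMem fun h => hv ((scaledDomain_smul hr s w).1 h)]

/-- Off the boundary values of `s` the rescaled integrand is eventually constant. -/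
theorem tendsto_scaledIntegrand (d q : ℕ) {T T' : ℝ} {v : ℝ × ℝ × ℝ × ℝ}
    (hv0 : v.1 ≠ 0) (hvT : v.1 ≠ T) (hvT' : v.1 ≠ T') :
    Tendsto (fun r => scaledIntegrand H d q T T' r v) (𝓝[>] 0)
      (𝓝 ((Set.Ioo 0 (min T T')).indicator (fun _ => (1 : ℝ)) v.1 *
        halfOctants.indicator (fun w => chaosG H d q 1 w.1 w.2.1 w.2.2) v.2)) := by
  obtain ⟨s, w⟩ := v
  simp only at hv0 hvT hvT'
  have hlim : ∀ a : ℝ, Tendsto (fun r : ℝ => s + r * a) (𝓝[>] 0) (𝓝 s) := fun a => by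
    have hc : Continuous fun r : ℝ => s + r * a := by fun_prop
    have := (hc.tendsto 0).mono_left (nhdsWithin_le_nhds (s := Set.Ioi 0))
    simpa using this
  have hlim' : Tendsto (fun r : ℝ => s + r * w.1 + r * w.2.2) (𝓝[>] 0) (𝓝 s) := by
    simpa only [add_assoc, ← mul_add] using hlim (w.1 + w.2.2)
  by_cases hw : w ∈ halfOctants
  · rw [Set.indicator_of_mem (s := halfOctants) hw]
    by_cases hs : s ∈ Set.Ioo 0 (min T T')
    · rw [Set.indicator_of_mem hs, one_mul]
      refine tendsto_const_nhds.congr' ?_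
      filter_upwards [(hlim w.2.1).eventually_lt_const (hs.2.trans_le (min_le_left _ _)),
        (hlim w.1).eventually_const_lt hs.1,
        hlim'.eventually_lt_const (hs.2.trans_le (min_le_right _ _))] with r h1 h2 h3
      rw [scaledIntegrand, Set.indicator_of_mem]
      exact ⟨⟨hs.1.le, hw.1, h1.le⟩, h2.le, hw.2, h3.le⟩
    · rw [Set.indicator_of_notMem hs, zero_mul]
      refine tendsto_const_nhds.congr' ?_
      suffices hout : ∀ᶠ r in 𝓝[>] (0 : ℝ), (s, w) ∉ scaledDomain T T' r by
        filter_upwards [hout] with r hr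
        rw [scaledIntegrand, Set.indicator_of_notMem hr]
      rcases hv0.lt_or_gt with h0 | h0
      · exact Eventually.of_forall fun r hr => absurd hr.1.1 (not_le.2 h0)
      rcases hvT.lt_or_gt with h1 | h1
      · rcases hvT'.lt_or_gt with h2 | h2
        · exact absurd ⟨h0, lt_min h1 h2⟩ hs
        · filter_upwards [hlim'.eventually_const_lt h2] with r h3 hr
          exact absurd hr.2.2.2 (not_le.2 h3)
      · filter_upwards [(hlim w.2.1).eventually_const_lt h1] with r h3 hr
        exact absurd hr.1.2.2 (not_le.2 h3)
  · rw [Set.indicator_of_notMem (s := halfOctants) hw, mul_zero]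
    refine tendsto_const_nhds.congr fun r => ?_
    rw [scaledIntegrand, Set.indicator_of_notMem]
    exact fun h => hw ⟨h.1.2.1, h.2.2.1⟩

theorem tendsto_integral_scaledIntegrand (h0 : 0 < H) {d q : ℕ} {T T' : ℝ} (hT : 0 ≤ T)
    (hT' : 0 ≤ T')
    (h : IntegrableOn (fun v : ℝ × ℝ × ℝ => chaosG H d q 1 v.1 v.2.1 v.2.2) octant) :
    Tendsto (fun r => ∫ v, scaledIntegrand H d q T T' r v) (𝓝[>] 0)
      (𝓝 (min T T' * (2 * ∫ v in octant, chaosG H d q 1 v.1 v.2.1 v.2.2))) := by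
  have hval : ∫ v : ℝ × ℝ × ℝ × ℝ, (Set.Ioo 0 (min T T')).indicator (fun _ => (1 : ℝ)) v.1 *
      halfOctants.indicator (fun w => chaosG H d q 1 w.1 w.2.1 w.2.2) v.2 =
      min T T' * (2 * ∫ v in octant, chaosG H d q 1 v.1 v.2.1 v.2.2) := by
    rw [Measure.volume_eq_prod, integral_prod_mul ((Set.Ioo 0 (min T T')).indicator fun _ => (1 : ℝ))
      (halfOctants.indicator fun w => chaosG H d q 1 w.1 w.2.1 w.2.2),
      integral_indicator measurableSet_Ioo, integral_indicator measurableSet_halfOctants,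
      setIntegral_halfOctants h]
    congr 1
    simp [le_min hT hT']
  rw [← hval]
  refine tendsto_integral_filter_of_dominated_convergence (limitBound H d q T)
    (Eventually.of_forall fun r => (measurable_scaledIntegrand h0 d q T T' r).aestronglyMeasurable)
    ?_ (integrable_limitBound T h) ?_
  · filter_upwards [self_mem_nhdsWithin] with r hr
    exact ae_of_all _ (norm_scaledIntegrand_le hr)
  · have hfin : ∀ᵐ s : ℝ, s ∉ ({0, T, T'} : Set ℝ) :=
      measure_eq_zero_iff_ae_notMem.1 ((Set.toFinite {0, T, T'}).measure_zero volume)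
    have hfin' : ∀ᵐ v : ℝ × ℝ × ℝ × ℝ, v.1 ∉ ({0, T, T'} : Set ℝ) :=
      Measure.quasiMeasurePreserving_fst.ae hfin
    filter_upwards [hfin'] with v hv
    simp only [Set.mem_insert_iff, Set.mem_singleton_iff, not_or] at hv
    exact tendsto_scaledIntegrand d q hv.1 hv.2.1 hv.2.2

theorem tendsto_integral_chaosCov (h0 : 0 < H) {d q : ℕ} {T T' : ℝ} (hT : 0 ≤ T)
    (hT' : 0 ≤ T')
    (h : IntegrableOn (fun v : ℝ × ℝ × ℝ => chaosG H d q 1 v.1 v.2.1 v.2.2) octant) :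
    Tendsto (fun ε : ℝ => ε ^ ((d : ℝ) - 3 / (2 * H)) *
        ∫ p in simplex T, ∫ p' in simplex T', chaosCov H d q ε p p') (𝓝[>] 0)
      (𝓝 (min T T' * (2 * ∫ v in octant, chaosG H d q 1 v.1 v.2.1 v.2.2))) := by
  have hp : 0 < (2 * H)⁻¹ := by positivity
  have hr : Tendsto (fun ε : ℝ => ε ^ (2 * H)⁻¹) (𝓝[>] 0) (𝓝[>] 0) := by
    refine tendsto_nhdsWithin_iff.2 ⟨?_, ?_⟩
    · have h1 := (Real.continuousAt_rpow_const 0 (2 * H)⁻¹ (Or.inr hp.le)).tendsto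
      rw [Real.zero_rpow hp.ne'] at h1
      exact h1.mono_left nhdsWithin_le_nhds
    · filter_upwards [self_mem_nhdsWithin] with ε hε
      exact Real.rpow_pos_of_pos hε _
  refine ((tendsto_integral_scaledIntegrand h0 hT hT' h).comp hr).congr' ?_
  filter_upwards [self_mem_nhdsWithin] with ε hε
  have hε' : (0 : ℝ) < ε := hε
  have h2 := integral_chaosCov_eq h0 (d := d) (q := q)
    (Real.rpow_pos_of_pos hε' (2 * H)⁻¹) T T' h
  have e : (ε ^ (2 * H)⁻¹) ^ (2 * H) = ε := by
    rw [← Real.rpow_mul hε'.le, inv_mul_cancel₀ (by positivity), Real.rpow_one]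
  rw [e] at h2
  have e2 : ε ^ ((d : ℝ) - 3 / (2 * H)) *
      ((ε ^ (2 * H)⁻¹) ^ 3 * (ε ^ (2 * H)⁻¹) ^ (-(2 * H * d))) = 1 := by
    rw [← Real.rpow_natCast, ← Real.rpow_mul hε'.le, ← Real.rpow_mul hε'.le,
      ← Real.rpow_add hε', ← Real.rpow_add hε', ← Real.rpow_zero ε]
    congr 1
    push_cast
    field_simp
    ring
  rw [h2, ← mul_assoc, e2, one_mul, Function.comp_apply]

end Limit

end SelfIntersection

end

theorem theorem3p1 {Ω : Type*} [MeasurableSpace Ω] (P : Measure Ω) [IsProbabilityMeasure P]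
    (d : ℕ) [NeZero d] (hd : 2 ≤ d) (H : ℝ) (hH₁ : 3 / (2 * (d : ℝ)) < H) (hH₂ : H < 3 / 4)
    (B : ℝ≥0 → Ω → EuclideanSpace ℝ (Fin d)) (hB : SelfIntersection.IsFBM H B P) :
    (∀ q : ℕ, 1 ≤ q →
      IntegrableOn (fun v : ℝ × ℝ × ℝ => SelfIntersection.G H B P q 1 v.1 v.2.1 v.2.2) SelfIntersection.octant ∧
      ∀ T₁ T₂ : ℝ, 0 ≤ T₁ → 0 ≤ T₂ →
        Tendsto
          (fun ε : ℝ => ε ^ ((d : ℝ) - 3 / (2 * H)) *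
            ∫ ω, SelfIntersection.multInt B P (2 * q) (SelfIntersection.kernel H B P q ε T₁) ω *
              SelfIntersection.multInt B P (2 * q) (SelfIntersection.kernel H B P q ε T₂) ω ∂P)
          (𝓝[>] 0) (𝓝 (SelfIntersection.sigmaSqChaos H B P q * min T₁ T₂))) ∧
    IntegrableOn (fun v : ℝ × ℝ × ℝ => SelfIntersection.F B P 1 v.1 v.2.1 v.2.2) SelfIntersection.octant ∧
    HasSum (fun q : ℕ => SelfIntersection.sigmaSqChaos H B P (q + 1)) (SelfIntersection.sigmaSq B P) := by
  open SelfIntersection in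
  have hd0 : (0 : ℝ) < d := by exact_mod_cast (by omega : 0 < d)
  have h0 : 0 < H := lt_trans (by positivity) hH₁
  have hHd : 3 / 2 < H * d := by
    rw [div_lt_iff₀ (by positivity)] at hH₁
    linarith
  have hG : ∀ q, Set.EqOn (fun v : ℝ × ℝ × ℝ => G H B P q 1 v.1 v.2.1 v.2.2)
      (fun v => chaosG H d q 1 v.1 v.2.1 v.2.2) octant := fun q v hv => by
    simp only [G, chaosG, hB.mu_eq_covMu hv.1 hv.2.1 hv.2.2]
  have hF : Set.EqOn (fun v : ℝ × ℝ × ℝ => F B P 1 v.1 v.2.1 v.2.2)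
      (fun v => covF H d v.1 v.2.1 v.2.2) octant := fun v hv =>
    hB.F_one_eq h0 hv.1 hv.2.1 hv.2.2
  have hσ : ∀ q, sigmaSqChaos H B P q =
      2 * (betaConst d q * ∫ v in octant, chaosG H d q 1 v.1 v.2.1 v.2.2) := fun q => by
    rw [sigmaSqChaos, setIntegral_congr_fun measurableSet_octant (hG q), mul_assoc]
  refine ⟨fun q hq => ?_, ?_, ?_⟩
  · have hi := integrableOn_chaosG (d := d) hd h0 hH₂ hHd hq
    refine ⟨hi.congr_fun (hG q).symm measurableSet_octant, fun T₁ T₂ hT₁ hT₂ => ?_⟩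
    have h := (tendsto_integral_chaosCov h0 hT₁ hT₂ hi).const_mul (betaConst d q)
    rw [hσ, show 2 * (betaConst d q * ∫ v in octant, chaosG H d q 1 v.1 v.2.1 v.2.2) * min T₁ T₂ =
      betaConst d q * (min T₁ T₂ * (2 * ∫ v in octant, chaosG H d q 1 v.1 v.2.1 v.2.2)) by ring]
    refine h.congr' ?_
    filter_upwards [self_mem_nhdsWithin] with ε hε
    rw [hB.integral_multInt_kernel h0 hq hε]
    ring
  · exact (integrableOn_covF hd h0 hH₂ hHd).congr_fun hF.symm measurableSet_octant
  · simp only [hσ]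
    rw [sigmaSq, setIntegral_congr_fun measurableSet_octant hF]
    exact (hasSum_integral_chaosG hd h0 hH₂ hHd).mul_left 2
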